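/- Let $\Gamma$ be a topological group. Let $\mathfrak S_\infty$ be the group of finite permutations of $\mathbb N$ (with the discrete topology), $\Gamma^\infty_e$ the group of sequences in $\Gamma$ with almost all entries equal to $e$ (with the inductive limit group topology, i.e. the finest group topology for which all inclusions $\Gamma^n\to\Gamma^\infty_e$ are continuous), and $\Gamma\wr\mathfrak S_\infty=\Gamma^\infty_e\rtimes\mathfrak S_\infty$ with the product topology, where $s\gamma s^{-1}=(\gamma_{s^{-1}(k)})_k$. A *character* of a topological group $G$ is a continuous, central, positive definite function $\phi$ with $\phi(e)=1$; it is *indecomposable* if its GNS representation is a factor-representation. **Data.** Let $\{\alpha_k\}$, $\{\beta_k\}$ be finite or infinite families of numbers in $(0,1)$, let $\varrho^{\alpha_k}$, $\varrho^{\beta_k}$ be continuous irreducible finite-dimensional unitary representations of $\Gamma$ in $\mathcal H^{\alpha_k}$, $\mathcal H^{\beta_k}$ with orthonormal bases $(\mathrm e_j^{(\alpha_k)})_j$, $(\mathrm e_j^{(\beta_k)})_j$, and suppose that $\sum_k\alpha_k\dim\varrho^{\alpha_k}+\sum_k\beta_k\dim\varrho^{\beta_k}\le 1$; let $\delta\ge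 0$ be $1$ minus this sum. Let $\varrho^0$ be a continuous unitary representation of $\Gamma$ in a Hilbert space $\mathcal H^0$ with a cyclic unit vector $\xi^{(0)}$ such that $tr^0(\gamma)=(\varrho^0(\gamma)\xi^{(0)},\xi^{(0)})$ is a central function. **Space.** Put $W=\bigoplus_k\mathcal H^{\alpha_k}\oplus\bigoplus_k\mathcal H^{\beta_k}$ and $\mathbf H=(W\otimes W)\oplus\bigoplus_{k\in\mathbb N}\mathcal H^{0k}$, where $(\mathcal H^{0k},\varrho^{0k},\xi^{(0k)})$ are copies of $(\mathcal H^0,\varrho^0,\xi^{(0)})$. The unit vectors $$\eta^{(m)}=\sum_k\sqrt{\alpha_k}\sum_j\mathrm e_j^{(\alpha_k)}\otimes\mathrm e_j^{(\alpha_k)}+\sum_k\sqrt{\beta_k}\sum_j\mathrm e_j^{(\beta_k)}\otimes\mathrm e_j^{(\beta_k)}+\sqrt\delta\,\xi^{(0m)}$$ define the infinite tensor product $\breve{\mathbf H}=\bigotimes_m(\mathbf H,\eta^{(m)})$; let $\breve\eta=\bigotimes_m\eta^{(m)}$. Let $\varrho$ be the representation $\big(\bigoplus_k\varrho^{\alpha_k}\oplus\bigoplus_k\varrho^{\beta_k}\big)\otimes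 I\,\oplus\,\bigoplus_k\varrho^{0k}$ of $\Gamma$ in $\mathbf H$. **Representation.** For $\gamma\in\Gamma^\infty_e$ set $\pi(\gamma)\bigotimes_m\zeta_m=\bigotimes_m\varrho(\gamma_m)\zeta_m$ whenever $\zeta_m=\eta^{(m)}$ for almost all $m$. For $s\in\mathfrak S_\infty$ fixing all $m\ge n$ and $\zeta=\bigotimes_m\zeta_m$ with $\zeta_m=\eta^{(m)}$ for $m\ge n$ and each $\zeta_m$, $m<n$, either of the form $\mathrm e_x\otimes\mathrm e_y$ (with $\mathrm e_x,\mathrm e_y$ in the chosen orthonormal basis of $W$) or in $\bigoplus_l\mathcal H^{0l}$, set $\pi(s)\zeta=\psi(s,\zeta)\,s(\zeta)$. Here $s(\zeta)$ agrees with $\zeta$ at the sites $m\ge n$ and is obtained by moving the first tensor factors $\mathrm e_x$, and the vectors of $\bigoplus_l\mathcal H^{0l}$, from the site $m$ to the site $s(m)$ for $m<n$, and by distributing the second tensor factors $\mathrm e_y$, in their original order, over the sites that receive a first tensor factor (so they stay in place if $s$ maps the set of sites $m<n$ of the form $\mathrm e_x\otimes\mathrm e_y$ to itself). The sign $\psi(s,\zeta)$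 is $(-1)$ to the number of pairs $i<j<n$ with $s(i)>s(j)$ such that the first tensor factors of both $\zeta_i$ and $\zeta_j$ exist and belong to $\bigoplus_k\mathcal H^{\beta_k}$. **Statement.** There is exactly one homomorphism $\pi$ of $\Gamma\wr\mathfrak S_\infty$ into the unitary group of $\breve{\mathbf H}$ satisfying these formulas; it is strongly continuous; and the function $\chi(g)=(\pi(g)\breve\eta,\breve\eta)$ is an indecomposable character of $\Gamma\wr\mathfrak S_\infty$. Moreover, for $s\in\mathfrak S_\infty$ and $\gamma\in\Gamma^\infty_e$, $$\chi(s\gamma)=\prod_{p\in\mathbb N/s}\Big\{\sum_k\alpha_k^{|p|}\,\mathrm{Tr}\,\varrho^{\alpha_k}(\tilde\gamma(p))+(-1)^{|p|-1}\sum_k\beta_k^{|p|}\,\mathrm{Tr}\,\varrho^{\beta_k}(\tilde\gamma(p))+\delta_p\,\delta\,tr^0(\tilde\gamma(p))\Big\},$$ where $\tilde\gamma(p)=\gamma_{s^{|p|-1}(k)}\cdots\gamma_{s(k)}\gamma_k$ for some $k\in p$, $\delta_p=1$ if $|p|=1$ and $\delta_p=0$ otherwise. -/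

import Mathlib

universe u

open Filter
open scoped ComplexOrder

noncomputable section

/-! ### The group `Γ ≀ 𝔖_∞` -/

/-- The subgroup of finite permutations of `ℕ`. -/
def finitaryPerm : Subgroup (Equiv.Perm ℕ) where
  carrier := {s | {i | s i ≠ i}.Finite}
  one_mem' := by simp
  mul_mem' := by
    intro s t hs ht
    refine (hs.union ht).subset fun i hi => ?_
    by_contra h
    simp only [Set.mem_union, Set.mem_ofPred_eq, not_or, not_not] at h
    exact hi (by rw [Equiv.Perm.mul_apply, h.2, h.1])
  inv_mem' := by
    intro s hs
    refine Set.Finite.subset hs fun i hi => ?_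
    intro h
    exact hi (by rw [Equiv.Perm.inv_eq_iff_eq]; exact h.symm)

/-- `𝔖_∞`. -/
def SInf : Type := finitaryPerm

instance : Group SInf := inferInstanceAs (Group finitaryPerm)

/-- `𝔖_∞` is discrete. -/
instance : TopologicalSpace SInf := ⊥

/-- The subgroup of sequences in `Γ` with finitely many entries different from `1`. -/
def finitarySeq (Γ : Type u) [Group Γ] : Subgroup (ℕ → Γ) where
  carrier := {γ | {k | γ k ≠ 1}.Finite}
  one_mem' := by simp
  mul_mem' := by
    intro s t hs ht
    refine (hs.union ht).subset fun i hi => ?_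
    by_contra h
    simp only [Set.mem_union, Set.mem_ofPred_eq, not_or, not_not] at h
    exact hi (by rw [Pi.mul_apply, h.2, h.1, one_mul])
  inv_mem' := by
    intro s hs
    refine Set.Finite.subset hs fun i hi => ?_
    intro h
    exact hi (by rw [Pi.inv_apply, h, inv_one])

/-- `Γ^∞_e`. A type synonym, so that it does not inherit the topology of pointwise convergence. -/
def GammaInf (Γ : Type u) [Group Γ] : Type u := finitarySeq Γ

instance (Γ : Type u) [Group Γ] : Group (GammaInf Γ) := inferInstanceAs (Group (finitarySeq Γ))

/-- The inclusion `Γ^n → Γ^∞_e`, `(γ_0, …, γ_{n-1}) ↦ (γ_0, …, γ_{n-1}, e, e, …)`. -/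
def GammaInf.incl (Γ : Type u) [Group Γ] (n : ℕ) (γ : Fin n → Γ) : GammaInf Γ :=
  ⟨fun k => if h : k < n then γ ⟨k, h⟩ else 1, by
    refine (Set.finite_Iio n).subset fun k hk => ?_
    by_contra h
    exact hk (dif_neg h)⟩

/-- The inductive limit topology on the group `Γ^∞_e`: the finest group topology for which all
the inclusions `Γ^n → Γ^∞_e` are continuous. -/
def GammaInf.groupTopology (Γ : Type u) [Group Γ] [TopologicalSpace Γ] :
    GroupTopology (GammaInf Γ) :=
  sInf {t | ∀ n, @Continuous (Fin n → Γ) (GammaInf Γ) _ t.toTopologicalSpace (GammaInf.incl Γ n)}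

instance (Γ : Type u) [Group Γ] [TopologicalSpace Γ] : TopologicalSpace (GammaInf Γ) :=
  (GammaInf.groupTopology Γ).toTopologicalSpace

/-- The action of `𝔖_∞` on `Γ^∞_e`: `(s • γ)_k = γ_{s⁻¹(k)}`. -/
def permAction (Γ : Type u) [Group Γ] : SInf →* MulAut (GammaInf Γ) where
  toFun s :=
    { toFun := fun γ => ⟨fun k => γ.1 (s.1.symm k), by
        refine (γ.2.image s.1).subset fun k hk => ⟨s.1.symm k, hk, by simp⟩⟩
      invFun := fun γ => ⟨fun k => γ.1 (s.1 k), by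
        refine (γ.2.image s.1.symm).subset fun k hk => ⟨s.1 k, hk, by simp⟩⟩
      left_inv := fun γ => Subtype.ext (by funext k; simp)
      right_inv := fun γ => Subtype.ext (by funext k; simp)
      map_mul' := fun _ _ => rfl }
  map_one' := rfl
  map_mul' _ _ := rfl

/-- The wreath product `Γ ≀ 𝔖_∞ = Γ^∞_e ⋊ 𝔖_∞`. -/
abbrev Wreath (Γ : Type u) [Group Γ] : Type u := GammaInf Γ ⋊[permAction Γ] SInf

/-- `Γ ≀ 𝔖_∞` carries the product topology of `Γ^∞_e × 𝔖_∞`. -/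
instance (Γ : Type u) [Group Γ] [TopologicalSpace Γ] : TopologicalSpace (Wreath Γ) :=
  TopologicalSpace.induced (fun g => (g.left, g.right)) inferInstance

/-! ### Unitary representations and characters -/

section Characters

variable {G : Type u} [Group G]
variable {H : Type*} [NormedAddCommGroup H] [InnerProductSpace ℂ H]

/-- Strong continuity of a representation by unitary operators. -/
def IsStronglyContinuous [TopologicalSpace G] (π : G →* (H ≃ₗᵢ[ℂ] H)) : Prop :=
  ∀ x : H, Continuous fun g => π g x

/-- `π(G)`, as a set of bounded operators. -/
def operatorRange (π : G →* (H ≃ₗᵢ[ℂ] H)) : Set (H →L[ℂ] H) :=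
  Set.range fun g => ((π g).toContinuousLinearEquiv : H →L[ℂ] H)

/-- `π` is a factor-representation: the von Neumann algebra `π(G)''` has trivial center. -/
def IsFactorRep (π : G →* (H ≃ₗᵢ[ℂ] H)) : Prop :=
  ∀ T : H →L[ℂ] H, T ∈ (operatorRange π).centralizer.centralizer →
    T ∈ (operatorRange π).centralizer.centralizer.centralizer →
    ∃ z : ℂ, T = z • ContinuousLinearMap.id ℂ H

/-- `ξ` is a cyclic vector of `π`. -/
def IsCyclicVector (π : G →* (H ≃ₗᵢ[ℂ] H)) (ξ : H) : Prop :=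
  (Submodule.span ℂ (Set.range fun g => π g ξ)).topologicalClosure = ⊤

/-- Characters: continuous, central, positive definite, normalized functions. -/
structure IsGroupCharacter [TopologicalSpace G] (φ : G → ℂ) : Prop where
  continuous : Continuous φ
  central : ∀ g h : G, φ (g * h) = φ (h * g)
  posDef : ∀ (n : ℕ) (g : Fin n → G), (Matrix.of fun j k => φ (g j * (g k)⁻¹)).PosSemidef
  normalized : φ 1 = 1

/-- An indecomposable character: a character whose GNS representation is a
factor-representation. The GNS representation of `φ` is the cyclic unitary representation
`(π, H, ξ)` with `φ(g) = (π(g)ξ, ξ)`, which is unique up to unitary equivalence. -/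
def IsIndecomposableCharacter [TopologicalSpace G] (φ : G → ℂ) : Prop :=
  IsGroupCharacter φ ∧
    ∃ (H : Type u) (_ : NormedAddCommGroup H) (_ : InnerProductSpace ℂ H) (_ : CompleteSpace H)
      (π : G →* (H ≃ₗᵢ[ℂ] H)) (ξ : H),
      IsStronglyContinuous π ∧ IsCyclicVector π ξ ∧ (∀ g, φ g = inner ℂ ξ (π g ξ)) ∧
        IsFactorRep π

end Characters

/-! ### The infinite tensor product `⊗_m (H, η_m)` -/

section InfiniteTensor

variable {H : Type u} [NormedAddCommGroup H] [InnerProductSpace ℂ H]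

/-- Sequences `(ζ_m)` of vectors with `ζ_m = η_m` for all but finitely many `m`. -/
abbrev TensorSeq (η : ℕ → H) : Type u := {ζ : ℕ → H // ∀ᶠ m in atTop, ζ m = η m}

/-- The kernel `(ζ, ζ') ↦ ∏_m (ζ_m, ζ'_m)`; if `‖η_m‖ = 1` for all `m`, then all but finitely
many factors are `1`. -/
def tensorKernel (η : ℕ → H) (_hη : ∀ m, ‖η m‖ = 1) :
    Matrix (TensorSeq η) (TensorSeq η) (ℂ →L[ℂ] ℂ) :=
  Matrix.of fun ζ ζ' => (∏ᶠ m, inner ℂ (ζ.1 m) (ζ'.1 m)) • (1 : ℂ →L[ℂ] ℂ)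

theorem tensorKernel_finite (η : ℕ → H) (hη : ∀ m, ‖η m‖ = 1) (ζ ζ' : TensorSeq η) :
    ∃ n, ∀ N ≥ n, (∏ᶠ m, inner ℂ (ζ.1 m) (ζ'.1 m)) =
      ∏ m ∈ Finset.range N, inner ℂ (ζ.1 m) (ζ'.1 m) := by
  obtain ⟨n, hn⟩ := eventually_atTop.1 (ζ.2.and ζ'.2)
  refine ⟨n, fun N hN => finprod_eq_prod_of_mulSupport_subset _ fun m hm => ?_⟩
  by_contra h
  have hm' : n ≤ m := hN.trans (by simpa using h)
  refine hm ?_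
  show inner ℂ (ζ.1 m) (ζ'.1 m) = 1
  rw [(hn m hm').1, (hn m hm').2, inner_self_eq_norm_sq_to_K, hη]
  simp

theorem posSemidef_prod_inner {X : Type*} [Finite X] (f : X → ℕ → H) (N : ℕ) :
    (Matrix.of fun x y => ∏ m ∈ Finset.range N, inner ℂ (f x m) (f y m)).PosSemidef := by
  induction N with
  | zero =>
    have h : (Matrix.of fun x y => ∏ m ∈ Finset.range 0, inner ℂ (f x m) (f y m)) =
        Matrix.gram ℂ (fun _ : X => (1 : ℂ)) := by
      ext x y
      simp [Matrix.gram]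
    rw [h]
    exact Matrix.posSemidef_gram ℂ _
  | succ N ih =>
    have h : (Matrix.of fun x y => ∏ m ∈ Finset.range (N + 1), inner ℂ (f x m) (f y m)) =
        (Matrix.of fun x y => ∏ m ∈ Finset.range N, inner ℂ (f x m) (f y m)).hadamard
          (Matrix.gram ℂ (fun x => f x N)) := by
      ext x y
      simp [Matrix.gram, Finset.prod_range_succ]
    rw [h]
    exact ih.hadamard (Matrix.posSemidef_gram ℂ (fun x => f x N))

theorem tensorKernel_posSemidef (η : ℕ → H) (hη : ∀ m, ‖η m‖ = 1) :
    (tensorKernel η hη).PosSemidef := by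
  have h := (RKHS.posSemidef_tfae (K := tensorKernel η hη)).out 0 2
  refine h.2 ⟨?_, fun v => ?_⟩
  · ext x y
    simp only [tensorKernel, Matrix.conjTranspose_apply, Matrix.of_apply]
    obtain ⟨n, hn⟩ := tensorKernel_finite η hη x y
    obtain ⟨n', hn'⟩ := tensorKernel_finite η hη y x
    rw [hn (max n n') (le_max_left _ _), hn' (max n n') (le_max_right _ _)]
    simp
  · choose n hn using tensorKernel_finite η hη
    obtain ⟨N, hN⟩ : ∃ N, ∀ x ∈ v.support, ∀ y ∈ v.support, n x y ≤ N := by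
      refine ⟨v.support.sup fun x => v.support.sup fun y => n x y, fun x hx y hy => ?_⟩
      exact (Finset.le_sup (f := fun y => n x y) hy).trans
        (Finset.le_sup (f := fun x => v.support.sup fun y => n x y) hx)
    have key := (posSemidef_prod_inner (fun x : v.support => x.1.1) N).2
      (Finsupp.equivFunOnFinite.symm fun x => v x.1)
    rw [Finsupp.sum_fintype _ _ (by simp)] at key
    conv at key =>
      enter [2, 2, x]
      rw [Finsupp.sum_fintype _ _ (by simp)]
    refine ((RCLike.nonneg_iff (K := ℂ)).1 key).1.trans_eq (congrArg _ ?_)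
    refine Eq.trans (Finset.sum_congr rfl fun x _ => ?_) (Finset.sum_coe_sort v.support _)
    refine Eq.trans (Finset.sum_congr rfl fun y _ => ?_) (Finset.sum_coe_sort v.support _)
    simp [tensorKernel, hn _ _ N (hN y.1 y.2 x.1 x.2), map_prod]
    ring

instance (η : ℕ → H) (hη : ∀ m, ‖η m‖ = 1) : Fact (tensorKernel η hη).PosSemidef :=
  ⟨tensorKernel_posSemidef η hη⟩

/-- The infinite tensor product `⊗_m (H, η_m)`: the Hilbert space spanned by the product vectors
`⊗_m ζ_m` with `ζ_m = η_m` for almost all `m`, where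
`(⊗_m ζ_m, ⊗_m ζ'_m) = ∏_m (ζ_m, ζ'_m)`. -/
abbrev InfTensor (η : ℕ → H) (hη : ∀ m, ‖η m‖ = 1) : Type u :=
  RKHS.OfKernel (tensorKernel η hη)

open Classical in
/-- The product vector `⊗_m ζ_m`, for a sequence with `ζ_m = η_m` for almost all `m` (and the
junk value `0` for other sequences). -/
def productVector (η : ℕ → H) (hη : ∀ m, ‖η m‖ = 1) (ζ : ℕ → H) : InfTensor η hη :=
  if h : ∀ᶠ m in atTop, ζ m = η m then
    RKHS.kerFun (InfTensor η hη) (⟨ζ, h⟩ : TensorSeq η) (1 : ℂ) else 0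

theorem inner_productVector (η : ℕ → H) (hη : ∀ m, ‖η m‖ = 1) (ζ ζ' : ℕ → H)
    (h : ∀ᶠ m in atTop, ζ m = η m) (h' : ∀ᶠ m in atTop, ζ' m = η m) :
    inner ℂ (productVector η hη ζ) (productVector η hη ζ') =
      ∏ᶠ m, inner ℂ (ζ m) (ζ' m) := by
  rw [productVector, productVector, dif_pos h, dif_pos h', ← RKHS.kernel_inner,
    RKHS.OfKernel.kernel_ofKernel]
  obtain ⟨n, hn⟩ := tensorKernel_finite η hη ⟨ζ, h⟩ ⟨ζ', h'⟩
  obtain ⟨n', hn'⟩ := tensorKernel_finite η hη ⟨ζ', h'⟩ ⟨ζ, h⟩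
  have h1 := hn (max n n') (le_max_left _ _)
  have h2 := hn' (max n n') (le_max_right _ _)
  simp only at h1 h2
  simp [tensorKernel, h1, h2, map_prod]

theorem span_productVector (η : ℕ → H) (hη : ∀ m, ‖η m‖ = 1) :
    (Submodule.span ℂ (productVector η hη '' {ζ | ∀ᶠ m in atTop, ζ m = η m})).topologicalClosure
      = ⊤ := by
  rw [eq_top_iff, ← RKHS.kerFun_dense (InfTensor η hη)]
  refine Submodule.topologicalClosure_mono (Submodule.span_le.2 ?_)
  rintro _ ⟨ζ, v, rfl⟩
  have : RKHS.kerFun (InfTensor η hη) ζ v = v • productVector η hη ζ.1 := by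
    rw [productVector, dif_pos ζ.2, ← map_smul, smul_eq_mul, mul_one]
  rw [this]
  exact Submodule.smul_mem _ _ (Submodule.subset_span ⟨ζ.1, ζ.2, rfl⟩)

end InfiniteTensor

/-! ### The representation -/

/-- The data of the construction. The index set of all `α_k` and `β_k` is `ι ⊕ κ`, with `ι`
enumerating the `α`'s and `κ` the `β`'s; for `r : ι ⊕ κ`, `a r` is the number, `ρ r` the
representation on `E r` and `e r` the chosen orthonormal basis of `E r`. -/
structure OlshanskiData (Γ : Type u) [Group Γ] [TopologicalSpace Γ] where
  ι : Type
  κ : Type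
  /-- the numbers `α_k = a (inl k)` and `β_k = a (inr k)` -/
  a : ι ⊕ κ → ℝ
  a_pos : ∀ r, 0 < a r
  a_lt_one : ∀ r, a r < 1
  /-- the spaces of the finite-dimensional representations -/
  E : ι ⊕ κ → Type u
  [instE : ∀ r, NormedAddCommGroup (E r)]
  [instE' : ∀ r, InnerProductSpace ℂ (E r)]
  [instE'' : ∀ r, FiniteDimensional ℂ (E r)]
  /-- the representations `ϱ^{α_k}` and `ϱ^{β_k}` -/
  ρ : ∀ r, Γ →* (E r ≃ₗᵢ[ℂ] E r)
  ρ_cont : ∀ r, IsStronglyContinuous (ρ r)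
  nontriv : ∀ r, Nontrivial (E r)
  irred : ∀ r, ∀ W : Submodule ℂ (E r), (∀ γ, ∀ v ∈ W, ρ r γ v ∈ W) → W = ⊥ ∨ W = ⊤
  e : ∀ r, OrthonormalBasis (Fin (Module.finrank ℂ (E r))) ℂ (E r)
  summable : Summable fun r => a r * Module.finrank ℂ (E r)
  sum_le_one : ∑' r, a r * Module.finrank ℂ (E r) ≤ 1
  /-- the Hilbert space of `ϱ⁰` -/
  H0 : Type u
  [instH : NormedAddCommGroup H0]
  [instH' : InnerProductSpace ℂ H0]
  [instH'' : CompleteSpace H0]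
  /-- the representation `ϱ⁰` -/
  ρ0 : Γ →* (H0 ≃ₗᵢ[ℂ] H0)
  ρ0_cont : IsStronglyContinuous ρ0
  /-- the cyclic vector `ξ⁰`, whose vector state is a trace -/
  ξ0 : H0
  ξ0_norm : ‖ξ0‖ = 1
  ξ0_cyclic : IsCyclicVector ρ0 ξ0
  ξ0_trace : ∀ γ γ', inner ℂ ξ0 (ρ0 (γ * γ') ξ0) = inner ℂ ξ0 (ρ0 (γ' * γ) ξ0)

attribute [instance] OlshanskiData.instE OlshanskiData.instE' OlshanskiData.instE''
  OlshanskiData.instH OlshanskiData.instH' OlshanskiData.instH''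

/-- The Hilbert direct sum of a family of unitary operators. -/
def lpUnitary {I : Type*} {F : I → Type*} [∀ i, NormedAddCommGroup (F i)]
    [∀ i, InnerProductSpace ℂ (F i)] (U : ∀ i, F i ≃ₗᵢ[ℂ] F i) (f : lp F 2) : lp F 2 :=
  ⟨fun i => U i (f i), Memℓp.of_norm (by simpa using (lp.memℓp f).norm)⟩

namespace OlshanskiData

variable {Γ : Type u} [Group Γ] [TopologicalSpace Γ] (D : OlshanskiData Γ)

/-- `δ = 1 - ∑ α_k dim ϱ^{α_k} - ∑ β_k dim ϱ^{β_k}`. -/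
def δ : ℝ := 1 - ∑' r, D.a r * Module.finrank ℂ (D.E r)

/-- Labels `x = (r, j)` of the orthonormal basis `e_x = e_j^{(r)}` of
`⊕_k H^{α_k} ⊕_k H^{β_k}`. -/
abbrev Leg : Type := Σ r : D.ι ⊕ D.κ, Fin (Module.finrank ℂ (D.E r))

/-- The tensor square of `⊕_k H^{α_k} ⊕_k H^{β_k}`, written as the Hilbert direct sum of the
spaces `H^{r} ⊗ e_y` over all `r` and all basis vectors `e_y` of the second factor. -/
abbrev TensorPart : Type u := lp (fun p : (D.ι ⊕ D.κ) × D.Leg => D.E p.1) 2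

/-- The Hilbert direct sum `⊕_k H^{0k}` of countably many copies of `H⁰`. -/
abbrev ZeroPart : Type u := lp (fun _ : ℕ => D.H0) 2

/-- The Hilbert space `𝐇`. -/
abbrev Site : Type u := WithLp 2 (D.TensorPart × D.ZeroPart)

/-- The vectors of `⊕_k H^{0k}`, as vectors of `𝐇`. -/
def zeroVec (h : D.ZeroPart) : D.Site := WithLp.toLp 2 (0, h)

open Classical in
/-- The vector `e_x ⊗ e_y` of `𝐇`. -/
def tensorVec (x y : D.Leg) : D.Site := WithLp.toLp 2 (lp.single 2 (x.1, y) (D.e x.1 x.2), 0)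

/-- The vector `√a_r ∑_j e_j^{(r)} ⊗ e_j^{(r)}`, where `a_r` is one of the `α_k` and `β_k`. -/
def ηTerm (r : D.ι ⊕ D.κ) : D.Site :=
  ((√(D.a r) : ℝ) : ℂ) • ∑ j, D.tensorVec ⟨r, j⟩ ⟨r, j⟩

/-- The part `∑_k √α_k ∑_j e_j ⊗ e_j + ∑_k √β_k ∑_j e_j ⊗ e_j` of `η_m`. -/
def ηTensor : D.Site := ∑' r, D.ηTerm r

/-- The vector `η_m = ∑_k √α_k ∑_j e_j ⊗ e_j + ∑_k √β_k ∑_j e_j ⊗ e_j + √δ ξ^{(0m)}`, where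
`ξ^{(0m)}` is the copy of `ξ⁰` in the `m`-th summand of `⊕_k H^{0k}`. -/
def η (m : ℕ) : D.Site :=
  D.ηTensor + ((√D.δ : ℝ) : ℂ) • D.zeroVec (lp.single 2 m D.ξ0)

/-- The representation `ϱ` of `Γ` in `𝐇`: it acts on the first tensor factors and on the
spaces `H^{0k}`. -/
def siteRep (γ : Γ) (v : D.Site) : D.Site :=
  WithLp.toLp 2 (lpUnitary (fun p : (D.ι ⊕ D.κ) × D.Leg => D.ρ p.1 γ) v.fst,
    lpUnitary (fun _ : ℕ => D.ρ0 γ) v.snd)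

theorem inner_tensorVec (x y x' y' : D.Leg) :
    inner ℂ (D.tensorVec x y) (D.tensorVec x' y') =
      open Classical in if x = x' ∧ y = y' then 1 else 0 := by
  classical
  obtain ⟨r, j⟩ := x
  obtain ⟨r', j'⟩ := x'
  simp only [tensorVec, WithLp.prod_inner_apply, inner_zero_left, add_zero]
  rw [lp.inner_single_left]
  by_cases h : r = r'
  · subst h
    by_cases hy : y = y'
    · subst hy
      simp [OrthonormalBasis.inner_eq_ite]
    · rw [lp.single_apply_ne _ _ _ (by simpa using hy)]
      simp [hy]
  · rw [lp.single_apply_ne _ _ _ (by simp [h])]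
    simp [h]

theorem inner_ηTerm (r r' : D.ι ⊕ D.κ) :
    inner ℂ (D.ηTerm r) (D.ηTerm r') =
      open Classical in if r = r' then ((D.a r * Module.finrank ℂ (D.E r) : ℝ) : ℂ) else 0 := by
  classical
  simp only [ηTerm, inner_smul_left, inner_smul_right, sum_inner, inner_sum, inner_tensorVec]
  by_cases h : r = r'
  · subst h
    have : ((√(D.a r) : ℝ) : ℂ) * ((√(D.a r) : ℝ) : ℂ) = (D.a r : ℂ) := by
      rw [← Complex.ofReal_mul, Real.mul_self_sqrt (D.a_pos r).le]
    simp only [Complex.conj_ofReal, ← Finset.mul_sum]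
    rw [← mul_assoc, this]
    simp
  · simp [h]

theorem norm_ηTerm_sq (r : D.ι ⊕ D.κ) : ‖D.ηTerm r‖ ^ 2 = D.a r * Module.finrank ℂ (D.E r) := by
  have h := D.inner_ηTerm r r
  rw [inner_self_eq_norm_sq_to_K, if_pos rfl] at h
  exact Complex.ofReal_injective ((Complex.ofReal_pow _ _).trans h)

theorem summable_ηTerm : Summable D.ηTerm := by
  classical
  have : ∀ r, CompleteSpace (D.E r) := fun r => FiniteDimensional.complete ℂ (D.E r)
  have hO : OrthogonalFamily ℂ (fun r => Submodule.span ℂ {D.ηTerm r})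
      fun r => (Submodule.span ℂ {D.ηTerm r}).subtypeₗᵢ := by
    refine OrthogonalFamily.of_pairwise fun r r' hr => ?_
    refine Submodule.isOrtho_span.2 ?_
    rintro u rfl v rfl
    rw [inner_ηTerm, if_neg hr]
  have h := hO.summable_iff_norm_sq_summable
    (fun r => ⟨D.ηTerm r, Submodule.mem_span_singleton_self _⟩)
  refine h.2 ?_
  simp only [Submodule.coe_norm, norm_ηTerm_sq]
  exact D.summable

theorem inner_ηTensor : inner ℂ D.ηTensor D.ηTensor =
    ((∑' r, D.a r * Module.finrank ℂ (D.E r) : ℝ) : ℂ) := by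
  classical
  have hs := D.summable_ηTerm.hasSum
  have h1 : HasSum (fun r => inner ℂ (D.ηTerm r) D.ηTensor) (inner ℂ D.ηTensor D.ηTensor) := by
    have := (innerSLFlip ℂ D.ηTensor).hasSum hs
    simp only [innerSLFlip_apply_apply] at this
    exact this
  have h2 : ∀ r, inner ℂ (D.ηTerm r) D.ηTensor =
      ((D.a r * Module.finrank ℂ (D.E r) : ℝ) : ℂ) := by
    intro r
    have h := (innerSL ℂ (D.ηTerm r)).hasSum hs
    simp only [innerSL_apply_apply, inner_ηTerm] at h
    refine h.unique ?_
    have h' := hasSum_ite_eq r ((D.a r * Module.finrank ℂ (D.E r) : ℝ) : ℂ)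
    simpa only [eq_comm] using h'
  simp only [h2] at h1
  rw [← h1.tsum_eq, Complex.ofReal_tsum]

theorem δ_nonneg : 0 ≤ D.δ := sub_nonneg.2 D.sum_le_one

theorem inner_tensorVec_zeroVec (x y : D.Leg) (h : D.ZeroPart) :
    inner ℂ (D.tensorVec x y) (D.zeroVec h) = 0 := by
  simp [tensorVec, zeroVec, WithLp.prod_inner_apply]

theorem inner_ηTensor_zeroVec (h : D.ZeroPart) : inner ℂ D.ηTensor (D.zeroVec h) = 0 := by
  have h1 := (innerSLFlip ℂ (D.zeroVec h)).hasSum D.summable_ηTerm.hasSum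
  simp only [innerSLFlip_apply_apply, ηTerm, inner_smul_left, sum_inner,
    inner_tensorVec_zeroVec, Finset.sum_const_zero, mul_zero] at h1
  exact h1.unique hasSum_zero

theorem norm_zeroVec (h : D.ZeroPart) : ‖D.zeroVec h‖ = ‖h‖ := by
  simp [zeroVec]

theorem norm_η (m : ℕ) : ‖D.η m‖ = 1 := by
  have h0 : inner ℂ D.ηTensor (((√D.δ : ℝ) : ℂ) • D.zeroVec (lp.single 2 m D.ξ0)) = 0 := by
    rw [inner_smul_right, inner_ηTensor_zeroVec, mul_zero]
  have h1 := norm_add_sq_eq_norm_sq_add_norm_sq_of_inner_eq_zero _ _ h0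
  have h2 : ‖D.ηTensor‖ * ‖D.ηTensor‖ = ∑' r, D.a r * Module.finrank ℂ (D.E r) := by
    have h := D.inner_ηTensor
    rw [inner_self_eq_norm_sq_to_K] at h
    rw [← sq]
    exact Complex.ofReal_injective ((Complex.ofReal_pow _ _).trans h)
  have h3 : ‖((√D.δ : ℝ) : ℂ) • D.zeroVec (lp.single 2 m D.ξ0)‖ = √D.δ := by
    rw [norm_smul, norm_zeroVec, lp.norm_single (by norm_num), D.ξ0_norm, mul_one,
      Complex.norm_real, Real.norm_of_nonneg (Real.sqrt_nonneg _)]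
  rw [h2, h3, Real.mul_self_sqrt D.δ_nonneg, δ, add_sub_cancel] at h1
  change ‖D.η m‖ * ‖D.η m‖ = 1 at h1
  nlinarith [norm_nonneg (D.η m)]

/-- The infinite tensor product `⊗_m (𝐇, η_m)`. -/
abbrev Space : Type u := InfTensor D.η D.norm_η

/-- The product vector `⊗_m ζ_m`. -/
abbrev prodVec (ζ : ℕ → D.Site) : D.Space := productVector D.η D.norm_η ζ

/-- The vector `⊗_m η_m`. -/
abbrev vacuum : D.Space := D.prodVec D.η

/-- What a site of a product vector may be filled with: `inl (x, y)` stands for `e_x ⊗ e_y` and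
`inr h` for the vector `h` of `⊕_k H^{0k}`. -/
abbrev Filling : Type u := (D.Leg × D.Leg) ⊕ D.ZeroPart

/-- The vector of `𝐇` described by a filling. -/
def fillVec : D.Filling → D.Site := Sum.elim (fun p => D.tensorVec p.1 p.2) D.zeroVec

/-- The vector `ζ_0 ⊗ … ⊗ ζ_{n-1} ⊗ η_n ⊗ η_{n+1} ⊗ …`, where `ζ_m` is described by `c m`. -/
def config (n : ℕ) (c : ℕ → D.Filling) : D.Space :=
  D.prodVec fun m => if m < n then D.fillVec (c m) else D.η m

/-- `ζ_m` is of the form `e_x ⊗ e_y`. -/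
def IsTensorSite (c : ℕ → D.Filling) (m : ℕ) : Prop := (c m).isLeft

/-- `ζ_m` is of the form `e_j^{(β_k)} ⊗ e_y`. -/
def IsBetaSite (c : ℕ → D.Filling) (m : ℕ) : Prop := ∃ x y, c m = Sum.inl (x, y) ∧ x.1.isRight

open Classical in
/-- The site of `ζ` whose second tensor factor is found at the site `k` of `s(ζ)`: the second
tensor factors keep their linear order. If `s` maps the set of sites of the form `e_x ⊗ e_y` to
itself, then this is `k`. -/
def secondSource (s : Equiv.Perm ℕ) (c : ℕ → D.Filling) (k : ℕ) : ℕ :=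
  Nat.nth (D.IsTensorSite c) (Nat.count (fun m => D.IsTensorSite c (s.symm m)) k)

/-- The filling of the sites of `s(ζ)`: the first tensor factors and the vectors of `⊕_k H^{0k}`
are moved from the site `s⁻¹(k)` to the site `k`, the second tensor factors are filled in, in
their order, at the sites which receive a first tensor factor. -/
def move (s : Equiv.Perm ℕ) (c : ℕ → D.Filling) (k : ℕ) : D.Filling :=
  match c (s.symm k), c (D.secondSource s c k) with
  | Sum.inl (x, _), Sum.inl (_, y) => Sum.inl (x, y)
  | other, _ => other

/-- The sign `ψ(s, ζ)` of the permutation which brings the images under `s` of the sites of the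
form `e_j^{(β_k)} ⊗ e_y` back into their order: `(-1)` to the number of inversions of `s` on the
set of these sites. -/
def sign (s : Equiv.Perm ℕ) (c : ℕ → D.Filling) : ℂ :=
  (-1) ^ {p : ℕ × ℕ | p.1 < p.2 ∧ D.IsBetaSite c p.1 ∧ D.IsBetaSite c p.2 ∧
    s p.2 < s p.1}.ncard

/-- `π` is the representation of `Γ ≀ 𝔖_∞` in `⊗_m (𝐇, η_m)` given by
`π(γ) (⊗_m ζ_m) = ⊗_m ϱ(γ_m) ζ_m` and `π(s) ζ = ψ(s, ζ) s(ζ)`. -/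
structure IsRealization (π : Wreath Γ →* (D.Space ≃ₗᵢ[ℂ] D.Space)) : Prop where
  colour : ∀ (γ : GammaInf Γ) (ζ : ℕ → D.Site), (∀ᶠ m in atTop, ζ m = D.η m) →
    π (SemidirectProduct.inl γ) (D.prodVec ζ) = D.prodVec fun m => D.siteRep (γ.1 m) (ζ m)
  perm : ∀ (s : SInf) (n : ℕ), (∀ m, n ≤ m → s.1 m = m) → ∀ c : ℕ → D.Filling,
    π (SemidirectProduct.inr s) (D.config n c) = D.sign s.1 c • D.config n (D.move s.1 c)

/-- The function `χ(g) = (π(g) η, η)`. -/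
def coefficient (π : Wreath Γ →* (D.Space ≃ₗᵢ[ℂ] D.Space)) (g : Wreath Γ) : ℂ :=
  inner ℂ D.vacuum (π g D.vacuum)

/-- For the cycle `p = (k → s(k) → … → s^{l-1}(k) → k)` of `s`, the product
`γ_{s^{l-1}(k)} ⋯ γ_{s(k)} γ_k`. -/
def cycleProduct (s : SInf) (γ : GammaInf Γ) (k : ℕ) : Γ :=
  ((List.range (Function.minimalPeriod s.1 k)).map fun i => γ.1 ((s.1 ^ i) k)).reverse.prod

/-- The contribution of a cycle of length `l` with cycle product `γ` to the character. -/
def cycleFactor (l : ℕ) (γ : Γ) : ℂ :=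
  (∑' r, (Sum.elim (fun _ => 1) (fun _ => (-1) ^ (l - 1)) r : ℂ) * (D.a r : ℂ) ^ l *
      LinearMap.trace ℂ (D.E r) ((D.ρ r γ).toLinearEquiv : D.E r →ₗ[ℂ] D.E r)) +
    if l = 1 then (D.δ : ℂ) * inner ℂ D.ξ0 (D.ρ0 γ D.ξ0) else 0

/-- The character value at `s · γ`: the product of the contributions of all cycles of `s`. -/
def characterValue (s : SInf) (γ : GammaInf Γ) : ℂ :=
  ∏ᶠ p : Quotient (Equiv.Perm.SameCycle.setoid s.1),
    D.cycleFactor (Function.minimalPeriod s.1 p.out) (cycleProduct s γ p.out)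

end OlshanskiData
end

/-! Existence rests on one principle: a family with dense span can be mapped isometrically to any
family with the same Gram matrix (`SpansDense.exists_isometry`). For `Γ^∞_e` the family consists of
all product vectors. For `𝔖_∞` it consists of product vectors whose entries are `v ⊗ e_y`, with `v`
an arbitrary vector of some `E r`, or vectors of `⊕_k H^{0k}`. Allowing arbitrary `v` makes the
family stable under `Γ`, so the semidirect product relation can be checked on it. Inner products of
such vectors factor into contributions of first tensor factors, of second tensor factors and of `⊕_k
H^{0k}`, and each of these is merely rearranged by `s`. Entries of different grade are orthogonal,
so signs are only compared where they agree (`gsign_mul_prod`). Multiplicativity in `s` holds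
because order preserving matchings compose and inversion signs form a cocycle (`moveFill_mul`,
`inversionSign_mul`).

Strong continuity reduces to each `Γ^n`, because the topology of pointwise convergence of a unitary
representation is a group topology (`GammaInf.continuous_rep`).

For the character formula, the vector acted on is truncated to finitely many `r` and expanded over
colourings of `{0, …, n-1}` by the terms of `η_m`. A colouring contributes a sign times a product of
matrix entries from the colour at `m` to the colour at `s m`. Nonzero contributions have
`β`-coloured sites forming a union of cycles, so the inversion sign is the sign of a permutation, a
product of `(-1)^(l-1)`. The sum then factors over cycles into traces
(`sum_inversionSign_mul_prod`). Copies of `H⁰` at different sites are orthogonal, hence `δ tr⁰`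
enters only at fixed points. The truncation is removed by continuity.

The formula yields centrality, since conjugation permutes cycles and conjugates cycle products, and
multiplicativity on elements with disjoint supports (`characterValue_mul`). Indecomposability
follows: for `T` in the center, `h ↦ (Tξ, π(h)ξ)` is invariant under conjugation. Moving `h` to
infinity by conjugation makes it asymptotically independent of everything else, so this function is
`(Tξ, ξ)(ξ, π(h)ξ)`, and `T` is scalar (`IsFactorRep.of_asymptotic_mul`). -/

noncomputable section

/-! ### Hilbert space preliminaries -/

section Hilbert

variable {H : Type*} [NormedAddCommGroup H] [InnerProductSpace ℂ H]
variable {H' : Type*} [NormedAddCommGroup H'] [InnerProductSpace ℂ H']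
variable {I : Type*}

/-- The family `v` spans a dense subspace. -/
def SpansDense (v : I → H) : Prop := (Submodule.span ℂ (Set.range v)).topologicalClosure = ⊤

theorem SpansDense.dense {v : I → H} (hv : SpansDense v) :
    Dense (Submodule.span ℂ (Set.range v) : Set H) :=
  (Submodule.dense_iff_topologicalClosure_eq_top).2 hv

theorem SpansDense.of_forall_inner [CompleteSpace H] {v : I → H}
    (h : ∀ x, (∀ i, inner ℂ (v i) x = 0) → x = 0) : SpansDense v := by
  rw [SpansDense, Submodule.topologicalClosure_eq_top_iff, Submodule.eq_bot_iff]
  intro x hx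
  exact h x fun i => (Submodule.mem_orthogonal _ x).1 hx _ (Submodule.subset_span ⟨i, rfl⟩)

theorem SpansDense.eq_zero {v : I → H} (hv : SpansDense v) {x : H}
    (h : ∀ i, inner ℂ (v i) x = 0) : x = 0 := by
  refine hv.dense.eq_zero_of_inner_left (𝕜 := ℂ) fun w hw => ?_
  induction hw using Submodule.span_induction with
  | mem w hw => obtain ⟨i, rfl⟩ := hw; rw [← inner_conj_symm, h i, map_zero]
  | zero => simp
  | add a b _ _ ha hb => rw [inner_add_right, ha, hb, add_zero]
  | smul c a _ ha => rw [inner_smul_right, ha, mul_zero]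

theorem SpansDense.ext_inner {v : I → H} (hv : SpansDense v) {x y : H}
    (h : ∀ i, inner ℂ (v i) x = inner ℂ (v i) y) : x = y :=
  sub_eq_zero.1 (hv.eq_zero fun i => by rw [inner_sub_right, h i, sub_self])

theorem SpansDense.ext_isometry {v : I → H} (hv : SpansDense v) {U V : H →ₗᵢ[ℂ] H'}
    (h : ∀ i, U (v i) = V (v i)) : U = V := by
  have : U.toContinuousLinearMap = V.toContinuousLinearMap :=
    ContinuousLinearMap.ext_on hv.dense (by rintro _ ⟨i, rfl⟩; exact h i)
  ext x
  exact congrArg (fun f : H →L[ℂ] H' => f x) this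

theorem SpansDense.ext_unitary {v : I → H} (hv : SpansDense v) {U V : H ≃ₗᵢ[ℂ] H'}
    (h : ∀ i, U (v i) = V (v i)) : U = V := by
  have := hv.ext_isometry (U := U.toLinearIsometry) (V := V.toLinearIsometry) h
  ext x
  exact congrArg (fun f : H →ₗᵢ[ℂ] H' => f x) this

/-- A family with dense span can be mapped isometrically to any family with the same Gram
matrix. -/
theorem SpansDense.exists_isometry [CompleteSpace H'] {v : I → H} (hv : SpansDense v)
    (w : I → H') (h : ∀ i j, inner ℂ (w i) (w j) = inner ℂ (v i) (v j)) :
    ∃ U : H →ₗᵢ[ℂ] H', ∀ i, U (v i) = w i := by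
  let e : (I →₀ ℂ) →ₗ[ℂ] H := Finsupp.linearCombination ℂ v
  let f : (I →₀ ℂ) →ₗ[ℂ] H' := Finsupp.linearCombination ℂ w
  -- Equal Gram matrices give corresponding linear combinations the same norm. Hence `f` factors
  -- through `e` without any linear independence of `v`.
  have hn : ∀ x, ‖f x‖ = ‖e x‖ := by
    intro x
    have : inner ℂ (f x) (f x) = inner ℂ (e x) (e x) := by
      simp only [f, e, Finsupp.linearCombination_apply, Finsupp.sum, sum_inner, inner_sum,
        inner_smul_left, inner_smul_right, h]
    rw [inner_self_eq_norm_sq_to_K, inner_self_eq_norm_sq_to_K] at this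
    have h2 : ‖f x‖ ^ 2 = ‖e x‖ ^ 2 := by exact_mod_cast this
    exact (sq_eq_sq₀ (norm_nonneg _) (norm_nonneg _)).1 h2
  have hd : DenseRange e := by
    have : Set.range e = (Submodule.span ℂ (Set.range v) : Set H) := by
      rw [← Finsupp.range_linearCombination]; rfl
    rw [DenseRange, this]
    exact hv.dense
  have hb : ∃ C : ℝ, ∀ x, ‖f x‖ ≤ C * ‖e x‖ := ⟨1, fun x => by rw [hn, one_mul]⟩
  let U := f.extendOfNorm e
  have hU : ∀ x, U (e x) = f x := LinearMap.extendOfNorm_eq hd hb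
  refine ⟨⟨U.toLinearMap, fun x => ?_⟩, fun i => ?_⟩
  · refine hd.induction_on (p := fun x => ‖U x‖ = ‖x‖) x ?_ fun y => ?_
    · exact isClosed_eq U.continuous.norm continuous_norm
    · rw [hU, hn]
  · have := hU (Finsupp.single i 1)
    simpa [e, f] using this

/-- A homomorphism of a group into the isometries consists of unitary operators. -/
def unitaryOfIsometry {G : Type*} [Group G] (f : G → H →ₗᵢ[ℂ] H) (h1 : ∀ x, f 1 x = x)
    (hm : ∀ g h x, f (g * h) x = f g (f h x)) : G →* (H ≃ₗᵢ[ℂ] H) where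
  toFun g :=
    { toLinearEquiv := LinearEquiv.ofLinearMap (f g).toLinearMap (f g⁻¹).toLinearMap
        (by ext x; simpa [h1] using (hm g g⁻¹ x).symm)
        (by ext x; simpa [h1] using (hm g⁻¹ g x).symm)
      norm_map' := fun x => (f g).norm_map x }
  map_one' := by ext x; exact h1 x
  map_mul' g h := by ext x; exact hm g h x

theorem rep_mul_apply {G : Type*} [Group G] (π : G →* (H ≃ₗᵢ[ℂ] H)) (g h : G) (x : H) :
    π (g * h) x = π g (π h x) := by rw [map_mul]; rfl

/-- Unitary operators are equicontinuous, so an `ε/3` argument passes from the span to its closure.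
-/
theorem continuous_rep_of_spansDense {G X : Type*} [Group G] [TopologicalSpace X]
    (π : G →* (H ≃ₗᵢ[ℂ] H)) (f : X → G) {v : I → H} (hv : SpansDense v)
    (h : ∀ i, Continuous fun a => π (f a) (v i)) (x : H) : Continuous fun a => π (f a) x := by
  have hspan : ∀ y ∈ Submodule.span ℂ (Set.range v), Continuous fun a => π (f a) y := by
    intro y hy
    induction hy using Submodule.span_induction with
    | mem w hw => obtain ⟨i, rfl⟩ := hw; exact h i
    | zero => simpa using continuous_const
    | add a b _ _ ha hb => simp only [map_add]; exact ha.add hb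
    | smul c a _ ha => simp only [map_smul]; exact ha.const_smul c
  refine continuous_iff_continuousAt.2 fun a => Metric.continuousAt_iff'.2 fun ε hε => ?_
  obtain ⟨y, hy, hxy⟩ := Metric.dense_iff.1 hv.dense x (ε / 3) (by positivity)
  have := Metric.continuousAt_iff'.1 ((hspan y hxy).continuousAt (x := a)) (ε / 3) (by positivity)
  filter_upwards [this] with b hb
  have h1 : dist (π (f b) x) (π (f b) y) < ε / 3 := by
    rw [LinearIsometryEquiv.dist_map]; rw [dist_comm]; exact hy
  have h2 : dist (π (f a) y) (π (f a) x) < ε / 3 := by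
    rw [LinearIsometryEquiv.dist_map]; exact hy
  calc dist (π (f b) x) (π (f a) x) ≤ dist (π (f b) x) (π (f b) y) + dist (π (f b) y) (π (f a) y)
        + dist (π (f a) y) (π (f a) x) := dist_triangle4 _ _ _ _
    _ < ε / 3 + ε / 3 + ε / 3 := by gcongr
    _ = ε := by ring

/-- The group topology of pointwise convergence defined by a unitary representation. -/
def repTopology {G : Type*} [Group G] (π : G →* (H ≃ₗᵢ[ℂ] H)) : GroupTopology G :=
  letI : TopologicalSpace G := TopologicalSpace.induced (fun g (x : H) => π g x) inferInstance
  have hc : ∀ x, Continuous fun g => π g x := fun x =>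
    (continuous_apply x).comp continuous_induced_dom
  { toTopologicalSpace := inferInstance
    continuous_mul := by
      refine continuous_induced_rng.2 (continuous_pi fun x => ?_)
      refine continuous_iff_continuousAt.2 fun p => ?_
      -- The outer operator is isometric and drops out of the norm, so separate convergence suffices
      -- for joint continuity.
      have h1 : Tendsto (fun q : G × G => π q.1 (π q.2 x) - π q.1 (π p.2 x)) (nhds p) (nhds 0) := by
        rw [tendsto_zero_iff_norm_tendsto_zero]
        have : (fun q : G × G => ‖π q.1 (π q.2 x) - π q.1 (π p.2 x)‖) =
            fun q => ‖π q.2 x - π p.2 x‖ := by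
          ext q; rw [← map_sub, LinearIsometryEquiv.norm_map]
        rw [this, ← tendsto_zero_iff_norm_tendsto_zero, tendsto_sub_nhds_zero_iff]
        exact ((hc x).comp continuous_snd).tendsto p
      have h2 : Tendsto (fun q : G × G => π q.1 (π p.2 x)) (nhds p) (nhds (π p.1 (π p.2 x))) :=
        ((hc (π p.2 x)).comp continuous_fst).tendsto p
      have := h1.add h2
      simpa [ContinuousAt, Function.comp_def] using this
    continuous_inv := by
      refine continuous_induced_rng.2 (continuous_pi fun x => ?_)
      refine continuous_iff_continuousAt.2 fun p => ?_
      -- Applying the unitary `π q` turns convergence at the inverses into convergence of `π q` on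
      -- the fixed vector `π p⁻¹ x`.
      have h1 : Tendsto (fun q : G => ‖π q⁻¹ x - π p⁻¹ x‖) (nhds p) (nhds 0) := by
        have : (fun q : G => ‖π q⁻¹ x - π p⁻¹ x‖) = fun q => ‖π q (π p⁻¹ x) - x‖ := by
          ext q
          rw [← LinearIsometryEquiv.norm_map (π q), map_sub, norm_sub_rev]
          congr 2
          rw [← rep_mul_apply]
          simp
        rw [this, ← tendsto_zero_iff_norm_tendsto_zero, tendsto_sub_nhds_zero_iff]
        have := (hc (π p⁻¹ x)).tendsto p
        rwa [← rep_mul_apply, mul_inv_cancel, map_one] at this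
      rw [← tendsto_zero_iff_norm_tendsto_zero, tendsto_sub_nhds_zero_iff] at h1
      exact h1 }

/-- The topology of pointwise convergence is one of the group topologies whose infimum is the
inductive limit topology, and is therefore coarser than it. -/
theorem GammaInf.continuous_rep {Γ : Type u} [Group Γ] [TopologicalSpace Γ]
    (π : GammaInf Γ →* (H ≃ₗᵢ[ℂ] H))
    (h : ∀ n x, Continuous fun γ : Fin n → Γ => π (GammaInf.incl Γ n γ) x) (x : H) :
    Continuous fun γ => π γ x := by
  have hle : GammaInf.groupTopology Γ ≤ repTopology π := by
    refine sInf_le ?_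
    intro n
    exact continuous_induced_rng.2 (continuous_pi fun x => h n x)
  have hle' : (GammaInf.groupTopology Γ).toTopologicalSpace ≤ (repTopology π).toTopologicalSpace :=
    hle
  have hc : @Continuous _ _ (repTopology π).toTopologicalSpace _ fun γ => π γ x :=
    @Continuous.comp _ _ _ (repTopology π).toTopologicalSpace _ _ _ _ (continuous_apply x)
      continuous_induced_dom
  exact continuous_le_dom hle' hc

end Hilbert

/-! ### Central vector states -/

section Factor

variable {G : Type u} [Group G]
variable {H : Type*} [NormedAddCommGroup H] [InnerProductSpace ℂ H]

theorem inner_rep_rep (π : G →* (H ≃ₗᵢ[ℂ] H)) (x y : H) (g h : G) :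
    inner ℂ (π g x) (π h y) = inner ℂ x (π (g⁻¹ * h) y) := by
  rw [rep_mul_apply, ← LinearIsometryEquiv.inner_map_map (π g) x, ← rep_mul_apply,
    mul_inv_cancel, map_one]
  rfl

/-- A cyclic representation with a central vector state is a factor representation, if every
element of the group has conjugates which are asymptotically independent of all other elements. -/
theorem IsFactorRep.of_asymptotic_mul [CompleteSpace H] (π : G →* (H ≃ₗᵢ[ℂ] H)) (ξ : H)
    (hξ : ‖ξ‖ = 1) (hcyc : IsCyclicVector π ξ)
    (hcentral : ∀ g h, inner ℂ ξ (π (g * h) ξ) = inner ℂ ξ (π (h * g) ξ))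
    (hmul : ∀ h, ∃ g : ℕ → G, ∀ h', ∀ᶠ k in atTop,
      inner ℂ ξ (π (h' * (g k * h * (g k)⁻¹)) ξ) = inner ℂ ξ (π h' ξ) * inner ℂ ξ (π h ξ)) :
    IsFactorRep π := by
  intro T hT hT'
  have hdense : SpansDense fun g => π g ξ := hcyc
  -- The third commutant is the first one, so `T` commutes with `π(G)`. The hypothesis `hT` makes it
  -- commute with right translations, which lie in the commutant.
  rw [Set.centralizer_centralizer_centralizer] at hT'
  have hTπ : ∀ g x, T (π g x) = π g (T x) := fun g x => by
    have := (Set.mem_centralizer_iff.1 hT') _ ⟨g, rfl⟩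
    exact (congrArg (fun S : H →L[ℂ] H => S x) this).symm
  -- right translations
  have hV : ∀ g, ∃ V : H →ₗᵢ[ℂ] H, ∀ h, V (π h ξ) = π (h * g⁻¹) ξ := fun g =>
    hdense.exists_isometry (fun h => π (h * g⁻¹) ξ) fun i j => by
      rw [inner_rep_rep, inner_rep_rep, mul_inv_rev, inv_inv, mul_assoc, hcentral]
      simp [mul_assoc]
  choose V hV using hV
  have hVT : ∀ g x, T (V g x) = V g (T x) := by
    intro g x
    have hmem : (V g).toContinuousLinearMap ∈ (operatorRange π).centralizer := by
      rw [Set.mem_centralizer_iff]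
      rintro _ ⟨h, rfl⟩
      refine ContinuousLinearMap.ext_on hdense.dense ?_
      rintro _ ⟨k, rfl⟩
      change π h (V g (π k ξ)) = V g (π h (π k ξ))
      rw [hV, ← rep_mul_apply, ← rep_mul_apply, hV, mul_assoc]
    have := (Set.mem_centralizer_iff.1 hT) _ hmem
    exact (congrArg (fun S : H →L[ℂ] H => S x) this).symm
  -- The operator `π g ∘ V g` fixes `ξ` and commutes with `T`.
  have hfix : ∀ g, π g (V g (T ξ)) = T ξ := by
    intro g
    have : V g ξ = π g⁻¹ ξ := by simpa using hV g 1
    rw [← hVT, ← hTπ, this, ← rep_mul_apply]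
    simp
  have hconj : ∀ g h, inner ℂ (T ξ) (π (g * h * g⁻¹) ξ) = inner ℂ (T ξ) (π h ξ) := by
    intro g h
    conv_lhs => rw [← hfix g, mul_assoc, rep_mul_apply, ← hV]
    rw [LinearIsometryEquiv.inner_map_map, LinearIsometry.inner_map_map]
  have hlim : ∀ h, inner ℂ (T ξ) (π h ξ) = inner ℂ (T ξ) ξ * inner ℂ ξ (π h ξ) := by
    intro h
    obtain ⟨g, hg⟩ := hmul h
    -- For `y` in the span of the orbit the factorization is exact for all large `k`. For `T ξ` it
    -- follows by approximation, since the left side does not depend on `k` by `hconj`.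
    have hspan : ∀ y ∈ Submodule.span ℂ (Set.range fun g => π g ξ), ∀ᶠ k in atTop,
        inner ℂ y (π (g k * h * (g k)⁻¹) ξ) = inner ℂ y ξ * inner ℂ ξ (π h ξ) := by
      intro y hy
      induction hy using Submodule.span_induction with
      | mem w hw =>
        obtain ⟨k', rfl⟩ := hw
        filter_upwards [hg k'⁻¹] with k hk
        rw [inner_rep_rep, hk]
        have := inner_rep_rep π ξ ξ k' 1
        simp only [map_one, mul_one] at this
        change inner ℂ (π k' ξ) ξ = _ at this
        rw [this]
      | zero => simp
      | add a b _ _ ha hb =>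
        filter_upwards [ha, hb] with k ha hb
        rw [inner_add_left, inner_add_left, ha, hb, add_mul]
      | smul c a _ ha =>
        filter_upwards [ha] with k ha
        rw [inner_smul_left, inner_smul_left, ha, mul_assoc]
    have hc1 : ‖inner ℂ ξ (π h ξ)‖ ≤ 1 := by
      refine (norm_inner_le_norm _ _).trans ?_
      rw [LinearIsometryEquiv.norm_map, hξ, mul_one]
    refine eq_of_forall_dist_le fun ε hε => ?_
    -- The index `k` is chosen after `y`; replacing `T ξ` by `y` costs at most `ε / 2` in each of
    -- two terms.
    obtain ⟨y, hy, hyspan⟩ := Metric.dense_iff.1 hdense.dense (T ξ) (ε / 2) (by positivity)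
    obtain ⟨k, hk⟩ := (hspan y hyspan).exists
    rw [Metric.mem_ball, dist_comm, dist_eq_norm] at hy
    rw [← hconj (g k) h, dist_eq_norm]
    have e : inner ℂ (T ξ) (π (g k * h * (g k)⁻¹) ξ) - inner ℂ (T ξ) ξ * inner ℂ ξ (π h ξ) =
        inner ℂ (T ξ - y) (π (g k * h * (g k)⁻¹) ξ) -
          inner ℂ (T ξ - y) ξ * inner ℂ ξ (π h ξ) := by
      rw [inner_sub_left, inner_sub_left, hk]; ring
    rw [e]
    refine (norm_sub_le _ _).trans ?_
    have h1 : ‖inner ℂ (T ξ - y) (π (g k * h * (g k)⁻¹) ξ)‖ ≤ ε / 2 := by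
      refine (norm_inner_le_norm _ _).trans ?_
      rw [LinearIsometryEquiv.norm_map, hξ, mul_one]; exact hy.le
    have h2 : ‖inner ℂ (T ξ - y) ξ * inner ℂ ξ (π h ξ)‖ ≤ ε / 2 := by
      rw [norm_mul]
      refine (mul_le_of_le_one_right (norm_nonneg _) hc1).trans ?_
      refine (norm_inner_le_norm _ _).trans ?_
      rw [hξ, mul_one]; exact hy.le
    linarith
  have hTξ : T ξ = inner ℂ ξ (T ξ) • ξ := by
    refine hdense.ext_inner fun h => ?_
    rw [← inner_conj_symm, hlim h, inner_smul_right, map_mul, inner_conj_symm, inner_conj_symm]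
  refine ⟨inner ℂ ξ (T ξ), ContinuousLinearMap.ext_on hdense.dense ?_⟩
  rintro _ ⟨h, rfl⟩
  change T (π h ξ) = inner ℂ ξ (T ξ) • π h ξ
  rw [hTπ, hTξ, map_smul, inner_smul_right, inner_self_eq_norm_sq_to_K, hξ]
  simp

theorem posSemidef_vectorState (π : G →* (H ≃ₗᵢ[ℂ] H)) (ξ : H) (n : ℕ) (g : Fin n → G) :
    (Matrix.of fun j k => inner ℂ ξ (π (g j * (g k)⁻¹) ξ)).PosSemidef := by
  have : (Matrix.of fun j k => inner ℂ ξ (π (g j * (g k)⁻¹) ξ)) =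
      Matrix.gram ℂ fun j => π (g j)⁻¹ ξ := by
    ext j k
    rw [Matrix.gram_apply, inner_rep_rep, inv_inv]
    rfl
  rw [this]
  exact Matrix.posSemidef_gram ℂ _

/-- The restriction of a unitary representation to the closed span of an orbit. -/
theorem exists_cyclic_subrep [TopologicalSpace G] {H : Type u} [NormedAddCommGroup H]
    [InnerProductSpace ℂ H]
    [CompleteSpace H] (π : G →* (H ≃ₗᵢ[ℂ] H)) (ξ : H) (hcont : IsStronglyContinuous π) :
    ∃ (K : Type u) (_ : NormedAddCommGroup K) (_ : InnerProductSpace ℂ K) (_ : CompleteSpace K)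
      (σ : G →* (K ≃ₗᵢ[ℂ] K)) (ζ : K), IsStronglyContinuous σ ∧ IsCyclicVector σ ζ ∧
      (∀ g, inner ℂ ζ (σ g ζ) = inner ℂ ξ (π g ξ)) ∧ ‖ζ‖ = ‖ξ‖ := by
  let S : Submodule ℂ H := Submodule.span ℂ (Set.range fun g => π g ξ)
  let K := S.topologicalClosure
  have hinv : ∀ g, ∀ x ∈ K, π g x ∈ K := by
    intro g
    have hc : IsClosed ((K.comap ((π g).toLinearEquiv : H →ₗ[ℂ] H) : Submodule ℂ H) : Set H) :=
      S.isClosed_topologicalClosure.preimage (π g).continuous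
    refine Submodule.topologicalClosure_minimal S (t := K.comap ((π g).toLinearEquiv : H →ₗ[ℂ] H))
      (Submodule.span_le.2 ?_) hc
    rintro _ ⟨h, rfl⟩
    change π g (π h ξ) ∈ K
    rw [← rep_mul_apply]
    exact S.le_topologicalClosure (Submodule.subset_span ⟨_, rfl⟩)
  let f : G → K →ₗᵢ[ℂ] K := fun g =>
    { toLinearMap := ((π g).toLinearEquiv : H →ₗ[ℂ] H).restrict (hinv g)
      norm_map' := fun x => (π g).norm_map x }
  have hξ : ξ ∈ K := S.le_topologicalClosure (Submodule.subset_span ⟨1, by simp⟩)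
  let σ : G →* (K ≃ₗᵢ[ℂ] K) := unitaryOfIsometry f
    (fun x => Subtype.ext (by change π 1 (x : H) = x; rw [map_one]; rfl))
    (fun g h x => Subtype.ext (rep_mul_apply π g h x))
  have hcomplete : CompleteSpace K := S.isClosed_topologicalClosure.completeSpace_coe
  refine ⟨K, inferInstance, inferInstance, hcomplete, σ, ⟨ξ, hξ⟩, ?_, ?_, fun g => rfl, rfl⟩
  · intro x
    exact (hcont (x : H)).subtype_mk _
  · refine SpansDense.of_forall_inner (v := fun g => σ g ⟨ξ, hξ⟩) fun x hx => ?_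
    have hx' : (x : H) ∈ Sᗮ := by
      rw [Submodule.mem_orthogonal]
      intro y hy
      induction hy using Submodule.span_induction with
      | mem w hw => obtain ⟨i, rfl⟩ := hw; exact hx i
      | zero => simp
      | add a b _ _ ha hb => rw [inner_add_left, ha, hb, add_zero]
      | smul c a _ ha => rw [inner_smul_left, ha, mul_zero]
    rw [← Submodule.orthogonal_closure] at hx'
    have := Submodule.inner_right_of_mem_orthogonal x.2 hx'
    exact Subtype.ext (inner_self_eq_zero.1 this)

/-- The vector `ξ` is not assumed cyclic, so the GNS representation is realized on the closed span
of its orbit. All hypotheses on the vector state pass to that subspace because they involve only the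
function. -/
theorem isIndecomposableCharacter_of_asymptotic_mul [TopologicalSpace G] {H : Type u}
    [NormedAddCommGroup H] [InnerProductSpace ℂ H] [CompleteSpace H]
    (π : G →* (H ≃ₗᵢ[ℂ] H)) (ξ : H)
    (hξ : ‖ξ‖ = 1) (hcont : IsStronglyContinuous π)
    (hcentral : ∀ g h, inner ℂ ξ (π (g * h) ξ) = inner ℂ ξ (π (h * g) ξ))
    (hmul : ∀ h, ∃ g : ℕ → G, ∀ h', ∀ᶠ k in atTop,
      inner ℂ ξ (π (h' * (g k * h * (g k)⁻¹)) ξ) = inner ℂ ξ (π h' ξ) * inner ℂ ξ (π h ξ)) :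
    IsIndecomposableCharacter fun g => inner ℂ ξ (π g ξ) := by
  refine ⟨⟨(innerSL ℂ ξ).continuous.comp (hcont ξ), hcentral, posSemidef_vectorState π ξ, ?_⟩, ?_⟩
  · rw [map_one]
    change inner ℂ ξ ξ = 1
    rw [inner_self_eq_norm_sq_to_K, hξ]
    simp
  · obtain ⟨K, i1, i2, i3, σ, ζ, h1, h2, h3, h4⟩ := exists_cyclic_subrep π ξ hcont
    refine ⟨K, i1, i2, i3, σ, ζ, h1, h2, fun g => (h3 g).symm, ?_⟩
    refine IsFactorRep.of_asymptotic_mul σ ζ (h4.trans hξ) h2 ?_ ?_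
    · simpa only [h3] using hcentral
    · simpa only [h3] using hmul

end Factor

/-! ### Product vectors in the infinite tensor product -/

section ProductVectors

variable {H : Type u} [NormedAddCommGroup H] [InnerProductSpace ℂ H]
variable (η : ℕ → H) (hη : ∀ m, ‖η m‖ = 1)

theorem inner_eq_one_of_norm_eq_one (hη : ∀ m, ‖η m‖ = 1) (m : ℕ) : inner ℂ (η m) (η m) = 1 := by
  rw [inner_self_eq_norm_sq_to_K, hη]; simp

theorem inner_productVector_eq_prod {ζ ζ' : ℕ → H} {n : ℕ} (h : ∀ m, n ≤ m → ζ m = η m)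
    (h' : ∀ m, n ≤ m → ζ' m = η m) :
    inner ℂ (productVector η hη ζ) (productVector η hη ζ') =
      ∏ m ∈ Finset.range n, inner ℂ (ζ m) (ζ' m) := by
  rw [inner_productVector η hη ζ ζ' (eventually_atTop.2 ⟨n, h⟩) (eventually_atTop.2 ⟨n, h'⟩)]
  refine finprod_eq_prod_of_mulSupport_subset _ fun m hm => ?_
  by_contra hm'
  have hm' : n ≤ m := by simpa using hm'
  refine hm ?_
  change inner ℂ (ζ m) (ζ' m) = 1
  rw [h m hm', h' m hm', inner_eq_one_of_norm_eq_one η hη]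

theorem spansDense_productVector : SpansDense fun ζ : TensorSeq η => productVector η hη ζ.1 := by
  have := span_productVector η hη
  rw [Set.image_eq_range] at this
  exact this

/-- The vector `ζ_0 ⊗ … ⊗ ζ_{n-1} ⊗ η_n ⊗ η_{n+1} ⊗ …`. -/
def headVec (n : ℕ) (ζ : Fin n → H) : InfTensor η hη :=
  productVector η hη fun m => if h : m < n then ζ ⟨m, h⟩ else η m

theorem headVec_tail {H : Type*} (η : ℕ → H) (n : ℕ) (ζ : Fin n → H) (m : ℕ) (hm : n ≤ m) :
    (if h : m < n then ζ ⟨m, h⟩ else η m) = η m := dif_neg (by omega)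

theorem productVector_eq_headVec {ζ : ℕ → H} {n : ℕ} (h : ∀ m, n ≤ m → ζ m = η m) :
    productVector η hη ζ = headVec η hη n fun i => ζ i := by
  unfold headVec
  congr 1
  ext m
  split_ifs with hm
  · rfl
  · exact h m (by omega)

/-- Against a fixed product vector the tail contributes a constant, and the rest is multilinear in
`ζ`. Multilinearity of `headVec` follows because product vectors span densely. -/
theorem exists_inner_headVec (n : ℕ) (ζ' : TensorSeq η) : ∃ c : ℂ, ∀ ζ : Fin n → H,
    inner ℂ (productVector η hη ζ'.1) (headVec η hη n ζ) = c * ∏ i : Fin n, inner ℂ (ζ'.1 i) (ζ i) := by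
  obtain ⟨N, hN⟩ := eventually_atTop.1 ζ'.2
  -- Beyond `n + N` both sequences equal `η`, and the factors are `1`.
  refine ⟨∏ m ∈ Finset.Ico n (n + N), inner ℂ (ζ'.1 m) (η m), fun ζ => ?_⟩
  rw [headVec, inner_productVector_eq_prod η hη (n := n + N) (fun m hm => hN m (by omega))
    (fun m hm => headVec_tail η n ζ m (by omega)),
    ← Finset.prod_range_mul_prod_Ico _ (Nat.le_add_right n N), mul_comm, Finset.prod_range]
  congr 1
  · refine Finset.prod_congr rfl fun m hm => ?_
    rw [headVec_tail η n ζ m (Finset.mem_Ico.1 hm).1]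
  · refine Finset.prod_congr rfl fun i _ => ?_
    rw [dif_pos i.2]

theorem inner_headVec (n : ℕ) (ζ ζ' : Fin n → H) :
    inner ℂ (headVec η hη n ζ) (headVec η hη n ζ') = ∏ i : Fin n, inner ℂ (ζ i) (ζ' i) := by
  rw [headVec, headVec, inner_productVector_eq_prod η hη (headVec_tail η n ζ)
    (headVec_tail η n ζ'), Finset.prod_range]
  exact Finset.prod_congr rfl fun i _ => by simp

theorem norm_headVec (n : ℕ) (ζ : Fin n → H) : ‖headVec η hη n ζ‖ = ∏ i, ‖ζ i‖ := by
  have h := inner_headVec η hη n ζ ζ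
  simp only [inner_self_eq_norm_sq_to_K] at h
  rw [Finset.prod_pow] at h
  have h' : ‖headVec η hη n ζ‖ ^ 2 = (∏ i, ‖ζ i‖) ^ 2 := by exact_mod_cast h
  exact (sq_eq_sq₀ (norm_nonneg _) (Finset.prod_nonneg fun i _ => norm_nonneg _)).1 h'

theorem prod_inner_update {n : ℕ} (ζ' : ℕ → H) (ζ : Fin n → H) (i : Fin n) (z : H) :
    ∏ j : Fin n, inner ℂ (ζ' j) (Function.update ζ i z j) =
      inner ℂ (ζ' i) z * ∏ j ∈ Finset.univ.erase i, inner ℂ (ζ' j) (ζ j) := by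
  rw [← Finset.mul_prod_erase _ _ (Finset.mem_univ i), Function.update_self]
  congr 1
  refine Finset.prod_congr rfl fun j hj => ?_
  rw [Function.update_of_ne (Finset.ne_of_mem_erase hj)]

/-- `headVec` as a continuous multilinear map. -/
def headMap (n : ℕ) : ContinuousMultilinearMap ℂ (fun _ : Fin n => H) (InfTensor η hη) :=
  MultilinearMap.mkContinuous
    (MultilinearMap.mk' (headVec η hη n)
      (by
        intro ζ i x y
        refine (spansDense_productVector η hη).ext_inner fun ζ' => ?_
        obtain ⟨c, hc⟩ := exists_inner_headVec η hη n ζ'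
        rw [inner_add_right, hc, hc, hc, prod_inner_update, prod_inner_update, prod_inner_update,
          inner_add_right]
        ring)
      (by
        intro ζ i a x
        refine (spansDense_productVector η hη).ext_inner fun ζ' => ?_
        obtain ⟨c, hc⟩ := exists_inner_headVec η hη n ζ'
        rw [inner_smul_right, hc, hc, prod_inner_update, prod_inner_update, inner_smul_right]
        ring)) 1
    (fun ζ => by rw [one_mul]; exact (norm_headVec η hη n ζ).le)

theorem headMap_apply (n : ℕ) (ζ : Fin n → H) : headMap η hη n ζ = headVec η hη n ζ := rfl

/-- Product vectors with entries in a family with dense span have a dense span. -/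
theorem spansDense_productVector_of_spansDense {J : Type*} {b : J → H} (hb : SpansDense b)
    [Nonempty J] (n₀ : ℕ) : SpansDense fun p : {p : ℕ × (ℕ → J) // n₀ ≤ p.1} =>
      productVector η hη fun m => if m < p.1.1 then b (p.1.2 m) else η m := by
  refine SpansDense.of_forall_inner fun x hx => ?_
  refine (spansDense_productVector η hη).eq_zero fun ζ => ?_
  obtain ⟨N, hN⟩ := eventually_atTop.1 ζ.2
  rw [productVector_eq_headVec η hη (n := n₀ + N) fun m hm => hN m (by omega)]
  set n := n₀ + N
  -- Induction on the number `j` of leading entries that may be arbitrary; the remaining entries are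
  -- taken from `b`. Each step frees one slot by linearity and continuity in that slot.
  have key : ∀ j ≤ n, ∀ ζ : Fin n → H, (∀ i : Fin n, j ≤ i → ζ i ∈ Set.range b) →
      inner ℂ x (headMap η hη n ζ) = 0 := by
    intro j
    induction j with
    | zero =>
      intro _ ζ hζ
      choose c hc using fun i => hζ i (Nat.zero_le _)
      have h0 := hx ⟨(n, fun m => if h : m < n then c ⟨m, h⟩ else Classical.arbitrary J),
        Nat.le_add_right _ _⟩
      rw [← inner_conj_symm, headMap_apply, headVec, ← map_zero (starRingEnd ℂ), ← h0]
      congr 3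
      ext m
      by_cases hm : m < n
      · simp [hm, hc]
      · simp [hm]
    | succ j ih =>
      intro hj ζ hζ
      let f : H →L[ℂ] ℂ := (innerSL ℂ x).comp ((headMap η hη n).toContinuousLinearMap ζ ⟨j, hj⟩)
      have hf : f = 0 := by
        refine ContinuousLinearMap.ext_on hb.dense ?_
        rintro _ ⟨k, rfl⟩
        refine ih (by omega) _ fun i hi => ?_
        rcases eq_or_lt_of_le hi with h | h
        · have : i = ⟨j, hj⟩ := Fin.ext h.symm
          rw [this, Function.update_self]
          exact ⟨k, rfl⟩
        · rw [Function.update_of_ne (by rintro rfl; exact lt_irrefl _ h)]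
          exact hζ i h
      have := congrArg (fun g : H →L[ℂ] ℂ => g (ζ ⟨j, hj⟩)) hf
      simpa [f] using this
  rw [← inner_conj_symm, ← headMap_apply, key n le_rfl _ (fun i hi => absurd i.2 (by omega)), map_zero]

variable {Γ : Type u} [Group Γ]

theorem GammaInf.eventually_eq_one (γ : GammaInf Γ) : ∀ᶠ m in atTop, γ.1 m = 1 := by
  rw [← Nat.cofinite_eq_atTop]
  exact γ.2

theorem eventually_colour (ρ : Γ →* (H ≃ₗᵢ[ℂ] H)) (γ : GammaInf Γ) {ζ : ℕ → H}
    (hζ : ∀ᶠ m in atTop, ζ m = η m) : ∀ᶠ m in atTop, ρ (γ.1 m) (ζ m) = η m := by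
  filter_upwards [γ.eventually_eq_one, hζ] with m h1 h2
  rw [h1, h2, map_one]; rfl

theorem exists_colour_isometry (ρ : Γ →* (H ≃ₗᵢ[ℂ] H)) (γ : GammaInf Γ) :
    ∃ U : InfTensor η hη →ₗᵢ[ℂ] InfTensor η hη, ∀ ζ : TensorSeq η,
      U (productVector η hη ζ.1) = productVector η hη fun m => ρ (γ.1 m) (ζ.1 m) := by
  have htail := fun ζ : TensorSeq η => eventually_colour η ρ γ ζ.2
  refine (spansDense_productVector η hη).exists_isometry
    (fun ζ => productVector η hη fun m => ρ (γ.1 m) (ζ.1 m)) fun ζ ζ' => ?_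
  rw [inner_productVector η hη _ _ (htail ζ) (htail ζ'), inner_productVector η hη _ _ ζ.2 ζ'.2]
  exact finprod_congr fun m => LinearIsometryEquiv.inner_map_map _ _ _

/-- The action of `Γ^∞_e` on the infinite tensor product. -/
def colourIsometry (ρ : Γ →* (H ≃ₗᵢ[ℂ] H)) (γ : GammaInf Γ) :
    InfTensor η hη →ₗᵢ[ℂ] InfTensor η hη := (exists_colour_isometry η hη ρ γ).choose

theorem colourIsometry_apply (ρ : Γ →* (H ≃ₗᵢ[ℂ] H)) (γ : GammaInf Γ) {ζ : ℕ → H}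
    (hζ : ∀ᶠ m in atTop, ζ m = η m) : colourIsometry η hη ρ γ (productVector η hη ζ) =
      productVector η hη fun m => ρ (γ.1 m) (ζ m) :=
  (exists_colour_isometry η hη ρ γ).choose_spec ⟨ζ, hζ⟩

/-- The representation of `Γ^∞_e` in the infinite tensor product. -/
def colourRep (ρ : Γ →* (H ≃ₗᵢ[ℂ] H)) :
    GammaInf Γ →* (InfTensor η hη ≃ₗᵢ[ℂ] InfTensor η hη) :=
  unitaryOfIsometry (colourIsometry η hη ρ)
    (fun x => by
      have : colourIsometry η hη ρ 1 = LinearIsometry.id := by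
        refine (spansDense_productVector η hη).ext_isometry fun ζ => ?_
        rw [colourIsometry_apply η hη ρ 1 ζ.2]
        change productVector η hη (fun m => ρ 1 (ζ.1 m)) = _
        rw [map_one]; rfl
      rw [this]; rfl)
    (fun γ γ' x => by
      have : colourIsometry η hη ρ (γ * γ') =
          (colourIsometry η hη ρ γ).comp (colourIsometry η hη ρ γ') := by
        refine (spansDense_productVector η hη).ext_isometry fun ζ => ?_
        change _ = colourIsometry η hη ρ γ (colourIsometry η hη ρ γ' _)
        rw [colourIsometry_apply η hη ρ _ ζ.2,
          colourIsometry_apply η hη ρ _ ζ.2,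
          colourIsometry_apply η hη ρ _ (eventually_colour η ρ γ' ζ.2)]
        congr 1
        ext m
        exact rep_mul_apply ρ (γ.1 m) (γ'.1 m) (ζ.1 m)
      rw [this]; rfl)

theorem colourRep_apply (ρ : Γ →* (H ≃ₗᵢ[ℂ] H)) (γ : GammaInf Γ) {ζ : ℕ → H}
    (hζ : ∀ᶠ m in atTop, ζ m = η m) : colourRep η hη ρ γ (productVector η hη ζ) =
      productVector η hη fun m => ρ (γ.1 m) (ζ m) :=
  colourIsometry_apply η hη ρ γ hζ

theorem isStronglyContinuous_colourRep [TopologicalSpace Γ] (ρ : Γ →* (H ≃ₗᵢ[ℂ] H))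
    (hρ : IsStronglyContinuous ρ) : IsStronglyContinuous (colourRep η hη ρ) := by
  refine GammaInf.continuous_rep _ fun n => ?_
  refine continuous_rep_of_spansDense _ _ (spansDense_productVector η hη) fun ζ => ?_
  obtain ⟨N, hN⟩ := eventually_atTop.1 ζ.2
  -- From site `n + N` on the group element is trivial and `ζ` is `η`. The orbit map thus factors
  -- through a continuous multilinear map in finitely many entries.
  have h : (fun γ : Fin n → Γ =>
      colourRep η hη ρ (GammaInf.incl Γ n γ) (productVector η hη ζ.1)) =
      fun γ => headMap η hη (n + N) fun i => ρ ((GammaInf.incl Γ n γ).1 i) (ζ.1 i) := by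
    ext1 γ
    rw [colourRep_apply η hη ρ _ ζ.2, productVector_eq_headVec η hη (n := n + N)]
    · rfl
    · intro m hm
      rw [hN m (by omega)]
      have : (GammaInf.incl Γ n γ).1 m = 1 := dif_neg (by omega)
      rw [this, map_one]; rfl
  rw [h]
  refine (headMap η hη (n + N)).cont.comp (continuous_pi fun i => ?_)
  by_cases hi : (i : ℕ) < n
  · have : (fun γ : Fin n → Γ => ρ ((GammaInf.incl Γ n γ).1 i) (ζ.1 i)) =
        fun γ => ρ (γ ⟨i, hi⟩) (ζ.1 i) := by
      ext1 γ
      have : (GammaInf.incl Γ n γ).1 i = γ ⟨i, hi⟩ := dif_pos hi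
      rw [this]
    rw [this]
    exact (hρ _).comp (continuous_apply _)
  · have : (fun γ : Fin n → Γ => ρ ((GammaInf.incl Γ n γ).1 i) (ζ.1 i)) = fun _ => ρ 1 (ζ.1 i) := by
      ext1 γ
      have : (GammaInf.incl Γ n γ).1 i = 1 := dif_neg hi
      rw [this]
    rw [this]
    exact continuous_const

end ProductVectors

/-! ### Rearrangements of fillings -/

section Rearrangement

/-- `s` fixes all `m ≥ n`. -/
def FixesFrom (s : Equiv.Perm ℕ) (n : ℕ) : Prop := ∀ m, n ≤ m → s m = m

theorem FixesFrom.mono {s : Equiv.Perm ℕ} {n n' : ℕ} (hs : FixesFrom s n) (h : n ≤ n') :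
    FixesFrom s n' := fun m hm => hs m (h.trans hm)

theorem FixesFrom.symm {s : Equiv.Perm ℕ} {n : ℕ} (hs : FixesFrom s n) : FixesFrom s.symm n :=
  fun m hm => by rw [Equiv.symm_apply_eq, hs m hm]

theorem FixesFrom.mul {s t : Equiv.Perm ℕ} {n : ℕ} (hs : FixesFrom s n) (ht : FixesFrom t n) :
    FixesFrom (s * t) n := fun m hm => by rw [Equiv.Perm.mul_apply, ht m hm, hs m hm]

theorem FixesFrom.one (n : ℕ) : FixesFrom 1 n := fun _ _ => rfl

theorem FixesFrom.lt {s : Equiv.Perm ℕ} {n : ℕ} (hs : FixesFrom s n) {m : ℕ} (hm : m < n) :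
    s m < n := by
  by_contra h
  have h1 := hs (s m) (by omega)
  have h2 := s.injective h1
  omega

theorem FixesFrom.prod_comp {M : Type*} [CommMonoid M] {s : Equiv.Perm ℕ} {n : ℕ}
    (hs : FixesFrom s n) (f : ℕ → M) :
    ∏ k ∈ Finset.range n, f (s k) = ∏ k ∈ Finset.range n, f k :=
  Finset.prod_bij (fun k _ => s k) (fun k hk => Finset.mem_range.2 (hs.lt (Finset.mem_range.1 hk)))
    (fun _ _ _ _ h => s.injective h)
    (fun k hk => ⟨s.symm k, Finset.mem_range.2 (hs.symm.lt (Finset.mem_range.1 hk)), by simp⟩)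
    (fun _ _ => rfl)

theorem SInf.exists_fixesFrom (s : SInf) : ∃ n, FixesFrom s.1 n := by
  have : ∀ᶠ m in atTop, s.1 m = m := by
    rw [← Nat.cofinite_eq_atTop]
    exact s.2
  exact eventually_atTop.1 this

-- Since `s` permutes `{0, …, n-1}`, the sets `p` and `s(p)` have equally many elements there. This
-- keeps the order preserving matching below `n`.
open Classical in
theorem FixesFrom.count_comp {s : Equiv.Perm ℕ} {n : ℕ} (hs : FixesFrom s n) (p : ℕ → Prop) :
    Nat.count (fun m => p (s.symm m)) n = Nat.count p n := by
  rw [Nat.count_eq_card_filter_range, Nat.count_eq_card_filter_range]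
  refine Finset.card_bij (fun k _ => s.symm k) (fun k hk => ?_)
    (fun _ _ _ _ h => s.symm.injective h) (fun k hk => ⟨s k, ?_, by simp⟩)
  · rw [Finset.mem_filter, Finset.mem_range] at hk ⊢
    exact ⟨hs.symm.lt hk.1, hk.2⟩
  · rw [Finset.mem_filter, Finset.mem_range] at hk ⊢
    exact ⟨hs.lt hk.1, by simpa using hk.2⟩

open Classical in
/-- The element of `p` which is matched with `k` by the order preserving bijection from `s(p)`
onto `p`. -/
def orderSource (s : Equiv.Perm ℕ) (p : ℕ → Prop) (k : ℕ) : ℕ :=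
  Nat.nth p (Nat.count (fun m => p (s.symm m)) k)

-- The last conjunct, equality of ranks in `p` and in `s(p)`, characterizes the matching. The later
-- identities for `orderSource` are proved by comparing ranks.
open Classical in
theorem orderSource_spec {s : Equiv.Perm ℕ} {n : ℕ} (hs : FixesFrom s n) {p : ℕ → Prop} {k : ℕ}
    (hk : k < n) (hp : p (s.symm k)) :
    orderSource s p k < n ∧ p (orderSource s p k) ∧
      Nat.count p (orderSource s p k) = Nat.count (fun m => p (s.symm m)) k := by
  have h1 : Nat.count (fun m => p (s.symm m)) k < Nat.count p n := by
    rw [← hs.count_comp p]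
    exact Nat.count_strict_mono (p := fun m => p (s.symm m)) hp hk
  -- For a finite `p`, `Nat.nth` takes the default value `0` beyond the last element; this bound
  -- excludes that case.
  have h2 : ∀ hf : (Set.ofPred p).Finite, Nat.count (fun m => p (s.symm m)) k < hf.toFinset.card := by
    intro hf
    refine h1.trans_le ?_
    rw [Nat.count_eq_card_filter_range]
    exact Finset.card_le_card fun i hi => hf.mem_toFinset.2 (Finset.mem_filter.1 hi).2
  exact ⟨Nat.nth_lt_of_lt_count h1, Nat.nth_mem _ h2, Nat.count_nth h2⟩

open Classical in
theorem orderSource_eq {s : Equiv.Perm ℕ} {n : ℕ} (hs : FixesFrom s n) {p : ℕ → Prop} {k j : ℕ}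
    (hk : k < n) (hp : p (s.symm k)) (hj : p j)
    (h : Nat.count p j = Nat.count (fun m => p (s.symm m)) k) : orderSource s p k = j := by
  obtain ⟨-, h2, h3⟩ := orderSource_spec hs hk hp
  exact Nat.count_injective h2 hj (h3.trans h.symm)

open Classical in
theorem count_congr_of_lt {p q : ℕ → Prop} {n k : ℕ} (h : ∀ m < n, (p m ↔ q m)) (hk : k ≤ n) :
    Nat.count p k = Nat.count q k := by
  rw [Nat.count_eq_card_filter_range, Nat.count_eq_card_filter_range]
  congr 1
  refine Finset.filter_congr fun m hm => h m ?_
  have := Finset.mem_range.1 hm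
  omega

theorem orderSource_congr {s : Equiv.Perm ℕ} {n : ℕ} (hs : FixesFrom s n) {p q : ℕ → Prop}
    (h : ∀ m < n, (p m ↔ q m)) {k : ℕ} (hk : k < n) (hp : p (s.symm k)) :
    orderSource s p k = orderSource s q k := by
  classical
  obtain ⟨h1, h2, h3⟩ := orderSource_spec hs hk hp
  refine (orderSource_eq hs hk ((h _ (hs.symm.lt hk)).1 hp) ((h _ h1).1 h2) ?_).symm
  have e1 := count_congr_of_lt h h1.le
  have e2 := count_congr_of_lt (n := n) (p := fun m => p (s.symm m)) (q := fun m => q (s.symm m))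
    (fun m hm => h _ (hs.symm.lt hm)) hk.le
  exact e1.symm.trans (h3.trans e2)

theorem orderSource_of_invariant {s : Equiv.Perm ℕ} {n : ℕ} (hs : FixesFrom s n) {p : ℕ → Prop}
    (h : ∀ m < n, (p (s.symm m) ↔ p m)) {k : ℕ} (hk : k < n) (hp : p k) :
    orderSource s p k = k := by
  classical
  refine orderSource_eq hs hk ((h k hk).2 hp) hp ?_
  exact count_congr_of_lt (n := n) (q := fun m => p (s.symm m)) (fun m hm => (h m hm).symm) hk.le

theorem orderSource_of_fixesFrom {s : Equiv.Perm ℕ} {n : ℕ} (hs : FixesFrom s n) {p : ℕ → Prop}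
    {k : ℕ} (hk : n ≤ k) (hp : p k) : orderSource s p k = k := by
  classical
  -- The bound `k + 1` is used so that `k` lies below it; the ranks agree because `s` also permutes
  -- `{0, …, k-1}`.
  refine orderSource_eq (hs.mono (hk.trans (Nat.le_succ k))) (Nat.lt_succ_self k)
    (by rwa [hs.symm k hk]) hp ?_
  exact ((hs.mono hk).count_comp p).symm

/-- The matchings for `s` on `p` and for `s⁻¹` on `s(p)` are mutually inverse, which supplies the
reindexing of second factors in `prod_moveFill`. -/
theorem orderSource_orderSource {s : Equiv.Perm ℕ} {n : ℕ} (hs : FixesFrom s n) {p : ℕ → Prop}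
    {k : ℕ} (hk : k < n) (hp : p (s.symm k)) :
    orderSource s.symm (fun m => p (s.symm m)) (orderSource s p k) = k := by
  classical
  obtain ⟨h1, h2, h3⟩ := orderSource_spec hs hk hp
  refine orderSource_eq hs.symm h1 (by simpa using h2) hp ?_
  simpa using h3.symm

variable {X Y Z : Type*}

/-- `c m` has two tensor factors. -/
def IsPair (c : ℕ → (X × Y) ⊕ Z) (m : ℕ) : Prop := (c m).isLeft

/-- The rearrangement of a filling by `s`. -/
def moveFill (s : Equiv.Perm ℕ) (c : ℕ → (X × Y) ⊕ Z) (k : ℕ) : (X × Y) ⊕ Z :=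
  match c (s.symm k), c (orderSource s (IsPair c) k) with
  | Sum.inl (x, _), Sum.inl (_, y) => Sum.inl (x, y)
  | other, _ => other

theorem IsPair.exists_eq {c : ℕ → (X × Y) ⊕ Z} {m : ℕ} (h : IsPair c m) :
    ∃ x y, c m = Sum.inl (x, y) := by
  obtain ⟨⟨x, y⟩, h⟩ := Sum.isLeft_iff.1 h
  exact ⟨x, y, h⟩

theorem exists_eq_inr {c : ℕ → (X × Y) ⊕ Z} {m : ℕ} (h : ¬ IsPair c m) :
    ∃ z, c m = Sum.inr z := by
  rw [IsPair, Bool.not_eq_true, Sum.isLeft_eq_false, Sum.isRight_iff] at h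
  exact h

theorem moveFill_inr {s : Equiv.Perm ℕ} {c : ℕ → (X × Y) ⊕ Z} {k : ℕ} {z : Z}
    (h : c (s.symm k) = Sum.inr z) : moveFill s c k = Sum.inr z := by
  simp only [moveFill, h]

theorem moveFill_inl {s : Equiv.Perm ℕ} {c : ℕ → (X × Y) ⊕ Z} {k : ℕ} {x x' : X} {y y' : Y}
    (h : c (s.symm k) = Sum.inl (x, y')) (h' : c (orderSource s (IsPair c) k) = Sum.inl (x', y)) :
    moveFill s c k = Sum.inl (x, y) := by
  simp only [moveFill, h, h']

/-- The fallback branch of `moveFill` returns a pair when it starts from one, so no bound on the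
support of `s` is required. -/
theorem isPair_moveFill (s : Equiv.Perm ℕ) (c : ℕ → (X × Y) ⊕ Z) (k : ℕ) :
    IsPair (moveFill s c) k ↔ IsPair c (s.symm k) := by
  unfold IsPair moveFill
  rcases h1 : c (s.symm k) with ⟨x, y⟩ | z <;>
  rcases h2 : c (orderSource s (IsPair c) k) with ⟨x', y'⟩ | z' <;> simp

theorem moveFill_of_fixesFrom {s : Equiv.Perm ℕ} {n : ℕ} (hs : FixesFrom s n)
    (c : ℕ → (X × Y) ⊕ Z) {k : ℕ} (hk : n ≤ k) : moveFill s c k = c k := by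
  have h1 : s.symm k = k := hs.symm k hk
  by_cases hp : IsPair c k
  · obtain ⟨x, y, h⟩ := hp.exists_eq
    rw [moveFill_inl (x := x) (y' := y) (x' := x) (y := y), h]
    · rw [h1, h]
    · rw [orderSource_of_fixesFrom hs hk hp, h]
  · obtain ⟨z, h⟩ := exists_eq_inr hp
    rw [moveFill_inr (z := z), h]
    rw [h1, h]

/-- First factors compose as permutations. Second factors compose because order preserving
bijections from `st(p)` to `t(p)` and from `t(p)` to `p` compose to the order preserving one. -/
theorem moveFill_mul {s t : Equiv.Perm ℕ} {n : ℕ} (hs : FixesFrom s n) (ht : FixesFrom t n)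
    (c : ℕ → (X × Y) ⊕ Z) {k : ℕ} (hk : k < n) :
    moveFill s (moveFill t c) k = moveFill (s * t) c k := by
  classical
  have hst : ∀ m, (s * t).symm m = t.symm (s.symm m) := fun m => rfl
  have hpp : IsPair (moveFill t c) = fun m => IsPair c (t.symm m) :=
    funext fun m => propext (isPair_moveFill t c m)
  by_cases hp : IsPair c (t.symm (s.symm k))
  · obtain ⟨x, y, h⟩ := hp.exists_eq
    have hk' : s.symm k < n := hs.symm.lt hk
    have hp1 : IsPair (moveFill t c) (s.symm k) := (isPair_moveFill t c _).2 hp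
    obtain ⟨a1, a2, a3⟩ := orderSource_spec ht hk' hp
    obtain ⟨b1, b2, b3⟩ := orderSource_spec hs hk hp1
    set j := orderSource s (IsPair (moveFill t c)) k with hj
    have hpj : IsPair c (t.symm j) := (isPair_moveFill t c _).1 b2
    obtain ⟨c1, c2, c3⟩ := orderSource_spec ht b1 hpj
    obtain ⟨xi, yi, hi⟩ := c2.exists_eq
    obtain ⟨xa, ya, ha⟩ := a2.exists_eq
    obtain ⟨xj, yj, hj'⟩ := hpj.exists_eq
    have e1 : moveFill t c (s.symm k) = Sum.inl (x, ya) := moveFill_inl h ha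
    have e2 : moveFill t c j = Sum.inl (xj, yi) := moveFill_inl hj' hi
    have e3 : orderSource (s * t) (IsPair c) k = orderSource t (IsPair c) j := by
      refine orderSource_eq (hs.mul ht) hk hp c2 ?_
      rw [c3]
      simp only [hpp] at b3
      exact b3
    rw [moveFill_inl e1 e2, moveFill_inl (s := s * t) h (e3 ▸ hi)]
  · obtain ⟨z, h⟩ := exists_eq_inr hp
    rw [moveFill_inr (s := s * t) h, moveFill_inr (moveFill_inr h)]

theorem moveFill_of_invariant {s : Equiv.Perm ℕ} {n : ℕ} (hs : FixesFrom s n)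
    {c : ℕ → (X × Y) ⊕ Z} (h : ∀ m < n, (IsPair c (s.symm m) ↔ IsPair c m)) {k : ℕ} (hk : k < n)
    {x x' : X} {y y' : Y} (h1 : c (s.symm k) = Sum.inl (x, y')) (h2 : c k = Sum.inl (x', y)) :
    moveFill s c k = Sum.inl (x, y) := by
  refine moveFill_inl h1 (x' := x') ?_
  rw [orderSource_of_invariant hs h hk (by simp [IsPair, h2]), h2]

/-- Naturality: maps of first factors and of `Z`-entries may depend on the site, and travel with it.
Second factors are matched by the pattern of pairs alone, which such maps preserve. -/
theorem moveFill_map {X' Z' : Type*} (f : ℕ → X → X') (g : ℕ → Z → Z') (s : Equiv.Perm ℕ)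
    (c : ℕ → (X × Y) ⊕ Z) (k : ℕ) :
    moveFill s (fun m => Sum.map (Prod.map (f m) id) (g m) (c m)) k =
      Sum.map (Prod.map (f (s.symm k)) id) (g (s.symm k)) (moveFill s c k) := by
  have hp : IsPair (fun m => Sum.map (Prod.map (f m) id) (g m) (c m)) = IsPair c := by
    ext m
    simp [IsPair]
  unfold moveFill
  rw [hp]
  rcases h1 : c (s.symm k) with ⟨x, y⟩ | z <;>
  rcases h2 : c (orderSource s (IsPair c) k) with ⟨x', y'⟩ | z' <;> simp [h1, h2]

/-- A product of contributions of the two factors does not change under a simultaneous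
rearrangement of two fillings with the same pattern. -/
theorem prod_moveFill {M : Type*} [CommMonoid M] {s : Equiv.Perm ℕ} {n : ℕ} (hs : FixesFrom s n)
    (A : X → X → M) (B : Y → Y → M) (C : Z → Z → M) (K : (X × Y) ⊕ Z → (X × Y) ⊕ Z → M)
    (hK : ∀ x y x' y', K (Sum.inl (x, y)) (Sum.inl (x', y')) = A x x' * B y y')
    (hK' : ∀ z z', K (Sum.inr z) (Sum.inr z') = C z z')
    (c c' : ℕ → (X × Y) ⊕ Z) (h : ∀ m < n, (IsPair c m ↔ IsPair c' m)) :
    ∏ k ∈ Finset.range n, K (moveFill s c k) (moveFill s c' k) =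
      ∏ k ∈ Finset.range n, K (c k) (c' k) := by
  classical
  let K1 : (X × Y) ⊕ Z → (X × Y) ⊕ Z → M := fun a b =>
    match a, b with
    | Sum.inl (x, _), Sum.inl (x', _) => A x x'
    | Sum.inr z, Sum.inr z' => C z z'
    | _, _ => 1
  let K2 : (X × Y) ⊕ Z → (X × Y) ⊕ Z → M := fun a b =>
    match a, b with
    | Sum.inl (_, y), Sum.inl (_, y') => B y y'
    | _, _ => 1
  have hR : ∏ k ∈ Finset.range n, K (c k) (c' k) =
      (∏ k ∈ Finset.range n, K1 (c k) (c' k)) * ∏ k ∈ Finset.range n with IsPair c k,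
        K2 (c k) (c' k) := by
    rw [Finset.prod_filter, ← Finset.prod_mul_distrib]
    refine Finset.prod_congr rfl fun k hk => ?_
    have hk' := Finset.mem_range.1 hk
    by_cases hp : IsPair c k
    · obtain ⟨x, y, e⟩ := hp.exists_eq
      obtain ⟨x', y', e'⟩ := ((h k hk').1 hp).exists_eq
      rw [if_pos hp, e, e', hK]
    · obtain ⟨z, e⟩ := exists_eq_inr hp
      obtain ⟨z', e'⟩ := exists_eq_inr (fun hq => hp ((h k hk').2 hq))
      rw [if_neg hp, e, e', hK', mul_one]
  have hL : ∏ k ∈ Finset.range n, K (moveFill s c k) (moveFill s c' k) =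
      (∏ k ∈ Finset.range n, K1 (c (s.symm k)) (c' (s.symm k))) *
        ∏ k ∈ Finset.range n with IsPair c (s.symm k),
          K2 (c (orderSource s (IsPair c) k)) (c' (orderSource s (IsPair c) k)) := by
    rw [Finset.prod_filter, ← Finset.prod_mul_distrib]
    refine Finset.prod_congr rfl fun k hk => ?_
    have hk' := Finset.mem_range.1 hk
    have hsk := hs.symm.lt hk'
    by_cases hp : IsPair c (s.symm k)
    · obtain ⟨x, y, e⟩ := hp.exists_eq
      have hp' := (h _ hsk).1 hp
      obtain ⟨x', y', e'⟩ := hp'.exists_eq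
      obtain ⟨h1, h2, -⟩ := orderSource_spec hs hk' hp
      have h2' := (h _ h1).1 h2
      obtain ⟨a, b, f⟩ := h2.exists_eq
      obtain ⟨a', b', f'⟩ := h2'.exists_eq
      rw [if_pos hp, moveFill_inl e f, moveFill_inl e' (orderSource_congr hs h hk' hp ▸ f'), e, e',
        f, f', hK]
    · obtain ⟨z, e⟩ := exists_eq_inr hp
      obtain ⟨z', e'⟩ := exists_eq_inr (fun hq => hp ((h _ hsk).2 hq))
      rw [if_neg hp, moveFill_inr e, moveFill_inr e', e, e', hK', mul_one]
  rw [hL, hR, hs.symm.prod_comp fun k => K1 (c k) (c' k)]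
  congr 1
  refine Finset.prod_bij' (fun k _ => orderSource s (IsPair c) k)
    (fun j _ => orderSource s.symm (fun m => IsPair c (s.symm m)) j) ?_ ?_ ?_ ?_ ?_
  · intro k hk
    rw [Finset.mem_filter, Finset.mem_range] at hk ⊢
    obtain ⟨h1, h2, -⟩ := orderSource_spec hs hk.1 hk.2
    exact ⟨h1, h2⟩
  · intro j hj
    rw [Finset.mem_filter, Finset.mem_range] at hj ⊢
    obtain ⟨h1, h2, -⟩ := orderSource_spec hs.symm (p := fun m => IsPair c (s.symm m)) hj.1
      (by simpa using hj.2)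
    exact ⟨h1, h2⟩
  · intro k hk
    rw [Finset.mem_filter, Finset.mem_range] at hk
    exact orderSource_orderSource hs hk.1 hk.2
  · intro j hj
    rw [Finset.mem_filter, Finset.mem_range] at hj
    have := orderSource_orderSource hs.symm (p := fun m => IsPair c (s.symm m)) hj.1
      (by simpa using hj.2)
    simpa using this
  · intro k hk
    rfl

end Rearrangement

/-! ### Inversion signs -/

section InversionSign

/-- `-1` for the pairs which are inverted by `s`, and `1` for the other pairs. -/
def pairSign (s : Equiv.Perm ℕ) : Sym2 ℕ → ℤˣ :=
  Sym2.lift ⟨fun i j => if (i < j ↔ s i < s j) then 1 else -1, fun i j => by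
    rcases lt_trichotomy i j with h | rfl | h
    · have : s i ≠ s j := fun e => h.ne (s.injective e)
      have e : (i < j ↔ s i < s j) ↔ (j < i ↔ s j < s i) := by omega
      exact if_congr e rfl rfl
    · rfl
    · have : s i ≠ s j := fun e => h.ne' (s.injective e)
      have e : (i < j ↔ s i < s j) ↔ (j < i ↔ s j < s i) := by omega
      exact if_congr e rfl rfl⟩

theorem pairSign_mk (s : Equiv.Perm ℕ) (i j : ℕ) :
    pairSign s s(i, j) = if (i < j ↔ s i < s j) then 1 else -1 := rfl

/-- A pair is inverted by `s * t` exactly when one, and not both, of `t` on the pair and `s` on its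
image inverts it. Unordered pairs are used so that `t` transports them; diagonal pairs have sign
`1`. -/
theorem pairSign_mul (s t : Equiv.Perm ℕ) (z : Sym2 ℕ) :
    pairSign (s * t) z = pairSign s (z.map t) * pairSign t z := by
  induction z using Sym2.ind with
  | _ i j =>
    rw [Sym2.map_mk, pairSign_mk, pairSign_mk, pairSign_mk]
    simp only [Equiv.Perm.mul_apply]
    by_cases h1 : i < j <;> by_cases h2 : t i < t j <;> by_cases h3 : s (t i) < s (t j) <;>
      simp [h1, h2, h3]

/-- The parity of the number of inversions of `s` on `B`. -/
def inversionSign (s : Equiv.Perm ℕ) (B : Finset ℕ) : ℤˣ := ∏ z ∈ B.sym2, pairSign s z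

theorem inversionSign_mul (s t : Equiv.Perm ℕ) (B : Finset ℕ) :
    inversionSign (s * t) B = inversionSign s (B.image t) * inversionSign t B := by
  rw [inversionSign, inversionSign, Finset.sym2_image,
    Finset.prod_image fun _ _ _ _ h => Sym2.map.injective t.injective h, inversionSign,
    ← Finset.prod_mul_distrib]
  exact Finset.prod_congr rfl fun z _ => pairSign_mul s t z

theorem inversionSign_one (B : Finset ℕ) : inversionSign 1 B = 1 := by
  refine Finset.prod_eq_one fun z _ => ?_
  induction z using Sym2.ind with
  | _ i j => simp [pairSign_mk]

open Classical in
theorem neg_one_pow_inversions {s : Equiv.Perm ℕ} {n : ℕ} (hs : FixesFrom s n) (b : ℕ → Prop) :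
    (-1 : ℂ) ^ {p : ℕ × ℕ | p.1 < p.2 ∧ b p.1 ∧ b p.2 ∧ s p.2 < s p.1}.ncard =
      ((inversionSign s {m ∈ Finset.range n | b m} : ℤˣ) : ℤ) := by
  set B := {m ∈ Finset.range n | b m}
  have h1 : inversionSign s B = (-1) ^ ({z ∈ B.sym2 | pairSign s z = -1}.card) := by
    rw [inversionSign, ← Finset.prod_const, Finset.prod_filter]
    refine Finset.prod_congr rfl fun z _ => ?_
    rcases Int.units_eq_one_or (pairSign s z) with h | h <;> rw [h] <;> decide
  -- An inverted pair lies below `n`, because `s` permutes `{0, …, n-1}` and fixes the rest. Hence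
  -- the set counted by `ncard` is finite and its cardinality is genuine.
  have hmem : ∀ p : ℕ × ℕ, p.1 < p.2 ∧ b p.1 ∧ b p.2 ∧ s p.2 < s p.1 →
      p.1 ∈ B ∧ p.2 ∈ B := by
    rintro ⟨i, j⟩ ⟨h1, h2, h3, h4⟩
    simp only at h1 h2 h3 h4 ⊢
    have hj : j < n := by
      by_contra hj
      rw [hs j (by omega)] at h4
      by_cases hi : i < n
      · have := hs.lt hi; omega
      · rw [hs i (by omega)] at h4; omega
    simp only [B, Finset.mem_filter, Finset.mem_range]
    exact ⟨⟨by omega, h2⟩, hj, h3⟩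
  have h2 : {p : ℕ × ℕ | p.1 < p.2 ∧ b p.1 ∧ b p.2 ∧ s p.2 < s p.1}.ncard =
      {z ∈ B.sym2 | pairSign s z = -1}.card := by
    rw [← Set.ncard_coe_finset]
    refine Set.ncard_congr (fun p _ => s(p.1, p.2)) ?_ ?_ ?_
    · intro p hp
      have := hmem p hp
      simp only [Finset.coe_filter, Set.mem_ofPred_eq, Finset.mk_mem_sym2_iff, pairSign_mk]
      refine ⟨this, if_neg ?_⟩
      have := hp.1
      have := hp.2.2.2
      omega
    · rintro ⟨i, j⟩ ⟨i', j'⟩ hp hp' h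
      have h1 := hp.1
      have h2 := hp'.1
      simp only [Sym2.eq_iff] at h h1 h2
      ext <;> simp only <;> omega
    · intro z hz
      induction z using Sym2.ind with
      | _ i j =>
        simp only [Finset.coe_filter, Set.mem_ofPred_eq, Finset.mk_mem_sym2_iff, pairSign_mk] at hz
        obtain ⟨⟨hi, hj⟩, hz⟩ := hz
        have hz' : ¬ (i < j ↔ s i < s j) := by
          intro h; rw [if_pos h] at hz; exact absurd hz (by decide)
        have hbi := (Finset.mem_filter.1 hi).2
        have hbj := (Finset.mem_filter.1 hj).2
        have hij : i ≠ j := by rintro rfl; simp at hz'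
        have hsij : s i ≠ s j := fun e => hij (s.injective e)
        rcases lt_or_gt_of_ne hij with h | h
        · exact ⟨(i, j), ⟨h, hbi, hbj, by simp only; omega⟩, rfl⟩
        · exact ⟨(j, i), ⟨h, hbj, hbi, by simp only; omega⟩, Sym2.eq_swap⟩
  rw [h1, h2]
  push_cast
  rfl

end InversionSign

/-! ### Direct sums of unitary representations -/

section DirectSum

variable {Γ : Type u} [Group Γ]
variable {I : Type*} {F : I → Type*} [∀ i, NormedAddCommGroup (F i)]
  [∀ i, InnerProductSpace ℂ (F i)]

/-- The Hilbert direct sum of a family of unitary representations. -/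
def lpRep (ρ : ∀ i, Γ →* (F i ≃ₗᵢ[ℂ] F i)) : Γ →* (lp F 2 ≃ₗᵢ[ℂ] lp F 2) :=
  unitaryOfIsometry
    (fun γ =>
      { toFun := lpUnitary fun i => ρ i γ
        map_add' := fun f g => lp.ext (funext fun i => (ρ i γ).map_add (f i) (g i))
        map_smul' := fun a f => lp.ext (funext fun i => (ρ i γ).map_smul a (f i))
        norm_map' := fun f => by
          rw [lp.norm_eq_tsum_rpow (by norm_num), lp.norm_eq_tsum_rpow (by norm_num)]
          congr 1
          exact tsum_congr fun i => congrArg (· ^ _) ((ρ i γ).norm_map (f i)) })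
    (fun f => lp.ext (funext fun i => by
      change ρ i 1 (f i) = f i
      rw [map_one]; rfl))
    (fun γ γ' f => lp.ext (funext fun i => rep_mul_apply (ρ i) γ γ' (f i)))

theorem lpRep_apply_coe (ρ : ∀ i, Γ →* (F i ≃ₗᵢ[ℂ] F i)) (γ : Γ) (f : lp F 2) (i : I) :
    lpRep ρ γ f i = ρ i γ (f i) := rfl

theorem lpRep_single [DecidableEq I] (ρ : ∀ i, Γ →* (F i ≃ₗᵢ[ℂ] F i)) (γ : Γ) (i : I) (v : F i) :
    lpRep ρ γ (lp.single 2 i v) = lp.single 2 i (ρ i γ v) := by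
  refine lp.ext (funext fun j => ?_)
  rw [lpRep_apply_coe]
  by_cases h : j = i
  · subst h; rw [lp.single_apply_self, lp.single_apply_self]
  · rw [lp.single_apply_ne _ _ _ h, lp.single_apply_ne _ _ _ h, map_zero]

theorem spansDense_single [DecidableEq I] [∀ i, CompleteSpace (F i)] :
    SpansDense fun x : Σ i, F i => (lp.single 2 x.1 x.2 : lp F 2) := by
  refine SpansDense.of_forall_inner fun f hf => lp.ext (funext fun i => ?_)
  have := hf ⟨i, f i⟩
  rw [lp.inner_single_left] at this
  exact inner_self_eq_zero.1 this

theorem isStronglyContinuous_lpRep [TopologicalSpace Γ] [∀ i, CompleteSpace (F i)]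
    (ρ : ∀ i, Γ →* (F i ≃ₗᵢ[ℂ] F i)) (hρ : ∀ i, IsStronglyContinuous (ρ i)) :
    IsStronglyContinuous (lpRep ρ) := by
  classical
  refine continuous_rep_of_spansDense _ id spansDense_single fun x => ?_
  simp only [id, lpRep_single]
  exact (lp.isometry_single x.1).continuous.comp (hρ x.1 x.2)

end DirectSum

/-! ### The representations of `Γ^∞_e` and `𝔖_∞` on the infinite tensor product -/

namespace OlshanskiData

variable {Γ : Type u} [Group Γ] [TopologicalSpace Γ] (D : OlshanskiData Γ)

instance (r : D.ι ⊕ D.κ) : CompleteSpace (D.E r) := FiniteDimensional.complete ℂ (D.E r)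

/-- `siteRep` as a unitary representation. -/
def siteHom : Γ →* (D.Site ≃ₗᵢ[ℂ] D.Site) :=
  unitaryOfIsometry
    (fun γ =>
      { toFun := D.siteRep γ
        map_add' := fun v w => WithLp.ofLp_injective 2 (Prod.ext
          (map_add (lpRep (fun p : (D.ι ⊕ D.κ) × D.Leg => D.ρ p.1) γ) v.fst w.fst)
          (map_add (lpRep (fun _ : ℕ => D.ρ0) γ) v.snd w.snd))
        map_smul' := fun a v => WithLp.ofLp_injective 2 (Prod.ext
          (map_smul (lpRep (fun p : (D.ι ⊕ D.κ) × D.Leg => D.ρ p.1) γ) a v.fst)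
          (map_smul (lpRep (fun _ : ℕ => D.ρ0) γ) a v.snd))
        norm_map' := fun v => by
          have h1 := (lpRep (fun p : (D.ι ⊕ D.κ) × D.Leg => D.ρ p.1) γ).norm_map v.fst
          have h2 := (lpRep (fun _ : ℕ => D.ρ0) γ).norm_map v.snd
          rw [← sq_eq_sq₀ (norm_nonneg _) (norm_nonneg _), WithLp.prod_norm_sq_eq_of_L2,
            WithLp.prod_norm_sq_eq_of_L2, ← h1, ← h2]
          rfl })
    (fun v => WithLp.ofLp_injective 2 (Prod.ext
      (by
        change lpRep (fun p : (D.ι ⊕ D.κ) × D.Leg => D.ρ p.1) 1 v.fst = v.fst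
        rw [map_one]; rfl)
      (by
        change lpRep (fun _ : ℕ => D.ρ0) 1 v.snd = v.snd
        rw [map_one]; rfl)))
    (fun γ γ' v => WithLp.ofLp_injective 2 (Prod.ext
      (rep_mul_apply (lpRep (fun p : (D.ι ⊕ D.κ) × D.Leg => D.ρ p.1)) γ γ' v.fst)
      (rep_mul_apply (lpRep (fun _ : ℕ => D.ρ0)) γ γ' v.snd)))

theorem isStronglyContinuous_siteHom : IsStronglyContinuous D.siteHom := by
  intro v
  have h1 := isStronglyContinuous_lpRep (fun p : (D.ι ⊕ D.κ) × D.Leg => D.ρ p.1)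
    (fun p => D.ρ_cont p.1) v.fst
  have h2 := isStronglyContinuous_lpRep (fun _ : ℕ => D.ρ0) (fun _ => D.ρ0_cont) v.snd
  exact (WithLp.prod_continuous_toLp 2 _ _).comp (h1.prodMk h2)

/-- Generalized fillings of a site: `inl (v, y)` stands for `v ⊗ e_y` with `v` in one of the spaces
`E r`, and `inr h` for the vector `h` of `⊕_k H^{0k}`. -/
abbrev GFilling : Type u := ((Σ r, D.E r) × D.Leg) ⊕ D.ZeroPart

open Classical in
/-- The vector described by a generalized filling. -/
def gvec : D.GFilling → D.Site :=
  Sum.elim (fun p => WithLp.toLp 2 (lp.single 2 (p.1.1, p.2) p.1.2, 0)) D.zeroVec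

/-- Fillings as generalized fillings. -/
def ofFilling : D.Filling → D.GFilling :=
  Sum.map (Prod.map (fun x => ⟨x.1, D.e x.1 x.2⟩) id) id

theorem gvec_ofFilling (f : D.Filling) : D.gvec (D.ofFilling f) = D.fillVec f := by
  rcases f with ⟨x, y⟩ | h <;> rfl

theorem spansDense_fillVec : SpansDense D.fillVec := by
  classical
  refine SpansDense.of_forall_inner fun v hv => WithLp.ofLp_injective 2 (Prod.ext ?_ ?_)
  · refine lp.ext (funext fun p => ?_)
    refine InnerProductSpace.ext_inner_left_basis (𝕜 := ℂ) (D.e p.1).toBasis fun j => ?_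
    have := hv (Sum.inl (⟨p.1, j⟩, p.2))
    simp only [fillVec, Sum.elim_inl, tensorVec, WithLp.prod_inner_apply, inner_zero_left,
      add_zero] at this
    rw [lp.inner_single_left] at this
    simpa using this
  · have := hv (Sum.inr v.snd)
    simp only [fillVec, Sum.elim_inr, zeroVec, WithLp.prod_inner_apply, inner_zero_left,
      zero_add] at this
    exact inner_self_eq_zero.1 this

theorem spansDense_gvec : SpansDense D.gvec := by
  refine SpansDense.of_forall_inner fun v hv => D.spansDense_fillVec.eq_zero fun f => ?_
  rw [← gvec_ofFilling]
  exact hv _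

open Classical in
/-- The inner product of first tensor factors. -/
def firstInner (x x' : Σ r, D.E r) : ℂ :=
  inner ℂ (lp.single 2 x.1 x.2 : lp D.E 2) (lp.single 2 x'.1 x'.2)

open Classical in
/-- The inner product of second tensor factors. -/
def secondInner (y y' : D.Leg) : ℂ := if y = y' then 1 else 0

theorem firstInner_mk (r : D.ι ⊕ D.κ) (v v' : D.E r) :
    D.firstInner ⟨r, v⟩ ⟨r, v'⟩ = inner ℂ v v' := by
  classical
  rw [firstInner, lp.inner_single_left, lp.single_apply_self]

theorem firstInner_of_ne {x x' : Σ r, D.E r} (h : x.1 ≠ x'.1) : D.firstInner x x' = 0 := by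
  classical
  rw [firstInner, lp.inner_single_left, lp.single_apply_ne _ _ _ h, inner_zero_right]

theorem inner_gvec_inl (x x' : Σ r, D.E r) (y y' : D.Leg) :
    inner ℂ (D.gvec (Sum.inl (x, y))) (D.gvec (Sum.inl (x', y'))) =
      D.firstInner x x' * D.secondInner y y' := by
  classical
  obtain ⟨r, v⟩ := x
  obtain ⟨r', v'⟩ := x'
  simp only [gvec, Sum.elim_inl, WithLp.prod_inner_apply, inner_zero_left, add_zero, secondInner]
  rw [lp.inner_single_left]
  by_cases h : r = r'
  · subst h
    rw [firstInner_mk]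
    by_cases hy : y = y'
    · subst hy
      rw [lp.single_apply_self]; simp
    · rw [lp.single_apply_ne _ _ _ (by simpa using hy)]
      simp [hy]
  · rw [lp.single_apply_ne _ _ _ (by simp [h]), D.firstInner_of_ne h]
    simp

theorem inner_gvec_inr (h h' : D.ZeroPart) :
    inner ℂ (D.gvec (Sum.inr h)) (D.gvec (Sum.inr h')) = inner ℂ h h' := by
  simp [gvec, zeroVec, WithLp.prod_inner_apply]

theorem inner_gvec_inl_inr (p : (Σ r, D.E r) × D.Leg) (h : D.ZeroPart) :
    inner ℂ (D.gvec (Sum.inl p)) (D.gvec (Sum.inr h)) = 0 := by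
  simp [gvec, zeroVec, WithLp.prod_inner_apply]

theorem inner_gvec_inr_inl (p : (Σ r, D.E r) × D.Leg) (h : D.ZeroPart) :
    inner ℂ (D.gvec (Sum.inr h)) (D.gvec (Sum.inl p)) = 0 := by
  simp [gvec, zeroVec, WithLp.prod_inner_apply]

/-- The index `r` of the first tensor factor, if there is one. -/
def grade : D.GFilling → Option (D.ι ⊕ D.κ) := Sum.elim (fun p => some p.1.1) fun _ => none

/-- The sign depends only on the grades, so this orthogonality spares any comparison of different
signs. -/
theorem inner_gvec_of_grade_ne {a b : D.GFilling} (h : D.grade a ≠ D.grade b) :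
    inner ℂ (D.gvec a) (D.gvec b) = 0 := by
  rcases a with ⟨x, y⟩ | a <;> rcases b with ⟨x', y'⟩ | b
  · rw [inner_gvec_inl, D.firstInner_of_ne fun e => h (congrArg some e), zero_mul]
  · exact D.inner_gvec_inl_inr _ _
  · exact D.inner_gvec_inr_inl _ _
  · exact absurd rfl h

theorem isPair_iff_grade (c : ℕ → D.GFilling) (m : ℕ) :
    IsPair c m ↔ D.grade (c m) ≠ none := by
  unfold IsPair grade
  rcases c m with p | h <;> simp

theorem grade_moveFill (s : Equiv.Perm ℕ) (c : ℕ → D.GFilling) (k : ℕ) :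
    D.grade (moveFill s c k) = D.grade (c (s.symm k)) := by
  unfold moveFill grade
  rcases h1 : c (s.symm k) with ⟨x, y⟩ | z <;>
  rcases h2 : c (orderSource s (IsPair c) k) with ⟨x', y'⟩ | z' <;> simp

/-- The grade belongs to one of the `β_k`. -/
def IsBetaGrade (g : Option (D.ι ⊕ D.κ)) : Prop := ∃ k, g = some (Sum.inr k)

open Classical in
/-- The sites `m < n` with first tensor factor in one of the spaces of the `ϱ^{β_k}`. -/
def betaSites (n : ℕ) (c : ℕ → D.GFilling) : Finset ℕ :=
  {m ∈ Finset.range n | D.IsBetaGrade (D.grade (c m))}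

theorem betaSites_congr {n : ℕ} {c c' : ℕ → D.GFilling}
    (h : ∀ m < n, D.grade (c m) = D.grade (c' m)) : D.betaSites n c = D.betaSites n c' := by
  classical
  unfold betaSites
  refine Finset.filter_congr fun m hm => ?_
  rw [h m (Finset.mem_range.1 hm)]

theorem betaSites_moveFill {s : Equiv.Perm ℕ} {n : ℕ} (hs : FixesFrom s n) (c : ℕ → D.GFilling) :
    D.betaSites n (moveFill s c) = (D.betaSites n c).image s := by
  classical
  ext m
  simp only [betaSites, Finset.mem_filter, Finset.mem_range, Finset.mem_image, grade_moveFill]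
  constructor
  · rintro ⟨h1, h2⟩
    exact ⟨s.symm m, ⟨hs.symm.lt h1, h2⟩, by simp⟩
  · rintro ⟨k, ⟨h1, h2⟩, rfl⟩
    exact ⟨hs.lt h1, by simpa using h2⟩

/-- The sign `ψ(s, ζ)` for generalized fillings. -/
def gsign (s : Equiv.Perm ℕ) (n : ℕ) (c : ℕ → D.GFilling) : ℂ :=
  ((inversionSign s (D.betaSites n c) : ℤˣ) : ℤ)

theorem gsign_eq {s : Equiv.Perm ℕ} {n : ℕ} (hs : FixesFrom s n) (c : ℕ → D.GFilling) :
    D.gsign s n c = (-1) ^ {p : ℕ × ℕ | p.1 < p.2 ∧ D.IsBetaGrade (D.grade (c p.1)) ∧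
      D.IsBetaGrade (D.grade (c p.2)) ∧ s p.2 < s p.1}.ncard :=
  (neg_one_pow_inversions hs fun m => D.IsBetaGrade (D.grade (c m))).symm

theorem gsign_mul {s t : Equiv.Perm ℕ} {n : ℕ} (ht : FixesFrom t n) (c : ℕ → D.GFilling) :
    D.gsign (s * t) n c = D.gsign s n (moveFill t c) * D.gsign t n c := by
  rw [gsign, gsign, gsign, D.betaSites_moveFill ht, inversionSign_mul]
  push_cast
  rfl

theorem star_gsign_mul_self (s : Equiv.Perm ℕ) (n : ℕ) (c : ℕ → D.GFilling) :
    (starRingEnd ℂ) (D.gsign s n c) * D.gsign s n c = 1 := by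
  unfold gsign
  rcases Int.units_eq_one_or (inversionSign s (D.betaSites n c)) with h | h <;> rw [h] <;> simp

theorem sign_eq_gsign {s : Equiv.Perm ℕ} {n : ℕ} (hs : FixesFrom s n) (c : ℕ → D.Filling) :
    D.sign s c = D.gsign s n fun m => D.ofFilling (c m) := by
  have h : ∀ m, D.IsBetaSite c m ↔ D.IsBetaGrade (D.grade (D.ofFilling (c m))) := by
    intro m
    unfold IsBetaSite IsBetaGrade grade ofFilling
    rcases c m with ⟨x, y⟩ | h
    · simp only [Sum.inl.injEq, Prod.mk.injEq, Sum.map_inl, Sum.elim_inl, Prod.map_fst,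
        Option.some.injEq]
      constructor
      · rintro ⟨x', y', ⟨rfl, rfl⟩, h⟩
        exact Sum.isRight_iff.1 h
      · intro h
        exact ⟨x, y, ⟨rfl, rfl⟩, Sum.isRight_iff.2 h⟩
    · simp
  rw [D.gsign_eq hs, sign]
  simp only [h]

theorem move_eq_moveFill (s : Equiv.Perm ℕ) (c : ℕ → D.Filling) (k : ℕ) :
    D.move s c k = moveFill s c k := by
  have h : D.secondSource s c k = orderSource s (IsPair c) k := rfl
  unfold move moveFill
  rw [h]
  rcases c (s.symm k) with ⟨x, y⟩ | z <;>
  rcases c (orderSource s (IsPair c) k) with ⟨x', y'⟩ | z' <;> rfl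

theorem ofFilling_move (s : Equiv.Perm ℕ) (c : ℕ → D.Filling) (k : ℕ) :
    D.ofFilling (D.move s c k) = moveFill s (fun m => D.ofFilling (c m)) k := by
  rw [move_eq_moveFill]
  exact (moveFill_map (X' := Σ r, D.E r) (Z' := D.ZeroPart) (fun _ (x : D.Leg) => ⟨x.1, D.e x.1 x.2⟩)
    (fun _ => id) s c k).symm

/-- The sequence `ζ_0, …, ζ_{n-1}, η_n, η_{n+1}, …`, where `ζ_m` is described by `c m`. -/
def gseq (n : ℕ) (c : ℕ → D.GFilling) (m : ℕ) : D.Site := if m < n then D.gvec (c m) else D.η m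

theorem gseq_tail (n : ℕ) (c : ℕ → D.GFilling) (m : ℕ) (hm : n ≤ m) : D.gseq n c m = D.η m :=
  if_neg (by omega)

/-- Product vectors described by generalized fillings. -/
def gconfig (n : ℕ) (c : ℕ → D.GFilling) : D.Space := D.prodVec (D.gseq n c)

theorem config_eq_gconfig (n : ℕ) (c : ℕ → D.Filling) :
    D.config n c = D.gconfig n fun m => D.ofFilling (c m) := by
  unfold config gconfig
  congr 1
  ext1 m
  unfold gseq
  rw [gvec_ofFilling]

theorem gconfig_congr {n : ℕ} {c c' : ℕ → D.GFilling} (h : ∀ m < n, c m = c' m) :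
    D.gconfig n c = D.gconfig n c' := by
  unfold gconfig
  congr 1
  ext1 m
  unfold gseq
  split_ifs with hm
  · rw [h m hm]
  · rfl

/-- If all grades below `n` agree, the two signs are equal and cancel, and the product is merely
rearranged. Otherwise a site with differing grades makes the right side vanish, and its image under
`s` does so on the left. -/
theorem gsign_mul_prod {s : Equiv.Perm ℕ} {n : ℕ} (hs : FixesFrom s n) (c c' : ℕ → D.GFilling) :
    (starRingEnd ℂ) (D.gsign s n c) * D.gsign s n c' * ∏ k ∈ Finset.range n,
      inner ℂ (D.gvec (moveFill s c k)) (D.gvec (moveFill s c' k)) =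
      ∏ k ∈ Finset.range n, inner ℂ (D.gvec (c k)) (D.gvec (c' k)) := by
  classical
  by_cases h : ∀ m < n, D.grade (c m) = D.grade (c' m)
  · have hsgn : D.gsign s n c = D.gsign s n c' := by rw [gsign, gsign, D.betaSites_congr h]
    rw [hsgn, star_gsign_mul_self, one_mul]
    refine prod_moveFill hs D.firstInner D.secondInner (fun h h' => inner ℂ h h')
      (fun a b => inner ℂ (D.gvec a) (D.gvec b)) (fun x y x' y' => D.inner_gvec_inl x x' y y')
      (fun h h' => D.inner_gvec_inr h h') c c' fun m hm => ?_
    rw [isPair_iff_grade, isPair_iff_grade, h m hm]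
  · push Not at h
    obtain ⟨m, hm, hne⟩ := h
    rw [Finset.prod_eq_zero (Finset.mem_range.2 (hs.lt hm)), Finset.prod_eq_zero
      (Finset.mem_range.2 hm) (D.inner_gvec_of_grade_ne hne), mul_zero]
    refine D.inner_gvec_of_grade_ne ?_
    rw [grade_moveFill, grade_moveFill]
    simpa using hne

/-- The two lengths may differ. Sites from `n₀` on are left untouched by `s`, so only the product
below `n₀` has to be compared. -/
theorem inner_gsign_smul_gconfig {s : Equiv.Perm ℕ} {n₀ n n' : ℕ} (hs : FixesFrom s n₀)
    (hn : n₀ ≤ n) (hn' : n₀ ≤ n') (c c' : ℕ → D.GFilling) :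
    inner ℂ (D.gsign s n c • D.gconfig n (moveFill s c))
      (D.gsign s n' c' • D.gconfig n' (moveFill s c')) =
      inner ℂ (D.gconfig n c) (D.gconfig n' c') := by
  have hN : n₀ ≤ n + n' := by omega
  have e : ∀ l c, ∀ m ∈ Finset.Ico n₀ (n + n'), D.gseq l (moveFill s c) m =
      D.gseq l c m := by
    intro l c m hm
    unfold gseq
    rw [moveFill_of_fixesFrom hs c (Finset.mem_Ico.1 hm).1]
  -- The inversion count does not mention the length, provided `s` fixes everything beyond it.
  have hg : ∀ n, n₀ ≤ n → ∀ c, D.gsign s n c = D.gsign s n₀ c := by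
    intro n hn c
    rw [D.gsign_eq (hs.mono hn), D.gsign_eq hs]
  have hlt : ∀ n, n₀ ≤ n → ∀ c, ∀ m ∈ Finset.range n₀, D.gseq n c m = D.gvec (c m) := by
    intro n hn c m hm
    have := Finset.mem_range.1 hm
    exact if_pos (by omega)
  have key : ∀ c c', inner ℂ (D.gconfig n c) (D.gconfig n' c') =
      (∏ m ∈ Finset.range n₀, inner ℂ (D.gvec (c m)) (D.gvec (c' m))) *
        ∏ m ∈ Finset.Ico n₀ (n + n'), inner ℂ (D.gseq n c m) (D.gseq n' c' m) := by
    intro c c'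
    rw [gconfig, gconfig, inner_productVector_eq_prod D.η D.norm_η (n := n + n')
      (fun m hm => D.gseq_tail n c m (by omega)) (fun m hm => D.gseq_tail n' c' m (by omega)),
      ← Finset.prod_range_mul_prod_Ico _ hN]
    congr 1
    exact Finset.prod_congr rfl fun m hm => by rw [hlt n hn c m hm, hlt n' hn' c' m hm]
  have key' : ∏ m ∈ Finset.Ico n₀ (n + n'), inner ℂ (D.gseq n (moveFill s c) m)
      (D.gseq n' (moveFill s c') m) = ∏ m ∈ Finset.Ico n₀ (n + n'),
        inner ℂ (D.gseq n c m) (D.gseq n' c' m) :=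
    Finset.prod_congr rfl fun m hm => by rw [e n c m hm, e n' c' m hm]
  rw [inner_smul_left, inner_smul_right, key, key, ← D.gsign_mul_prod hs c c',
    hg n hn, hg n' hn', key']
  ring

/-- The lower bound on the length leaves room for given elements of the group to act only below it.
-/
theorem spansDense_gconfig (n₀ : ℕ) :
    SpansDense fun p : {p : ℕ × (ℕ → D.GFilling) // n₀ ≤ p.1} => D.gconfig p.1.1 p.1.2 :=
  haveI : Nonempty D.GFilling := ⟨Sum.inr 0⟩
  spansDense_productVector_of_spansDense D.η D.norm_η D.spansDense_gvec n₀

theorem spansDense_config (n₀ : ℕ) :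
    SpansDense fun p : {p : ℕ × (ℕ → D.Filling) // n₀ ≤ p.1} => D.config p.1.1 p.1.2 :=
  haveI : Nonempty D.Filling := ⟨Sum.inr 0⟩
  spansDense_productVector_of_spansDense D.η D.norm_η D.spansDense_fillVec n₀

theorem exists_perm_isometry (s : SInf) : ∃ U : D.Space →ₗᵢ[ℂ] D.Space, ∀ n, FixesFrom s.1 n →
    ∀ c, U (D.gconfig n c) = D.gsign s.1 n c • D.gconfig n (moveFill s.1 c) := by
  classical
  have hs := s.exists_fixesFrom
  -- Starting from the least length beyond which `s` is trivial, a single isometry serves all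
  -- admissible lengths.
  obtain ⟨U, hU⟩ := (D.spansDense_gconfig (Nat.find hs)).exists_isometry
    (fun p => D.gsign s.1 p.1.1 p.1.2 • D.gconfig p.1.1 (moveFill s.1 p.1.2))
    (fun p q => D.inner_gsign_smul_gconfig (Nat.find_spec hs) p.2 q.2 _ _)
  exact ⟨U, fun n hn c => hU ⟨(n, c), Nat.find_min' hs hn⟩⟩

/-- The action of `s` on the infinite tensor product. -/
def permIsometry (s : SInf) : D.Space →ₗᵢ[ℂ] D.Space := (D.exists_perm_isometry s).choose

theorem permIsometry_apply (s : SInf) {n : ℕ} (hs : FixesFrom s.1 n) (c : ℕ → D.GFilling) :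
    D.permIsometry s (D.gconfig n c) = D.gsign s.1 n c • D.gconfig n (moveFill s.1 c) :=
  (D.exists_perm_isometry s).choose_spec n hs c

theorem moveFill_one {X Y Z : Type*} (c : ℕ → (X × Y) ⊕ Z) (k : ℕ) : moveFill 1 c k = c k :=
  moveFill_of_fixesFrom (FixesFrom.one 0) c (Nat.zero_le k)

/-- The representation of `𝔖_∞` in the infinite tensor product. -/
def permRep : SInf →* (D.Space ≃ₗᵢ[ℂ] D.Space) :=
  unitaryOfIsometry D.permIsometry
    (fun x => by
      have : D.permIsometry 1 = LinearIsometry.id := by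
        refine (D.spansDense_gconfig 0).ext_isometry fun p => ?_
        rw [D.permIsometry_apply 1 (FixesFrom.one _)]
        change D.gsign 1 _ _ • D.gconfig _ (moveFill 1 _) = _
        rw [funext (moveFill_one p.1.2), gsign, inversionSign_one]
        simp
      rw [this]; rfl)
    (fun s t x => by
      obtain ⟨n, hn⟩ := s.exists_fixesFrom
      obtain ⟨n', hn'⟩ := t.exists_fixesFrom
      have : D.permIsometry (s * t) = (D.permIsometry s).comp (D.permIsometry t) := by
        refine (D.spansDense_gconfig (n + n')).ext_isometry fun p => ?_
        have h1 : FixesFrom s.1 p.1.1 := hn.mono (by have := p.2; omega)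
        have h2 : FixesFrom t.1 p.1.1 := hn'.mono (by have := p.2; omega)
        change _ = D.permIsometry s (D.permIsometry t _)
        rw [D.permIsometry_apply t h2, map_smul, D.permIsometry_apply s h1, smul_smul,
          D.permIsometry_apply (s * t) (h1.mul h2)]
        change D.gsign (s.1 * t.1) _ _ • D.gconfig _ (moveFill (s.1 * t.1) _) = _
        rw [D.gsign_mul h2, mul_comm]
        congr 1
        exact D.gconfig_congr fun m hm => (moveFill_mul h1 h2 _ hm).symm
      rw [this]; rfl)

theorem permRep_apply (s : SInf) {n : ℕ} (hs : FixesFrom s.1 n) (c : ℕ → D.GFilling) :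
    D.permRep s (D.gconfig n c) = D.gsign s.1 n c • D.gconfig n (moveFill s.1 c) :=
  D.permIsometry_apply s hs c

/-- The action of `Γ` on generalized fillings. -/
def gact (γ : Γ) : D.GFilling → D.GFilling :=
  Sum.map (Prod.map (fun v => ⟨v.1, D.ρ v.1 γ v.2⟩) id) fun h => lpRep (fun _ : ℕ => D.ρ0) γ h

/-- Generalized fillings are stable under `Γ`; the basis vectors `e_x ⊗ e_y` in general are not. -/
theorem siteHom_gvec (γ : Γ) (a : D.GFilling) : D.siteHom γ (D.gvec a) = D.gvec (D.gact γ a) := by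
  classical
  rcases a with ⟨⟨r, v⟩, y⟩ | h
  · refine WithLp.ofLp_injective 2 (Prod.ext ?_ ?_)
    · exact lpRep_single (fun p : (D.ι ⊕ D.κ) × D.Leg => D.ρ p.1) γ (r, y) v
    · exact map_zero (lpRep (fun _ : ℕ => D.ρ0) γ)
  · refine WithLp.ofLp_injective 2 (Prod.ext ?_ ?_)
    · exact map_zero (lpRep (fun p : (D.ι ⊕ D.κ) × D.Leg => D.ρ p.1) γ)
    · rfl

theorem grade_gact (γ : Γ) (a : D.GFilling) : D.grade (D.gact γ a) = D.grade a := by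
  rcases a with p | h <;> rfl

/-- The representation of `Γ^∞_e` in the infinite tensor product. -/
def gammaRep : GammaInf Γ →* (D.Space ≃ₗᵢ[ℂ] D.Space) := colourRep D.η D.norm_η D.siteHom

theorem gammaRep_apply (γ : GammaInf Γ) {ζ : ℕ → D.Site} (hζ : ∀ᶠ m in atTop, ζ m = D.η m) :
    D.gammaRep γ (D.prodVec ζ) = D.prodVec fun m => D.siteHom (γ.1 m) (ζ m) :=
  colourRep_apply D.η D.norm_η D.siteHom γ hζ

theorem gammaRep_gconfig (γ : GammaInf Γ) {n : ℕ} (hγ : ∀ m, n ≤ m → γ.1 m = 1)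
    (c : ℕ → D.GFilling) :
    D.gammaRep γ (D.gconfig n c) = D.gconfig n fun m => D.gact (γ.1 m) (c m) := by
  rw [gconfig, D.gammaRep_apply γ (eventually_atTop.2 ⟨n, D.gseq_tail n c⟩), gconfig]
  congr 1
  ext1 m
  unfold gseq
  split_ifs with hm
  · exact D.siteHom_gvec _ _
  · rw [hγ m (by omega), map_one]; rfl

/-- Colours act on first tensor factors and on `⊕_k H^{0k}`, exactly the parts that travel from `m`
to `s m`. They preserve grades, hence the sign. -/
theorem permRep_gammaRep (s : SInf) (γ : GammaInf Γ) (x : D.Space) :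
    D.permRep s (D.gammaRep γ x) = D.gammaRep (permAction Γ s γ) (D.permRep s x) := by
  obtain ⟨n, hn⟩ := s.exists_fixesFrom
  obtain ⟨n', hn'⟩ := eventually_atTop.1 γ.eventually_eq_one
  have key : D.permRep s * D.gammaRep γ = D.gammaRep (permAction Γ s γ) * D.permRep s := by
    refine (D.spansDense_gconfig (n + n')).ext_unitary fun p => ?_
    have h1 : FixesFrom s.1 p.1.1 := hn.mono (by have := p.2; omega)
    have h2 : ∀ m, p.1.1 ≤ m → γ.1 m = 1 := fun m hm => hn' m (by have := p.2; omega)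
    have h3 : ∀ m, p.1.1 ≤ m → (permAction Γ s γ).1 m = 1 := fun m hm => by
      change γ.1 (s.1.symm m) = 1
      rw [h1.symm m hm, h2 m hm]
    change D.permRep s (D.gammaRep γ _) = D.gammaRep (permAction Γ s γ) (D.permRep s _)
    rw [D.gammaRep_gconfig γ h2, D.permRep_apply s h1, D.permRep_apply s h1, map_smul,
      D.gammaRep_gconfig _ h3]
    congr 1
    · rw [gsign, gsign, D.betaSites_congr fun m _ => D.grade_gact (γ.1 m) (p.1.2 m)]
    · refine D.gconfig_congr fun m _ => ?_
      exact moveFill_map (X' := Σ r, D.E r) (Z' := D.ZeroPart)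
        (fun m v => ⟨v.1, D.ρ v.1 (γ.1 m) v.2⟩) (fun m h => lpRep (fun _ : ℕ => D.ρ0) (γ.1 m) h)
        s.1 p.1.2 m
  exact congrArg (fun U : D.Space ≃ₗᵢ[ℂ] D.Space => U x) key

/-- The representation of `Γ ≀ 𝔖_∞` in the infinite tensor product. -/
def wreathRep : Wreath Γ →* (D.Space ≃ₗᵢ[ℂ] D.Space) :=
  SemidirectProduct.lift D.gammaRep D.permRep fun s => by
    refine MonoidHom.ext fun γ => LinearIsometryEquiv.ext fun x => ?_
    change D.gammaRep (permAction Γ s γ) x = D.permRep s (D.gammaRep γ ((D.permRep s)⁻¹ x))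
    rw [permRep_gammaRep]
    congr 1
    exact ((D.permRep s).apply_symm_apply x).symm

theorem wreathRep_inl (γ : GammaInf Γ) :
    D.wreathRep (SemidirectProduct.inl γ) = D.gammaRep γ := SemidirectProduct.lift_inl ..

theorem wreathRep_inr (s : SInf) :
    D.wreathRep (SemidirectProduct.inr s) = D.permRep s := SemidirectProduct.lift_inr ..

theorem isRealization_wreathRep : D.IsRealization D.wreathRep where
  colour γ ζ hζ := by rw [wreathRep_inl, D.gammaRep_apply γ hζ]; rfl
  perm s n hs c := by
    rw [wreathRep_inr, config_eq_gconfig, D.permRep_apply s hs, config_eq_gconfig,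
      D.sign_eq_gsign hs]
    simp only [ofFilling_move]

/-- The two formulas prescribe both restrictions on families with dense span, and the two subgroups
generate. -/
theorem IsRealization.ext {π π' : Wreath Γ →* (D.Space ≃ₗᵢ[ℂ] D.Space)} (h : D.IsRealization π)
    (h' : D.IsRealization π') : π' = π := by
  refine SemidirectProduct.hom_ext ?_ ?_
  · refine MonoidHom.ext fun γ => (spansDense_productVector D.η D.norm_η).ext_unitary fun ζ => ?_
    exact (h'.colour γ ζ.1 ζ.2).trans (h.colour γ ζ.1 ζ.2).symm
  · refine MonoidHom.ext fun s => ?_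
    obtain ⟨n, hn⟩ := s.exists_fixesFrom
    refine (D.spansDense_config n).ext_unitary fun p => ?_
    exact (h'.perm s p.1.1 (hn.mono p.2) p.1.2).trans (h.perm s p.1.1 (hn.mono p.2) p.1.2).symm

theorem isStronglyContinuous_wreathRep : IsStronglyContinuous D.wreathRep := by
  intro x
  have : DiscreteTopology SInf := ⟨rfl⟩
  have h : (fun g : Wreath Γ => D.wreathRep g x) =
      (fun p : GammaInf Γ × SInf => D.gammaRep p.1 (D.permRep p.2 x)) ∘
        fun g => (g.left, g.right) := by
    ext1 g
    rw [← SemidirectProduct.inl_left_mul_inr_right g, rep_mul_apply, wreathRep_inl, wreathRep_inr]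
    simp
  rw [h]
  refine Continuous.comp ?_ continuous_induced_dom
  -- Since `𝔖_∞` is discrete, only continuity in the colours remains, on the vector `D.permRep s x`.
  rw [continuous_prod_of_discrete_right]
  exact fun s => isStronglyContinuous_colourRep D.η D.norm_η D.siteHom
    D.isStronglyContinuous_siteHom (D.permRep s x)

end OlshanskiData

/-! ### Signs of permutations with given cycles -/

section CycleSigns

/-- Both sides are homomorphisms in `σ`, so a permutation of a single fibre is enough to check. -/
theorem sign_sigmaCongrRight {P : Type*} [Fintype P] [DecidableEq P] {β : P → Type*}
    [∀ a, Fintype (β a)] [∀ a, DecidableEq (β a)] (σ : ∀ a, Equiv.Perm (β a)) :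
    Equiv.Perm.sign (Equiv.sigmaCongrRight σ) = ∏ a, Equiv.Perm.sign (σ a) := by
  let f : (∀ a, Equiv.Perm (β a)) →* ℤˣ :=
    Equiv.Perm.sign.comp (Equiv.Perm.sigmaCongrRightHom β)
  let g : (∀ a, Equiv.Perm (β a)) →* ℤˣ :=
    { toFun := fun σ => ∏ a, Equiv.Perm.sign (σ a)
      map_one' := by simp
      map_mul' := fun σ τ => by simp [Finset.prod_mul_distrib] }
  have h : f = g := by
    refine MonoidHom.pi_ext fun a τ => ?_
    have hg : g (Pi.mulSingle a τ) = Equiv.Perm.sign τ := by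
      change ∏ b, Equiv.Perm.sign ((Pi.mulSingle a τ : ∀ a, Equiv.Perm (β a)) b) = _
      rw [Finset.prod_eq_single a]
      · rw [Pi.mulSingle_eq_same]
      · intro b _ hb
        rw [Pi.mulSingle_eq_of_ne hb, Equiv.Perm.sign_one]
      · simp
    rw [hg]
    change Equiv.Perm.sign (Equiv.sigmaCongrRight (Pi.mulSingle a τ)) = _
    have hne : ∀ b, ∀ y : β b, b ≠ a →
        Equiv.sigmaCongrRight (Pi.mulSingle a τ : ∀ a, Equiv.Perm (β a)) ⟨b, y⟩ = ⟨b, y⟩ := by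
      intro b y hb
      rw [Equiv.sigmaCongrRight_apply]
      simp [Pi.mulSingle_eq_of_ne hb]
    symm
    refine Equiv.Perm.sign_bij (fun x _ => ⟨a, x⟩) ?_ ?_ ?_
    · intro x hx hx'
      simp
    · intro x y _ _ h
      simpa using h
    · rintro ⟨b, y⟩ hy
      by_cases hb : b = a
      · subst hb
        refine ⟨y, ?_, rfl⟩
        intro h
        apply hy
        simp [h]
      · exact absurd (hne b y hb) hy
  exact congrArg (fun k : (∀ a, Equiv.Perm (β a)) →* ℤˣ => k σ) h

/-- The increasing enumeration of `B` turns inversions of `s` on `B` into inversions of `σ`, and the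
sign of `σ` is the product over all pairs `i < j`. -/
theorem inversionSign_eq_sign {s : Equiv.Perm ℕ} {B : Finset ℕ}
    (σ : Equiv.Perm (Fin B.card))
    (h : ∀ i, B.orderEmbOfFin rfl (σ i) = s (B.orderEmbOfFin rfl i)) :
    inversionSign s B = Equiv.Perm.sign σ := by
  classical
  set g := B.orderEmbOfFin rfl with hg
  have hB : B = Finset.univ.image g := by
    ext k
    rw [← Finset.mem_coe, ← Finset.range_orderEmbOfFin B rfl]
    simp [hg]
  have h1 : inversionSign s B = ∏ z ∈ (Finset.univ : Finset (Fin B.card)).sym2,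
      pairSign s (z.map g) := by
    conv_lhs => rw [hB]
    rw [inversionSign, Finset.sym2_image,
      Finset.prod_image fun _ _ _ _ h => Sym2.map.injective g.injective h]
  have h2 : ∏ z ∈ (Finset.univ : Finset (Fin B.card)).sym2, pairSign s (z.map g) =
      ∏ z ∈ (Finset.univ : Finset (Fin B.card)).sym2 with ¬ z.IsDiag, pairSign s (z.map g) := by
    rw [Finset.prod_filter]
    refine Finset.prod_congr rfl fun z _ => ?_
    split_ifs with hz
    · induction z using Sym2.ind with
      | _ i j =>
        rw [Sym2.mk_isDiag_iff] at hz
        subst hz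
        simp [pairSign_mk]
    · rfl
  -- Unordered off-diagonal pairs are replaced by pairs `i < j`; the reindexing lemma is additive,
  -- hence `Additive ℤˣ`.
  have h3 : ∏ z ∈ (Finset.univ : Finset (Fin B.card)).sym2 with ¬ z.IsDiag, pairSign s (z.map g) =
      ∏ p ∈ (Finset.univ : Finset (Fin B.card)).offDiag with p.1 < p.2,
        pairSign s (s(p.1, p.2).map g) :=
    Finset.sum_sym2_filter_not_isDiag (M := Additive ℤˣ) Finset.univ
      fun z => Additive.ofMul (pairSign s (z.map g))
  rw [h1, h2, h3, Equiv.Perm.sign_eq_prod_prod_Iio, Finset.prod_sigma']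
  refine Finset.prod_bij' (fun p _ => ⟨p.2, p.1⟩) (fun p _ => (p.2, p.1)) ?_ ?_ ?_ ?_ ?_
  · intro p hp
    simpa using (Finset.mem_filter.1 hp).2
  · rintro ⟨j, i⟩ hp
    have : i < j := by simpa using hp
    simp [this, this.ne]
  · intro p _; rfl
  · intro p _; rfl
  · rintro ⟨i, j⟩ hp
    have hij : i < j := (Finset.mem_filter.1 hp).2
    rw [Sym2.map_mk, pairSign_mk, ← h, ← h]
    simp only [OrderEmbedding.lt_iff_lt, hij, true_iff]

/-- On the image of `e`, `s` is a disjoint union of rotations. The map `e` need not be increasing: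
passing to the increasing enumeration is a conjugation, which preserves the sign. -/
theorem inversionSign_eq_prod {s : Equiv.Perm ℕ} {P : Type*} [Fintype P] (l : P → ℕ)
    (e : (Σ q, Fin (l q)) → ℕ) (he : Function.Injective e)
    (hs : ∀ q i, e ⟨q, finRotate (l q) i⟩ = s (e ⟨q, i⟩)) :
    inversionSign s (Finset.univ.image e) = ∏ q, (-1 : ℤˣ) ^ (l q - 1) := by
  classical
  set B := Finset.univ.image e with hB
  let E1 : (Σ q, Fin (l q)) ≃ B := Equiv.ofBijective
    (fun x => ⟨e x, Finset.mem_image_of_mem e (Finset.mem_univ x)⟩)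
    ⟨fun x y h => he (congrArg Subtype.val h), fun ⟨k, hk⟩ => by
      obtain ⟨x, -, rfl⟩ := Finset.mem_image.1 hk
      exact ⟨x, rfl⟩⟩
  let E : (Σ q, Fin (l q)) ≃ Fin B.card := E1.trans (B.orderIsoOfFin rfl).toEquiv.symm
  have hE : ∀ x, B.orderEmbOfFin rfl (E x) = e x := by
    intro x
    rw [← Finset.coe_orderIsoOfFin_apply]
    change (((B.orderIsoOfFin rfl) ((B.orderIsoOfFin rfl).symm (E1 x)) : B) : ℕ) = e x
    rw [OrderIso.apply_symm_apply]
    rfl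
  rw [inversionSign_eq_sign (E.permCongr (Equiv.sigmaCongrRight fun q => finRotate (l q))),
    Equiv.Perm.sign_permCongr, sign_sigmaCongrRight]
  · exact Finset.prod_congr rfl fun q _ => sign_finRotate _
  · intro i
    obtain ⟨⟨q, k⟩, rfl⟩ := E.surjective i
    rw [Equiv.permCongr_apply, Equiv.symm_apply_apply, hE, hE, ← hs]
    rfl

end CycleSigns

/-! ### Traces of products around a cycle -/

section CyclicTrace

variable {L : Type*} [Fintype L] [DecidableEq L]

/-- The product `M_{l-1} ⋯ M_0`. -/
def descProd {R : Type*} [Monoid R] (M : ℕ → R) (l : ℕ) : R :=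
  ((List.range l).map M).reverse.prod

theorem descProd_zero {R : Type*} [Monoid R] (M : ℕ → R) : descProd M 0 = 1 := rfl

theorem descProd_succ {R : Type*} [Monoid R] (M : ℕ → R) (l : ℕ) :
    descProd M (l + 1) = M l * descProd M l := by
  simp [descProd, List.range_succ]

/-- A matrix product is a sum over paths. The path starts at `x 0 = a`, `M i` governs the step from
`x i` to `x (i + 1)`, and the last step leads to `b`. -/
theorem descProd_succ_apply (M : ℕ → Matrix L L ℂ) (l : ℕ) (a b : L) :
    descProd M (l + 1) b a = ∑ x : Fin (l + 1) → L, if x 0 = a then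
      (∏ i : Fin l, M i (x i.succ) (x i.castSucc)) * M l b (x (Fin.last l)) else 0 := by
  induction l generalizing b with
  | zero =>
    rw [descProd_succ, descProd_zero, mul_one,
      Fintype.sum_equiv (Equiv.funUnique (Fin 1) L) _ (fun y => if y = a then M 0 b y else 0)]
    · simp
    · intro x; simp
  | succ l ih =>
    rw [descProd_succ, Matrix.mul_apply,
      ← Fintype.sum_equiv (Fin.snocEquiv fun _ : Fin (l + 2) => L)
        (fun p => if p.2 0 = a then
          (∏ i : Fin l, M i (p.2 i.succ) (p.2 i.castSucc)) * M l p.1 (p.2 (Fin.last l)) *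
            M (l + 1) b p.1 else 0), Fintype.sum_prod_type]
    · refine Finset.sum_congr rfl fun c _ => ?_
      rw [ih, Finset.mul_sum]
      refine Finset.sum_congr rfl fun x _ => ?_
      split_ifs
      · ring
      · simp
    · rintro ⟨c, x⟩
      have h0 : (Fin.snoc x c : Fin (l + 2) → L) 0 = x 0 := by
        rw [← Fin.castSucc_zero, Fin.snoc_castSucc]
      simp only [Fin.snocEquiv, Equiv.coe_fn_mk, h0, Fin.snoc_last]
      rw [Fin.prod_univ_castSucc]
      simp only [Fin.succ_last, Fin.snoc_last, Fin.snoc_castSucc, ← Fin.castSucc_succ,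
        Fin.val_castSucc, Fin.val_last]

/-- The rotation closes the path, so a sum over closed paths is a trace, weighted by the label at
the starting point. -/
theorem sum_prod_finRotate (M : ℕ → Matrix L L ℂ) (ε : L → ℂ) {l : ℕ} (hl : 0 < l) :
    ∑ x : Fin l → L, ε (x ⟨0, hl⟩) * ∏ i : Fin l, M i (x (finRotate l i)) (x i) =
      ∑ a, ε a * descProd M l a a := by
  obtain ⟨l, rfl⟩ := Nat.exists_eq_succ_of_ne_zero hl.ne'
  simp only [Nat.succ_eq_add_one, descProd_succ_apply, Finset.mul_sum]
  rw [Finset.sum_comm]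
  refine Finset.sum_congr rfl fun x _ => ?_
  rw [Finset.sum_eq_single (x 0)]
  · rw [if_pos rfl, Fin.prod_univ_castSucc, finRotate_last]
    congr 2
    refine Finset.prod_congr rfl fun i _ => ?_
    have : finRotate (l + 1) i.castSucc = i.succ := finRotate_of_lt i.2
    rw [this]; rfl
  · intro a _ ha
    rw [if_neg (Ne.symm ha), mul_zero]
  · simp

end CyclicTrace

/-! ### The cycles of a finite permutation -/

section Cycles

/-- The cycles of `s`. -/
abbrev Cycles (s : Equiv.Perm ℕ) : Type := Quotient (Equiv.Perm.SameCycle.setoid s)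

/-- The cycles which meet `{0, …, n-1}`. -/
abbrev CyclesBelow (s : Equiv.Perm ℕ) (n : ℕ) : Type :=
  {q : Cycles s // ∃ k < n, Quotient.mk (Equiv.Perm.SameCycle.setoid s) k = q}

instance (s : Equiv.Perm ℕ) (n : ℕ) : Finite (CyclesBelow s n) := by
  refine Finite.of_surjective
    (fun k : Fin n => (⟨Quotient.mk _ (k : ℕ), k, k.2, rfl⟩ : CyclesBelow s n)) ?_
  rintro ⟨q, k, hk, rfl⟩
  exact ⟨⟨k, hk⟩, rfl⟩

theorem FixesFrom.pow {s : Equiv.Perm ℕ} {n : ℕ} (hs : FixesFrom s n) (i : ℕ) :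
    FixesFrom (s ^ i) n := by
  induction i with
  | zero => exact FixesFrom.one n
  | succ i ih => rw [pow_succ]; exact ih.mul hs

theorem FixesFrom.zpow {s : Equiv.Perm ℕ} {n : ℕ} (hs : FixesFrom s n) (i : ℤ) :
    FixesFrom (s ^ i) n := by
  obtain ⟨i, rfl | rfl⟩ := i.eq_nat_or_neg
  · rw [zpow_natCast]; exact hs.pow i
  · rw [zpow_neg, zpow_natCast]; exact (hs.pow i).symm

theorem FixesFrom.lt_of_sameCycle {s : Equiv.Perm ℕ} {n : ℕ} (hs : FixesFrom s n) {k m : ℕ}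
    (h : s.SameCycle k m) (hk : k < n) : m < n := by
  obtain ⟨i, rfl⟩ := h
  exact (hs.zpow i).lt hk

theorem FixesFrom.mem_periodicPts {s : Equiv.Perm ℕ} {n : ℕ} (hs : FixesFrom s n) (k : ℕ) :
    k ∈ Function.periodicPts s := by
  -- The bound is enlarged so that the orbit of `k` stays in a finite set, to which the pigeonhole
  -- principle applies.
  have hk : FixesFrom s (n + k + 1) := hs.mono (by omega)
  obtain ⟨i, j, hij, h'⟩ := Finite.exists_ne_map_eq_of_infinite
    fun i : ℕ => (⟨(s ^ i) k, (hk.pow i).lt (by omega)⟩ : Fin (n + k + 1))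
  have h : (s ^ i) k = (s ^ j) k := congrArg Fin.val h'
  clear h'
  wlog hlt : i < j generalizing i j
  · exact this j i hij.symm h.symm (by omega)
  refine ⟨j - i, by omega, ?_⟩
  rw [Function.IsPeriodicPt, Function.IsFixedPt, Equiv.Perm.iterate_eq_pow]
  refine (s ^ i).injective ?_
  rw [← Equiv.Perm.mul_apply, ← pow_add, h, Nat.add_sub_cancel' hlt.le]

theorem FixesFrom.minimalPeriod_pos {s : Equiv.Perm ℕ} {n : ℕ} (hs : FixesFrom s n) (k : ℕ) :
    0 < Function.minimalPeriod s k :=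
  Function.minimalPeriod_pos_of_mem_periodicPts (hs.mem_periodicPts k)

theorem sameCycle_out (s : Equiv.Perm ℕ) (k : ℕ) :
    s.SameCycle (Quotient.mk (Equiv.Perm.SameCycle.setoid s) k).out k :=
  Quotient.exact (s := Equiv.Perm.SameCycle.setoid s)
    (Quotient.out_eq (Quotient.mk (Equiv.Perm.SameCycle.setoid s) k))

/-- The `i`-th element of a cycle, counted from its chosen representative. -/
def cyclePoint (s : Equiv.Perm ℕ) (n : ℕ)
    (x : Σ q : CyclesBelow s n, Fin (Function.minimalPeriod s q.1.out)) : ℕ :=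
  (s ^ (x.2 : ℕ)) x.1.1.out

theorem out_lt {s : Equiv.Perm ℕ} {n : ℕ} (hs : FixesFrom s n) (q : CyclesBelow s n) :
    q.1.out < n := by
  obtain ⟨k, hk, h⟩ := q.2
  rw [← h]
  exact hs.lt_of_sameCycle (sameCycle_out s k).symm hk

theorem cyclePoint_lt {s : Equiv.Perm ℕ} {n : ℕ} (hs : FixesFrom s n)
    (x : Σ q : CyclesBelow s n, Fin (Function.minimalPeriod s q.1.out)) : cyclePoint s n x < n :=
  (hs.pow _).lt (out_lt hs x.1)

theorem mk_cyclePoint (s : Equiv.Perm ℕ) (n : ℕ)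
    (x : Σ q : CyclesBelow s n, Fin (Function.minimalPeriod s q.1.out)) :
    Quotient.mk (Equiv.Perm.SameCycle.setoid s) (cyclePoint s n x) = x.1.1 := by
  conv_rhs => rw [← Quotient.out_eq x.1.1]
  exact Quotient.sound (show s.SameCycle _ _ from
    Equiv.Perm.sameCycle_pow_left.2 (Equiv.Perm.SameCycle.refl _ _))

theorem cyclePoint_injective (s : Equiv.Perm ℕ) (n : ℕ) :
    Function.Injective (cyclePoint s n) := by
  intro x y h
  have hq : x.1 = y.1 := by
    refine Subtype.ext ?_
    rw [← mk_cyclePoint s n x, ← mk_cyclePoint s n y, h]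
  obtain ⟨q, i⟩ := x
  obtain ⟨q', j⟩ := y
  simp only at hq
  subst hq
  simp only [cyclePoint, ← Equiv.Perm.iterate_eq_pow] at h
  have := Function.iterate_injOn_Iio_minimalPeriod (f := s) (x := q.1.out) i.2 j.2 h
  rw [Fin.ext this]

theorem FixesFrom.exists_pow_eq {s : Equiv.Perm ℕ} {n : ℕ} (hs : FixesFrom s n) {k m : ℕ}
    (h : s.SameCycle k m) : ∃ i < Function.minimalPeriod s k, (s ^ i) k = m := by
  obtain ⟨i, hi⟩ := h
  have hpos : (0 : ℤ) < Function.minimalPeriod s k := by exact_mod_cast hs.minimalPeriod_pos _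
  set l := Function.minimalPeriod s k with hl
  have h1 : (s ^ (l : ℤ)) k = k := by
    rw [zpow_natCast, ← Equiv.Perm.iterate_eq_pow]
    exact Function.isPeriodicPt_minimalPeriod s _
  have h2 : ∀ j : ℤ, ((s ^ (l : ℤ)) ^ j) k = k := fun j =>
    Equiv.Perm.zpow_apply_eq_self_of_apply_eq_self h1 j
  have h3 : 0 ≤ i % l := Int.emod_nonneg _ hpos.ne'
  have h4 : i % l < l := Int.emod_lt_of_pos _ hpos
  refine ⟨(i % l).toNat, by omega, ?_⟩
  rw [← zpow_natCast, Int.toNat_of_nonneg h3, ← hi]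
  conv_rhs => rw [← Int.emod_add_mul_ediv i l, zpow_add, zpow_mul, Equiv.Perm.mul_apply, h2]

theorem exists_cyclePoint {s : Equiv.Perm ℕ} {n : ℕ} (hs : FixesFrom s n) {k : ℕ} (hk : k < n) :
    ∃ x, cyclePoint s n x = k := by
  obtain ⟨i, hi, h⟩ := hs.exists_pow_eq (sameCycle_out s k)
  exact ⟨⟨⟨Quotient.mk _ k, k, hk, rfl⟩, ⟨i, hi⟩⟩, h⟩

theorem cyclePoint_finRotate {s : Equiv.Perm ℕ} {n : ℕ} (q : CyclesBelow s n)
    (i : Fin (Function.minimalPeriod s q.1.out)) :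
    cyclePoint s n ⟨q, finRotate _ i⟩ = s (cyclePoint s n ⟨q, i⟩) := by
  simp only [cyclePoint, ← Equiv.Perm.mul_apply, ← pow_succ']
  have hp := Function.isPeriodicPt_minimalPeriod s q.1.out
  generalize Function.minimalPeriod s q.1.out = l at i hp ⊢
  obtain _ | l := l
  · exact i.elim0
  · rcases Nat.lt_succ_iff_lt_or_eq.1 i.2 with h | h
    · have : finRotate (l + 1) i = ⟨i + 1, by omega⟩ := finRotate_of_lt h
      rw [this]
    · have hi : i = Fin.last l := Fin.ext h
      rw [hi, finRotate_last]
      simp only [Fin.val_zero, pow_zero, Fin.val_last, ← Equiv.Perm.iterate_eq_pow]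
      exact hp.symm

/-- The points below `n`, arranged along the cycles. -/
def cycleEquiv {s : Equiv.Perm ℕ} {n : ℕ} (hs : FixesFrom s n) :
    (Σ q : CyclesBelow s n, Fin (Function.minimalPeriod s q.1.out)) ≃ Fin n :=
  Equiv.ofBijective (fun x => ⟨cyclePoint s n x, cyclePoint_lt hs x⟩)
    ⟨fun _ _ h => cyclePoint_injective s n (congrArg Fin.val h), fun k => by
      obtain ⟨x, hx⟩ := exists_cyclePoint hs k.2
      exact ⟨x, Fin.ext hx⟩⟩

end Cycles

/-! ### The character formula -/

section GradedSum

theorem finRotate_mk {l i : ℕ} (h : i + 1 < l) :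
    finRotate l ⟨i, (Nat.lt_succ_self i).trans h⟩ = ⟨i + 1, h⟩ := by
  obtain _ | l := l
  · omega
  · exact finRotate_of_lt (by omega)

open Classical in
/-- A signed sum over colourings of `{0, …, n-1}` factors over the cycles of `s`. -/
theorem sum_inversionSign_mul_prod {L : Type*} [Fintype L] [DecidableEq L] (b : L → Prop)
    (M : ℕ → Matrix L L ℂ) (hM : ∀ m x y, M m x y ≠ 0 → (b x ↔ b y))
    {s : Equiv.Perm ℕ} {n : ℕ} (hs : FixesFrom s n) [Fintype (CyclesBelow s n)] :
    ∑ x : Fin n → L,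
      (((inversionSign s ((Finset.univ.filter fun m => b (x m)).image Fin.val) : ℤˣ) : ℤ) : ℂ) *
        ∏ m : Fin n, M m (x ⟨s m, hs.lt m.2⟩) (x m) =
      ∏ q : CyclesBelow s n, ∑ a, (if b a then (-1) ^ (Function.minimalPeriod s q.1.out - 1) else 1) *
        descProd (fun i => M ((s ^ i) q.1.out)) (Function.minimalPeriod s q.1.out) a a := by
  set l : CyclesBelow s n → ℕ := fun q => Function.minimalPeriod s q.1.out with hl
  have hpos : ∀ q, 0 < l q := fun q => hs.minimalPeriod_pos _
  -- A colouring of `{0, …, n-1}` amounts to independent colourings of the cycles; the distributive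
  -- law then yields the product over cycles.
  let Φ : (∀ q, Fin (l q) → L) ≃ (Fin n → L) :=
    (Equiv.piCurry fun q (_ : Fin (l q)) => L).symm.trans
      ((cycleEquiv hs).arrowCongr (Equiv.refl L))
  have hΦ : ∀ y q i, Φ y (cycleEquiv hs ⟨q, i⟩) = y q i := by
    intro y q i
    change ((Equiv.piCurry fun q (_ : Fin (l q)) => L).symm y)
      ((cycleEquiv hs).symm (cycleEquiv hs ⟨q, i⟩)) = _
    rw [Equiv.symm_apply_apply]
    rfl
  have hrot : ∀ y q i, Φ y ⟨s (cycleEquiv hs ⟨q, i⟩), hs.lt (Fin.is_lt _)⟩ =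
      y q (finRotate (l q) i) := by
    intro y q i
    rw [← hΦ y q (finRotate (l q) i)]
    exact congrArg (Φ y) (Fin.ext (cyclePoint_finRotate q i).symm)
  have hprod : ∀ y, ∏ m : Fin n, M m (Φ y ⟨s m, hs.lt m.2⟩) (Φ y m) =
      ∏ q, ∏ i : Fin (l q), M ((s ^ (i : ℕ)) q.1.out) (y q (finRotate (l q) i)) (y q i) := by
    intro y
    rw [← Fintype.prod_equiv (cycleEquiv hs) (fun x : Σ q, Fin (l q) =>
      M ((s ^ (x.2 : ℕ)) x.1.1.out) (y x.1 (finRotate (l x.1) x.2)) (y x.1 x.2)),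
      Fintype.prod_sigma]
    rintro ⟨q, i⟩
    rw [hrot, hΦ]
    rfl
  rw [← Fintype.sum_equiv Φ (fun y => ∏ q, ((if b (y q ⟨0, hpos q⟩) then (-1) ^ (l q - 1) else 1) *
    ∏ i : Fin (l q), M ((s ^ (i : ℕ)) q.1.out) (y q (finRotate (l q) i)) (y q i)))]
  · rw [← Fintype.piFinset_univ, ← Finset.prod_univ_sum (fun _ => Finset.univ)
      fun q (z : Fin (l q) → L) => ((if b (z ⟨0, hpos q⟩) then (-1) ^ (l q - 1) else 1) *
        ∏ i : Fin (l q), M ((s ^ (i : ℕ)) q.1.out) (z (finRotate (l q) i)) (z i))]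
    refine Finset.prod_congr rfl fun q _ => ?_
    exact sum_prod_finRotate (fun i => M ((s ^ i) q.1.out))
      (fun a => if b a then (-1) ^ (l q - 1) else 1) (hpos q)
  · intro y
    rw [hprod, Finset.prod_mul_distrib]
    by_cases h0 : ∏ q, ∏ i : Fin (l q),
        M ((s ^ (i : ℕ)) q.1.out) (y q (finRotate (l q) i)) (y q i) = 0
    · rw [h0, mul_zero, mul_zero]
    congr 1
    -- In a nonvanishing term no matrix entry is zero, so `b` is constant along each cycle and can
    -- be read at its starting point.
    have hstep : ∀ q i, (b (y q (finRotate (l q) i)) ↔ b (y q i)) := fun q i =>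
      hM _ _ _ (Finset.prod_ne_zero_iff.1 (Finset.prod_ne_zero_iff.1 h0 q (Finset.mem_univ q)) i
        (Finset.mem_univ i))
    have hconst : ∀ q (i : ℕ) (hi : i < l q), (b (y q ⟨i, hi⟩) ↔ b (y q ⟨0, hpos q⟩)) := by
      intro q i
      induction i with
      | zero => intro _; rfl
      | succ i ih =>
        intro hi
        rw [← ih (by omega), ← hstep q ⟨i, by omega⟩]
        rw [finRotate_mk hi]
    -- The points coloured by `b` form a union of cycles, enumerated here along those cycles so that
    -- `inversionSign_eq_prod` applies.
    let e : (Σ q : {q // b (y q ⟨0, hpos q⟩)}, Fin (l q.1)) → ℕ := fun x =>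
      cyclePoint s n ⟨x.1.1, x.2⟩
    have he : Function.Injective e := by
      rintro ⟨⟨q, hq⟩, i⟩ ⟨⟨q', hq'⟩, j⟩ h
      have := cyclePoint_injective s n h
      obtain ⟨rfl, h2⟩ := Sigma.mk.inj_iff.1 this
      obtain rfl : i = j := eq_of_heq h2
      rfl
    have himg : (Finset.univ.filter fun m => b (Φ y m)).image Fin.val = Finset.univ.image e := by
      ext k
      simp only [Finset.mem_image, Finset.mem_filter, Finset.mem_univ, true_and]
      constructor
      · rintro ⟨m, hm, rfl⟩
        obtain ⟨⟨q, i⟩, rfl⟩ := (cycleEquiv hs).surjective m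
        rw [hΦ] at hm
        exact ⟨⟨⟨q, (hconst q i i.2).1 hm⟩, i⟩, rfl⟩
      · rintro ⟨⟨⟨q, hq⟩, i⟩, rfl⟩
        refine ⟨cycleEquiv hs ⟨q, i⟩, ?_, rfl⟩
        rw [hΦ]
        exact (hconst q i i.2).2 hq
    rw [himg, inversionSign_eq_prod (fun q : {q // b (y q ⟨0, hpos q⟩)} => l q.1) e he
      (fun q i => cyclePoint_finRotate q.1 i)]
    push_cast
    rw [← Finset.prod_filter, ← Finset.prod_subtype (p := fun q => b (y q ⟨0, hpos q⟩))
      (Finset.univ.filter fun q => b (y q ⟨0, hpos q⟩)) (by simp)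
      (fun q => (-1 : ℂ) ^ (l q - 1))]

end GradedSum

/-! ### Expansion of the vacuum expectation over colourings -/

namespace OlshanskiData

variable {Γ : Type u} [Group Γ] [TopologicalSpace Γ] (D : OlshanskiData Γ)

/-- Labels for the terms of the finite part of `η_m` given by a finite set of indices `r`. -/
abbrev TLeg (F : Finset (D.ι ⊕ D.κ)) : Type :=
  (Σ r : F, Fin (Module.finrank ℂ (D.E r))) ⊕ Unit

variable (F : Finset (D.ι ⊕ D.κ))

/-- The coefficients of the terms of `η_m`. -/
def weight : D.TLeg F → ℂ :=
  Sum.elim (fun x => ((√(D.a x.1) : ℝ) : ℂ)) fun _ => ((√D.δ : ℝ) : ℂ)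

/-- The fillings which appear in `η_m`. -/
def etaFill (m : ℕ) : D.TLeg F → D.GFilling :=
  Sum.elim (fun x => Sum.inl (⟨x.1, D.e x.1 x.2⟩, ⟨x.1, x.2⟩)) fun _ => Sum.inr (lp.single 2 m D.ξ0)

/-- The vector `η_m` with the sum over `r` restricted to a finite set. -/
def ηTrunc (m : ℕ) : D.Site :=
  ∑ r ∈ F, D.ηTerm r + ((√D.δ : ℝ) : ℂ) • D.zeroVec (lp.single 2 m D.ξ0)

theorem ηTrunc_eq (m : ℕ) : D.ηTrunc F m = ∑ x, D.weight F x • D.gvec (D.etaFill F m x) := by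
  rw [Fintype.sum_sum_type, Fintype.sum_sigma, ηTrunc, ← Finset.sum_coe_sort F]
  congr 1
  · refine Finset.sum_congr rfl fun r _ => ?_
    rw [ηTerm, Finset.smul_sum]
    rfl
  · simp [weight, etaFill, gvec]

theorem tendsto_ηTrunc (m : ℕ) : Tendsto (fun F => D.ηTrunc F m) atTop (nhds (D.η m)) :=
  D.summable_ηTerm.hasSum.add_const _

/-- The second tensor factor `e_y` selects the single term `e_y ⊗ e_y` of `ηTensor`. -/
theorem inner_ηTensor_gvec_inl (x : Σ r, D.E r) (y : D.Leg) :
    inner ℂ D.ηTensor (D.gvec (Sum.inl (x, y))) =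
      ((√(D.a y.1) : ℝ) : ℂ) * D.firstInner ⟨y.1, D.e y.1 y.2⟩ x := by
  classical
  have h1 := (innerSLFlip ℂ (D.gvec (Sum.inl (x, y)))).hasSum D.summable_ηTerm.hasSum
  simp only [innerSLFlip_apply_apply] at h1
  have h2 : ∀ r, inner ℂ (D.ηTerm r) (D.gvec (Sum.inl (x, y))) =
      if r = y.1 then ((√(D.a y.1) : ℝ) : ℂ) * D.firstInner ⟨y.1, D.e y.1 y.2⟩ x else 0 := by
    intro r
    have h3 : ∀ j, inner ℂ (D.tensorVec ⟨r, j⟩ ⟨r, j⟩) (D.gvec (Sum.inl (x, y))) =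
        D.firstInner ⟨r, D.e r j⟩ x * D.secondInner ⟨r, j⟩ y := fun j =>
      D.inner_gvec_inl ⟨r, D.e r j⟩ x ⟨r, j⟩ y
    simp only [ηTerm, inner_smul_left, sum_inner, h3, Complex.conj_ofReal]
    obtain ⟨r', j'⟩ := y
    split_ifs with h
    · subst h
      congr 1
      rw [Finset.sum_eq_single j']
      · simp [secondInner]
      · intro j _ hj
        simp [secondInner, hj]
      · simp
    · rw [Finset.sum_eq_zero, mul_zero]
      intro j _
      simp [secondInner, h]
  simp only [h2] at h1
  exact h1.unique (hasSum_ite_eq y.1 _)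

theorem inner_η_gvec_inl (m : ℕ) (x : Σ r, D.E r) (y : D.Leg) :
    inner ℂ (D.η m) (D.gvec (Sum.inl (x, y))) =
      ((√(D.a y.1) : ℝ) : ℂ) * D.firstInner ⟨y.1, D.e y.1 y.2⟩ x := by
  rw [η, inner_add_left, inner_smul_left, inner_ηTensor_gvec_inl]
  have : inner ℂ (D.zeroVec (lp.single 2 m D.ξ0)) (D.gvec (Sum.inl (x, y))) = 0 :=
    D.inner_gvec_inr_inl _ _
  rw [this, mul_zero, add_zero]

/-- Only the `m`-th copy of `H⁰` meets `η_m`; this confines the contribution of `ϱ⁰` to fixed points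
of `s`. -/
theorem inner_η_gvec_inr (m : ℕ) (h : D.ZeroPart) :
    inner ℂ (D.η m) (D.gvec (Sum.inr h)) = ((√D.δ : ℝ) : ℂ) * inner ℂ D.ξ0 (h m) := by
  have h1 : inner ℂ D.ηTensor (D.gvec (Sum.inr h)) = 0 := D.inner_ηTensor_zeroVec h
  have h2 : inner ℂ (D.zeroVec (lp.single 2 m D.ξ0)) (D.gvec (Sum.inr h)) =
      inner ℂ (lp.single 2 m D.ξ0 : D.ZeroPart) h := D.inner_gvec_inr _ _
  rw [η, inner_add_left, inner_smul_left, h1, h2, zero_add, Complex.conj_ofReal,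
    lp.inner_single_left]

/-- The matrix of `ϱ^r(γ)`. -/
def repMatrix (r : D.ι ⊕ D.κ) :
    Γ →* Matrix (Fin (Module.finrank ℂ (D.E r))) (Fin (Module.finrank ℂ (D.E r))) ℂ where
  toFun γ := LinearMap.toMatrix (D.e r).toBasis (D.e r).toBasis
    ((D.ρ r γ).toLinearEquiv : D.E r →ₗ[ℂ] D.E r)
  map_one' := by
    rw [map_one]
    exact LinearMap.toMatrix_id _
  map_mul' γ γ' := by
    rw [map_mul, ← LinearMap.toMatrix_mul]
    rfl

theorem repMatrix_apply (r : D.ι ⊕ D.κ) (γ : Γ) (i j : Fin (Module.finrank ℂ (D.E r))) :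
    D.repMatrix r γ i j = inner ℂ (D.e r i) (D.ρ r γ (D.e r j)) := by
  change LinearMap.toMatrix _ _ _ i j = _
  rw [LinearMap.toMatrix_apply]
  simp [OrthonormalBasis.repr_apply_apply]

theorem trace_repMatrix (r : D.ι ⊕ D.κ) (γ : Γ) : (D.repMatrix r γ).trace =
    LinearMap.trace ℂ (D.E r) ((D.ρ r γ).toLinearEquiv : D.E r →ₗ[ℂ] D.E r) :=
  (LinearMap.trace_eq_matrix_trace ℂ (D.e r).toBasis _).symm

open Classical in
/-- The matrix which describes the contribution of a site to the character. -/
def siteMatrix (γ : Γ) (c : ℂ) : Matrix (D.TLeg F) (D.TLeg F) ℂ :=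
  Matrix.fromBlocks (Matrix.blockDiagonal' fun r : F => (D.a r : ℂ) • D.repMatrix r γ) 0 0
    (Matrix.of fun _ _ => c)

-- Multiplication is blockwise and each `ϱ^r` is multiplicative, so a cycle of length `l` yields
-- `a_r^l` and the representation of the cycle product.
open Classical in
theorem descProd_siteMatrix (γ : ℕ → Γ) (c : ℕ → ℂ) (l : ℕ) :
    descProd (fun i => D.siteMatrix F (γ i) (c i)) l =
      Matrix.fromBlocks (Matrix.blockDiagonal' fun r : F =>
        (D.a r : ℂ) ^ l • D.repMatrix r (descProd γ l)) 0 0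
          (Matrix.of fun _ _ => ∏ i ∈ Finset.range l, c i) := by
  induction l with
  | zero =>
    have h1 : (Matrix.blockDiagonal' fun r : F => (D.a r : ℂ) ^ 0 • D.repMatrix r (descProd γ 0)) =
        1 := by
      simp only [descProd_zero, map_one, pow_zero, one_smul]
      exact Matrix.blockDiagonal'_one
    have h2 : (Matrix.of fun _ _ : Unit => ∏ i ∈ Finset.range 0, c i) = 1 := by
      ext; simp
    rw [h1, h2, Matrix.fromBlocks_one, descProd_zero]
  | succ l ih =>
    rw [descProd_succ, ih, siteMatrix, Matrix.fromBlocks_multiply]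
    simp only [Matrix.mul_zero, Matrix.zero_mul, add_zero, zero_add, ← Matrix.blockDiagonal'_mul]
    congr 1
    · congr 1
      ext1 r
      rw [descProd_succ, map_mul, Matrix.smul_mul, Matrix.mul_smul, smul_smul, pow_succ']
    · ext
      simp [Matrix.mul_apply, Finset.prod_range_succ, mul_comm]

/-- The label belongs to one of the `β_k`. -/
def IsBetaLabel : D.TLeg F → Prop := Sum.elim (fun x => x.1.1.isRight) fun _ => False

theorem isBetaLabel_iff_of_siteMatrix_ne_zero (γ : Γ) (c : ℂ) (x y : D.TLeg F)
    (h : D.siteMatrix F γ c x y ≠ 0) : D.IsBetaLabel F x ↔ D.IsBetaLabel F y := by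
  classical
  rcases x with ⟨r, i⟩ | x <;> rcases y with ⟨r', j⟩ | y
  · have : r = r' := by
      by_contra hr
      refine h ?_
      rw [siteMatrix, Matrix.fromBlocks_apply₁₁]
      exact Matrix.blockDiagonal'_apply_ne _ _ _ hr
    subst this
    rfl
  · exact absurd rfl h
  · exact absurd rfl h
  · rfl

open Classical in
theorem sum_sign_mul_descProd (γ : ℕ → Γ) (c : ℕ → ℂ) (l : ℕ) :
    ∑ a, (if D.IsBetaLabel F a then (-1 : ℂ) ^ (l - 1) else 1) *
      descProd (fun i => D.siteMatrix F (γ i) (c i)) l a a =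
    ∑ r ∈ F, (Sum.elim (fun _ => 1) (fun _ => (-1) ^ (l - 1)) r : ℂ) * (D.a r : ℂ) ^ l *
      LinearMap.trace ℂ (D.E r) ((D.ρ r (descProd γ l)).toLinearEquiv : D.E r →ₗ[ℂ] D.E r) +
      ∏ i ∈ Finset.range l, c i := by
  rw [descProd_siteMatrix, Fintype.sum_sum_type, Fintype.sum_sigma, ← Finset.sum_coe_sort F]
  congr 1
  · refine Finset.sum_congr rfl fun r _ => ?_
    rw [← trace_repMatrix, Matrix.trace, Finset.mul_sum]
    refine Finset.sum_congr rfl fun j _ => ?_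
    rw [Matrix.fromBlocks_apply₁₁, Matrix.blockDiagonal'_apply_eq]
    obtain ⟨r | r, hr⟩ := r
    · simp [IsBetaLabel]
    · simp [IsBetaLabel, mul_assoc]
  · simp [IsBetaLabel]

/-- The fillings of the sites below `n` described by a colouring. -/
def fillOf {n : ℕ} (x : Fin n → D.TLeg F) (m : ℕ) : D.GFilling :=
  if h : m < n then D.etaFill F m (x ⟨m, h⟩) else Sum.inr 0

theorem headMap_ηTrunc (n : ℕ) : headMap D.η D.norm_η n (fun i => D.ηTrunc F i) =
    ∑ x : Fin n → D.TLeg F, (∏ i, D.weight F (x i)) • D.gconfig n (D.fillOf F x) := by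
  classical
  simp only [ηTrunc_eq]
  rw [ContinuousMultilinearMap.map_sum]
  refine Finset.sum_congr rfl fun x _ => ?_
  rw [ContinuousMultilinearMap.map_smul_univ]
  congr 1
  refine Eq.trans ?_
    (productVector_eq_headVec D.η D.norm_η (D.gseq_tail n (D.fillOf F x))).symm
  rw [headMap_apply]
  congr 1
  ext1 i
  simp [gseq, fillOf]

theorem inner_vacuum_gconfig (n : ℕ) (c : ℕ → D.GFilling) : inner ℂ D.vacuum (D.gconfig n c) =
    ∏ k ∈ Finset.range n, inner ℂ (D.η k) (D.gvec (c k)) := by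
  rw [gconfig, inner_productVector_eq_prod D.η D.norm_η (fun _ _ => rfl) (D.gseq_tail n c)]
  exact Finset.prod_congr rfl fun k hk => by rw [gseq, if_pos (Finset.mem_range.1 hk)]

/-- Of the two square roots making up `a_r`, one is the coefficient in the expanded vector at the
source site, the other comes from the inner product with `η` at the target. -/
theorem siteMatrix_inl_inl (γ : Γ) (c : ℂ) (x y : Σ r : F, Fin (Module.finrank ℂ (D.E r))) :
    D.siteMatrix F γ c (Sum.inl x) (Sum.inl y) =
      ((√(D.a y.1) : ℝ) : ℂ) * (((√(D.a x.1) : ℝ) : ℂ) *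
        D.firstInner ⟨x.1, D.e x.1 x.2⟩ ⟨y.1, D.ρ y.1 γ (D.e y.1 y.2)⟩) := by
  classical
  obtain ⟨r, i⟩ := x
  obtain ⟨r', j⟩ := y
  rw [siteMatrix, Matrix.fromBlocks_apply₁₁]
  by_cases h : r = r'
  · subst h
    rw [Matrix.blockDiagonal'_apply_eq, firstInner_mk, ← mul_assoc, ← Complex.ofReal_mul,
      Real.mul_self_sqrt (D.a_pos r).le, Matrix.smul_apply, repMatrix_apply, smul_eq_mul]
  · rw [Matrix.blockDiagonal'_apply_ne _ _ _ h, D.firstInner_of_ne fun e => h (Subtype.ext e)]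
    simp

open Classical in
/-- The contribution of the component `⊕_k H^{0k}` of a site to the character. -/
def zeroFactor (s : Equiv.Perm ℕ) (γ : ℕ → Γ) (m : ℕ) : ℂ :=
  if s m = m then (D.δ : ℂ) * inner ℂ D.ξ0 (D.ρ0 (γ m) D.ξ0) else 0

/-- If `s` fixes every site labelled by `ξ⁰`, the pattern of pairs is invariant and second factors
stay in place; the factors are then compared site by site. Otherwise a copy of `ξ⁰` arrives at a
site whose `η` is orthogonal to it, and both sides vanish. -/
theorem weight_mul_prod_inner {s : Equiv.Perm ℕ} {n : ℕ} (hs : FixesFrom s n) (γ : ℕ → Γ)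
    (x : Fin n → D.TLeg F) :
    (∏ i, D.weight F (x i)) * ∏ k ∈ Finset.range n, inner ℂ (D.η k)
      (D.gvec (moveFill s (fun m => D.gact (γ m) (D.fillOf F x m)) k)) =
      ∏ m : Fin n, D.siteMatrix F (γ m) (D.zeroFactor s γ m) (x ⟨s m, hs.lt m.2⟩) (x m) := by
  classical
  set c : ℕ → D.GFilling := fun m => D.gact (γ m) (D.fillOf F x m) with hc
  have hcx : ∀ m : Fin n, c m = D.gact (γ m) (D.etaFill F m (x m)) := by
    intro m; simp [hc, fillOf]
  have hinr : ∀ m : Fin n, ∀ u, x m = Sum.inr u →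
      c m = Sum.inr (lp.single 2 (m : ℕ) (D.ρ0 (γ m) D.ξ0)) := by
    intro m u h
    rw [hcx, h]
    change Sum.inr (lpRep (fun _ : ℕ => D.ρ0) (γ m) (lp.single 2 (m : ℕ) D.ξ0)) = _
    rw [lpRep_single]
  have hinl : ∀ m : Fin n, ∀ y, x m = Sum.inl y →
      c m = Sum.inl (⟨y.1, D.ρ y.1 (γ m) (D.e y.1 y.2)⟩, ⟨y.1, y.2⟩) := by
    intro m y h
    rw [hcx, h]
    rfl
  have hδ : ((√D.δ : ℝ) : ℂ) * ((√D.δ : ℝ) : ℂ) = D.δ := by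
    rw [← Complex.ofReal_mul, Real.mul_self_sqrt D.δ_nonneg]
  -- Target sites are written as `s m`, matching the factor at `s m` with the first tensor factor
  -- that left `m`.
  rw [← hs.prod_comp fun k => inner ℂ (D.η k) (D.gvec (moveFill s c k)), Finset.prod_range]
  by_cases hfix : ∀ m : Fin n, ∀ u, x m = Sum.inr u → s m = m
  · rw [← Finset.prod_mul_distrib]
    refine Finset.prod_congr rfl fun m _ => ?_
    rcases hxm : x m with y | u
    -- A site labelled by `ξ⁰` is fixed, so if `s m` were such a site it would equal `m`, which
    -- carries a pair.
    · have hne : ∀ u, x ⟨s m, hs.lt m.2⟩ ≠ Sum.inr u := by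
        intro u hu
        have h1 := hfix _ u hu
        have h2 : s m = m := s.injective h1
        have h3 : (⟨s m, hs.lt m.2⟩ : Fin n) = m := Fin.ext h2
        rw [h3, hxm] at hu
        cases hu
      rcases hxs : x ⟨s m, hs.lt m.2⟩ with z | u
      · have hinv : ∀ k < n, (IsPair c (s.symm k) ↔ IsPair c k) := by
          intro k hk
          have hk' := hs.symm.lt hk
          by_cases hsk : s.symm k = k
          · rw [hsk]
          have a1 : IsPair c (s.symm k) := by
            rcases h : x ⟨s.symm k, hk'⟩ with w | u
            · simp [IsPair, hinl ⟨s.symm k, hk'⟩ w h]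
            · have h4 := hfix _ u h
              simp only [Equiv.apply_symm_apply] at h4
              exact absurd h4.symm hsk
          have a2 : IsPair c k := by
            rcases h : x ⟨k, hk⟩ with w | u
            · simp [IsPair, hinl ⟨k, hk⟩ w h]
            · have h4 := hfix _ u h
              simp only at h4
              exact absurd (by rw [Equiv.symm_apply_eq, h4]) hsk
          exact ⟨fun _ => a2, fun _ => a1⟩
        have e1 : c (s.symm (s m)) = Sum.inl (⟨y.1, D.ρ y.1 (γ m) (D.e y.1 y.2)⟩, ⟨y.1, y.2⟩) := by
          rw [Equiv.symm_apply_apply, hinl m y hxm]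
        have e2 : c (s m) = _ := hinl ⟨s m, hs.lt m.2⟩ z hxs
        rw [moveFill_of_invariant hs hinv (hs.lt m.2) e1 e2, inner_η_gvec_inl, siteMatrix_inl_inl]
        rfl
      · exact absurd hxs (hne u)
    · have hsm := hfix m u hxm
      have h3 : (⟨s m, hs.lt m.2⟩ : Fin n) = m := Fin.ext hsm
      have e1 : c (s.symm (s m)) = Sum.inr (lp.single 2 (m : ℕ) (D.ρ0 (γ m) D.ξ0)) := by
        rw [Equiv.symm_apply_apply]
        exact hinr m u hxm
      rw [moveFill_inr e1, inner_η_gvec_inr, h3, hsm, lp.single_apply_self, hxm, siteMatrix,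
        Matrix.fromBlocks_apply₂₂, Matrix.of_apply, zeroFactor, if_pos hsm, ← hδ, ← mul_assoc]
      rfl
  · push Not at hfix
    obtain ⟨m, u, hxm, hsm⟩ := hfix
    have e1 : c (s.symm (s m)) = Sum.inr (lp.single 2 (m : ℕ) (D.ρ0 (γ m) D.ξ0)) := by
      rw [Equiv.symm_apply_apply]
      exact hinr m u hxm
    have h1 : inner ℂ (D.η (s m)) (D.gvec (moveFill s c (s m))) = 0 := by
      rw [moveFill_inr e1, inner_η_gvec_inr, lp.single_apply_ne _ _ _ hsm, inner_zero_right,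
        mul_zero]
    have h2 : D.siteMatrix F (γ m) (D.zeroFactor s γ m) (x ⟨s m, hs.lt m.2⟩) (x m) = 0 := by
      rw [hxm, siteMatrix]
      rcases x ⟨s m, hs.lt m.2⟩ with z | w
      · rfl
      · rw [Matrix.fromBlocks_apply₂₂, Matrix.of_apply, zeroFactor, if_neg hsm]
    rw [Finset.prod_eq_zero
      (f := fun i : Fin n => inner ℂ (D.η (s i)) (D.gvec (moveFill s c (s i))))
      (Finset.mem_univ m) h1, mul_zero]
    exact (Finset.prod_eq_zero (f := fun m : Fin n =>
      D.siteMatrix F (γ m) (D.zeroFactor s γ m) (x ⟨s m, hs.lt m.2⟩) (x m))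
      (Finset.mem_univ m) h2).symm

open Classical in
theorem betaSites_fillOf {n : ℕ} (γ : ℕ → Γ) (x : Fin n → D.TLeg F) :
    D.betaSites n (fun m => D.gact (γ m) (D.fillOf F x m)) =
      (Finset.univ.filter fun m => D.IsBetaLabel F (x m)).image Fin.val := by
  have h : ∀ m : Fin n, D.IsBetaGrade (D.grade (D.gact (γ m) (D.fillOf F x m))) ↔
      D.IsBetaLabel F (x m) := by
    intro m
    rw [grade_gact]
    have : D.fillOf F x m = D.etaFill F m (x m) := by simp [fillOf]
    rw [this]
    rcases x m with ⟨⟨r | r, hr⟩, j⟩ | u <;>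
      simp [IsBetaGrade, IsBetaLabel, grade, etaFill]
  ext k
  simp only [betaSites, Finset.mem_filter, Finset.mem_range, Finset.mem_image, Finset.mem_univ,
    true_and]
  constructor
  · rintro ⟨hk, hb⟩
    exact ⟨⟨k, hk⟩, (h ⟨k, hk⟩).1 hb, rfl⟩
  · rintro ⟨m, hb, rfl⟩
    exact ⟨m.2, (h m).2 hb⟩

/-- Only the vector acted upon is truncated; the vacuum on the left keeps all its terms. The
expansion is a finite sum over colourings, to which `sum_inversionSign_mul_prod` applies. -/
theorem inner_vacuum_headMap_ηTrunc (s : SInf) (γ : GammaInf Γ) {n : ℕ} (hs : FixesFrom s.1 n)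
    (hγ : ∀ m, n ≤ m → γ.1 m = 1) [Fintype (CyclesBelow s.1 n)] :
    inner ℂ D.vacuum (D.permRep s (D.gammaRep γ
      (headMap D.η D.norm_η n fun i => D.ηTrunc F i))) =
    ∏ q : CyclesBelow s.1 n,
      (∑ r ∈ F, (Sum.elim (fun _ => 1)
          (fun _ => (-1) ^ (Function.minimalPeriod s.1 q.1.out - 1)) r : ℂ) *
        (D.a r : ℂ) ^ Function.minimalPeriod s.1 q.1.out *
        LinearMap.trace ℂ (D.E r)
          ((D.ρ r (cycleProduct s γ q.1.out)).toLinearEquiv : D.E r →ₗ[ℂ] D.E r) +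
      ∏ i ∈ Finset.range (Function.minimalPeriod s.1 q.1.out),
        D.zeroFactor s.1 γ.1 ((s.1 ^ i) q.1.out)) := by
  classical
  rw [headMap_ηTrunc, map_sum, map_sum, inner_sum]
  have key := sum_inversionSign_mul_prod (D.IsBetaLabel F)
    (fun m => D.siteMatrix F (γ.1 m) (D.zeroFactor s.1 γ.1 m))
    (fun m => D.isBetaLabel_iff_of_siteMatrix_ne_zero F _ _) hs
  refine Eq.trans (Finset.sum_congr rfl fun x _ => ?_) (key.trans (Finset.prod_congr rfl fun q _ => ?_))
  · rw [map_smul, map_smul, D.gammaRep_gconfig γ hγ, D.permRep_apply s hs, inner_smul_right,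
      inner_smul_right, inner_vacuum_gconfig, gsign, betaSites_fillOf, mul_left_comm,
      D.weight_mul_prod_inner F hs γ.1 x]
  · exact D.sum_sign_mul_descProd F (fun i => γ.1 ((s.1 ^ i) q.1.out))
      (fun i => D.zeroFactor s.1 γ.1 ((s.1 ^ i) q.1.out)) _

/-- A cycle of length greater than one contains no fixed point, so the factor with `i = 0` already
vanishes. -/
theorem prod_zeroFactor {s : Equiv.Perm ℕ} {n : ℕ} (hs : FixesFrom s n) (γ : ℕ → Γ) (k : ℕ) :
    ∏ i ∈ Finset.range (Function.minimalPeriod s k), D.zeroFactor s γ ((s ^ i) k) =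
      if Function.minimalPeriod s k = 1 then
        (D.δ : ℂ) * inner ℂ D.ξ0 (D.ρ0 (descProd (fun i => γ ((s ^ i) k))
          (Function.minimalPeriod s k)) D.ξ0) else 0 := by
  split_ifs with h
  · have hk : s k = k := Function.minimalPeriod_eq_one_iff_isFixedPt.1 h
    rw [h, Finset.prod_range_one, pow_zero, descProd_succ, descProd_zero, mul_one, zeroFactor]
    simp [hk]
  · refine Finset.prod_eq_zero (Finset.mem_range.2 (hs.minimalPeriod_pos k)) ?_
    rw [zeroFactor, if_neg]
    intro hk
    exact h (Function.minimalPeriod_eq_one_iff_isFixedPt.2 hk)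

theorem norm_trace_le (r : D.ι ⊕ D.κ) (γ : Γ) :
    ‖LinearMap.trace ℂ (D.E r) ((D.ρ r γ).toLinearEquiv : D.E r →ₗ[ℂ] D.E r)‖ ≤
      Module.finrank ℂ (D.E r) := by
  rw [← trace_repMatrix, Matrix.trace]
  refine (norm_sum_le _ _).trans ?_
  have : ∀ j ∈ Finset.univ, ‖(D.repMatrix r γ).diag j‖ ≤ 1 := by
    intro j _
    rw [Matrix.diag_apply, repMatrix_apply]
    refine (norm_inner_le_norm _ _).trans ?_
    rw [LinearIsometryEquiv.norm_map, OrthonormalBasis.norm_eq_one, mul_one]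
  refine (Finset.sum_le_card_nsmul _ _ _ this).trans ?_
  simp

/-- For `l ≥ 1` the terms are dominated by `a_r dim ϱ^r`, since `0 < a_r < 1` and unitary traces are
bounded by the dimension. -/
theorem summable_cycleFactor {l : ℕ} (hl : 0 < l) (γ : Γ) : Summable fun r =>
    (Sum.elim (fun _ => 1) (fun _ => (-1) ^ (l - 1)) r : ℂ) * (D.a r : ℂ) ^ l *
      LinearMap.trace ℂ (D.E r) ((D.ρ r γ).toLinearEquiv : D.E r →ₗ[ℂ] D.E r) := by
  refine Summable.of_norm_bounded D.summable fun r => ?_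
  have h1 : ‖(Sum.elim (fun _ => 1) (fun _ => (-1) ^ (l - 1)) r : ℂ)‖ = 1 := by
    rcases r with r | r <;> simp
  have h2 : ‖(D.a r : ℂ) ^ l‖ ≤ D.a r := by
    rw [norm_pow, Complex.norm_real, Real.norm_of_nonneg (D.a_pos r).le]
    exact pow_le_of_le_one (D.a_pos r).le (D.a_lt_one r).le hl.ne'
  rw [norm_mul, norm_mul, h1, one_mul]
  exact mul_le_mul h2 (D.norm_trace_le r γ) (norm_nonneg _) (D.a_pos r).le

/-- The number `δ` completes the total mass to `1`. Consequently uncoloured fixed points contribute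
trivially and the product over all cycles is finite. -/
theorem cycleFactor_one : D.cycleFactor 1 1 = 1 := by
  have h1 : ∀ r, (Sum.elim (fun _ => 1) (fun _ => (-1) ^ (1 - 1)) r : ℂ) * (D.a r : ℂ) ^ 1 *
      LinearMap.trace ℂ (D.E r) ((D.ρ r 1).toLinearEquiv : D.E r →ₗ[ℂ] D.E r) =
      ((D.a r * Module.finrank ℂ (D.E r) : ℝ) : ℂ) := by
    intro r
    rw [← trace_repMatrix, map_one, Matrix.trace_one]
    rcases r with r | r <;> simp
  rw [cycleFactor, if_pos rfl, tsum_congr h1, map_one]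
  have h2 : inner ℂ D.ξ0 ((1 : D.H0 ≃ₗᵢ[ℂ] D.H0) D.ξ0) = 1 := by
    change inner ℂ D.ξ0 D.ξ0 = 1
    rw [inner_self_eq_norm_sq_to_K, D.ξ0_norm]
    simp
  rw [h2, mul_one, ← Complex.ofReal_tsum, ← Complex.ofReal_add, δ]
  simp

theorem cycleFactor_of_fixed {s : SInf} {γ : GammaInf Γ} {k : ℕ} (h1 : s.1 k = k)
    (h2 : γ.1 k = 1) :
    D.cycleFactor (Function.minimalPeriod s.1 k) (cycleProduct s γ k) = 1 := by
  have h : Function.minimalPeriod s.1 k = 1 := Function.minimalPeriod_eq_one_iff_isFixedPt.2 h1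
  rw [cycleProduct, h]
  simp [h2, cycleFactor_one]

theorem characterValue_eq_prod (s : SInf) (γ : GammaInf Γ) {n : ℕ}
    (hs : FixesFrom s.1 n) (hγ : ∀ m, n ≤ m → γ.1 m = 1) [Fintype (CyclesBelow s.1 n)] :
    D.characterValue s γ = ∏ q : CyclesBelow s.1 n,
      D.cycleFactor (Function.minimalPeriod s.1 q.1.out) (cycleProduct s γ q.1.out) := by
  rw [characterValue, finprod_eq_prod_of_mulSupport_subset
    (s := (Finset.univ : Finset (CyclesBelow s.1 n)).map (Function.Embedding.subtype _))]
  · rw [Finset.prod_map]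
    rfl
  · intro q hq
    rw [Finset.mem_coe, Finset.mem_map]
    by_contra h
    refine hq ?_
    have hout : n ≤ q.out := by
      by_contra hlt
      exact h ⟨⟨q, q.out, by omega, Quotient.out_eq q⟩, Finset.mem_univ _, rfl⟩
    exact D.cycleFactor_of_fixed (hs _ hout) (hγ _ hout)

/-- Both sides are limits over finite sets `F` of indices: on the left by continuity of the
multilinear map, on the right by summability in each of finitely many cycles. -/
theorem inner_vacuum_eq_characterValue (s : SInf) (γ : GammaInf Γ) :
    inner ℂ D.vacuum (D.permRep s (D.gammaRep γ D.vacuum)) = D.characterValue s γ := by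
  obtain ⟨n₁, hn₁⟩ := s.exists_fixesFrom
  obtain ⟨n₂, hn₂⟩ := eventually_atTop.1 γ.eventually_eq_one
  have hs : FixesFrom s.1 (n₁ + n₂) := hn₁.mono (by omega)
  have hγ : ∀ m, n₁ + n₂ ≤ m → γ.1 m = 1 := fun m hm => hn₂ m (by omega)
  set n := n₁ + n₂
  have : Fintype (CyclesBelow s.1 n) := Fintype.ofFinite _
  have hvac : D.vacuum = headMap D.η D.norm_η n fun i => D.η i :=
    productVector_eq_headVec D.η D.norm_η fun _ _ => rfl
  have hL : Tendsto (fun F => inner ℂ D.vacuum (D.permRep s (D.gammaRep γ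
      (headMap D.η D.norm_η n fun i => D.ηTrunc F i)))) atTop
      (nhds (inner ℂ D.vacuum (D.permRep s (D.gammaRep γ
        (headMap D.η D.norm_η n fun i => D.η i))))) := by
    have hcont : Continuous fun v => inner ℂ D.vacuum (D.permRep s (D.gammaRep γ v)) :=
      (innerSL ℂ D.vacuum).continuous.comp
        ((D.permRep s).continuous.comp (D.gammaRep γ).continuous)
    refine (hcont.tendsto _).comp (((headMap D.η D.norm_η n).cont.tendsto _).comp ?_)
    exact tendsto_pi_nhds.2 fun i => D.tendsto_ηTrunc i
  have hv : headMap D.η D.norm_η n (fun i : Fin n => D.η i) = D.vacuum := hvac.symm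
  rw [hv] at hL
  refine tendsto_nhds_unique hL ?_
  rw [D.characterValue_eq_prod s γ hs hγ]
  simp only [fun F => D.inner_vacuum_headMap_ηTrunc F s γ hs hγ]
  refine tendsto_finsetProd _ fun q _ => ?_
  rw [D.prod_zeroFactor hs]
  exact ((D.summable_cycleFactor (hs.minimalPeriod_pos _) _).hasSum.add_const _)

end OlshanskiData

/-! ### Centrality and multiplicativity of the character -/

theorem descProd_succ' {R : Type*} [Monoid R] (M : ℕ → R) (l : ℕ) :
    descProd M (l + 1) = descProd (fun i => M (i + 1)) l * M 0 := by
  induction l with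
  | zero => simp [descProd_succ, descProd_zero]
  | succ l ih => rw [descProd_succ, ih, ← mul_assoc, ← descProd_succ (fun i => M (i + 1))]

/-- The product telescopes. Around a cycle the two end factors are taken at the same point, so the
cycle product is conjugated. -/
theorem descProd_conj {G : Type*} [Group G] (c M : ℕ → G) (l : ℕ) :
    descProd (fun i => c (i + 1) * M i * (c i)⁻¹) l = c l * descProd M l * (c 0)⁻¹ := by
  induction l with
  | zero => simp [descProd_zero]
  | succ l ih => rw [descProd_succ, ih, descProd_succ]; group

theorem SInf.pow_minimalPeriod (s : SInf) (k : ℕ) :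
    (s.1 ^ Function.minimalPeriod s.1 k) k = k := by
  have h := Function.iterate_minimalPeriod (f := s.1) (x := k)
  rwa [← Equiv.Perm.coe_pow] at h

theorem minimalPeriod_congr {s u : Equiv.Perm ℕ} {k k' : ℕ} {f : ℕ → ℕ}
    (hf : Function.Injective f) (h : ∀ i : ℕ, (u ^ i) k' = f ((s ^ i) k)) :
    Function.minimalPeriod u k' = Function.minimalPeriod s k := by
  refine Function.minimalPeriod_eq_minimalPeriod_iff.2 fun i => ?_
  rw [Function.IsPeriodicPt, Function.IsFixedPt, Function.IsPeriodicPt, Function.IsFixedPt,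
    ← Equiv.Perm.coe_pow, ← Equiv.Perm.coe_pow, h]
  have h0 : k' = f k := h 0
  rw [h0]
  exact hf.eq_iff

/-- `k` is the smallest element of its cycle. -/
def IsCycleMin (s : Equiv.Perm ℕ) (k : ℕ) : Prop := ∀ j, s.SameCycle k j → k ≤ j

/-- Least elements index cycles by natural numbers, so products over the cycles of different
permutations become comparable factor by factor. -/
theorem bijective_mk_cycleMin (s : Equiv.Perm ℕ) :
    Function.Bijective fun k : {k | IsCycleMin s k} =>
      Quotient.mk (Equiv.Perm.SameCycle.setoid s) k.1 := by
  constructor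
  · intro k j h
    have h' : s.SameCycle k.1 j.1 := Quotient.exact h
    exact Subtype.ext (le_antisymm (k.2 _ h') (j.2 _ h'.symm))
  · intro q
    obtain ⟨k, rfl⟩ := Quotient.exists_rep q
    classical
    have hne : ∃ j, s.SameCycle k j := ⟨k, Equiv.Perm.SameCycle.refl s k⟩
    refine ⟨⟨Nat.find hne, fun j hj => Nat.find_min' hne ((Nat.find_spec hne).trans hj)⟩, ?_⟩
    exact Quotient.sound (Nat.find_spec hne).symm

namespace OlshanskiData

theorem cycleProduct_eq_descProd {Γ : Type u} [Group Γ] (s : SInf) (γ : GammaInf Γ) (k : ℕ) :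
    cycleProduct s γ k =
      descProd (fun i => γ.1 ((s.1 ^ i) k)) (Function.minimalPeriod s.1 k) := rfl

variable {Γ : Type u} [Group Γ] [TopologicalSpace Γ] (D : OlshanskiData Γ)

theorem cycleFactor_conj (l : ℕ) (g γ : Γ) :
    D.cycleFactor l (g * γ * g⁻¹) = D.cycleFactor l γ := by
  have h1 : ∀ r, LinearMap.trace ℂ (D.E r)
      ((D.ρ r (g * γ * g⁻¹)).toLinearEquiv : D.E r →ₗ[ℂ] D.E r) =
      LinearMap.trace ℂ (D.E r) ((D.ρ r γ).toLinearEquiv : D.E r →ₗ[ℂ] D.E r) := by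
    intro r
    rw [← trace_repMatrix, ← trace_repMatrix, map_mul, Matrix.trace_mul_comm, ← map_mul,
      inv_mul_cancel_left]
  rw [cycleFactor, cycleFactor, D.ξ0_trace, inv_mul_cancel_left]
  simp only [h1]

/-- The contribution of the cycle of `k` to the character. -/
def cycleValue (s : SInf) (γ : GammaInf Γ) (k : ℕ) : ℂ :=
  D.cycleFactor (Function.minimalPeriod s.1 k) (cycleProduct s γ k)

theorem cycleValue_congr {s u : SInf} {γ γ' : GammaInf Γ} {k k' : ℕ} {f : ℕ → ℕ}
    (hf : Function.Injective f) (h : ∀ i : ℕ, (u.1 ^ i) k' = f ((s.1 ^ i) k))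
    (hγ : ∀ i : ℕ, γ'.1 ((u.1 ^ i) k') = γ.1 ((s.1 ^ i) k)) :
    D.cycleValue u γ' k' = D.cycleValue s γ k := by
  rw [cycleValue, cycleValue, cycleProduct_eq_descProd, cycleProduct_eq_descProd,
    minimalPeriod_congr hf h, funext hγ]

theorem cycleValue_apply (s : SInf) (γ : GammaInf Γ) (k : ℕ) :
    D.cycleValue s γ (s.1 k) = D.cycleValue s γ k := by
  have h : ∀ i : ℕ, (s.1 ^ i) (s.1 k) = s.1 ((s.1 ^ i) k) := fun i => by
    rw [← Equiv.Perm.mul_apply, ← Equiv.Perm.mul_apply, (Commute.self_pow s.1 i).eq]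
  have hl := minimalPeriod_congr s.1.injective h
  have h' : cycleProduct s γ (s.1 k) = γ.1 k * cycleProduct s γ k * (γ.1 k)⁻¹ := by
    rw [eq_mul_inv_iff_mul_eq, cycleProduct_eq_descProd, cycleProduct_eq_descProd, hl]
    -- A product of one more factor than the period is split at either end; both end factors are `γ
    -- k`, since the orbit has returned to `k`.
    have h1 := descProd_succ (fun i => γ.1 ((s.1 ^ i) k)) (Function.minimalPeriod s.1 k)
    rw [descProd_succ'] at h1
    simpa only [pow_succ, Equiv.Perm.mul_apply, pow_zero, Equiv.Perm.one_apply,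
      s.pow_minimalPeriod] using h1
  rw [cycleValue, cycleValue, h', cycleFactor_conj, hl]

theorem cycleValue_of_sameCycle (s : SInf) (γ : GammaInf Γ) {k j : ℕ} (h : s.1.SameCycle k j) :
    D.cycleValue s γ j = D.cycleValue s γ k := by
  obtain ⟨i, rfl⟩ := h
  induction i using Int.induction_on with
  | zero => rfl
  | succ i ih => rw [add_comm, zpow_one_add, Equiv.Perm.mul_apply, cycleValue_apply, ih]
  | pred i ih =>
    rw [← ih, ← cycleValue_apply, ← Equiv.Perm.mul_apply, ← zpow_one_add]
    congr 3
    ring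

theorem characterValue_eq_finprod_mem (s : SInf) (γ : GammaInf Γ) :
    D.characterValue s γ = ∏ᶠ k ∈ {k | IsCycleMin s.1 k}, D.cycleValue s γ k := by
  rw [← finprod_set_coe_eq_finprod_mem]
  refine (finprod_eq_of_bijective _ (bijective_mk_cycleMin s.1) fun k => ?_).symm
  exact D.cycleValue_of_sameCycle s γ (sameCycle_out s.1 k.1)

/-- The permutation `t` carries cycles with their colours to cycles of `t * s * t⁻¹`. It need not
respect the chosen representatives, but the contribution depends only on the cycle. -/
theorem characterValue_conj_inr (s t : SInf) (γ : GammaInf Γ) :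
    D.characterValue (t * s * t⁻¹) (permAction Γ t γ) = D.characterValue s γ := by
  have h : ∀ (i : ℕ) k, ((t * s * t⁻¹ : SInf).1 ^ i) (t.1 k) = t.1 ((s.1 ^ i) k) := by
    intro i k
    change ((t.1 * s.1 * t.1⁻¹) ^ i) (t.1 k) = _
    rw [conj_pow]
    simp
  let e : Cycles s.1 ≃ Cycles (t * s * t⁻¹ : SInf).1 :=
    Quotient.congr t.1 fun a b => by
      change s.1.SameCycle a b ↔ (t.1 * s.1 * t.1⁻¹).SameCycle (t.1 a) (t.1 b)
      rw [Equiv.Perm.sameCycle_conj]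
      simp
  refine (finprod_eq_of_bijective e e.bijective fun q => ?_).symm
  have h1 : D.cycleValue (t * s * t⁻¹) (permAction Γ t γ) (t.1 q.out) =
      D.cycleValue s γ q.out := by
    refine D.cycleValue_congr t.1.injective (fun i => h i _) fun i => ?_
    rw [h]
    change γ.1 (t.1.symm (t.1 _)) = _
    rw [Equiv.symm_apply_apply]
  have h2 : (t * s * t⁻¹ : SInf).1.SameCycle (e q).out (t.1 q.out) := by
    refine Quotient.exact (s := Equiv.Perm.SameCycle.setoid _) ?_
    rw [Quotient.out_eq]
    conv_lhs => rw [← Quotient.out_eq q]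
    rfl
  exact h1.symm.trans (D.cycleValue_of_sameCycle _ _ h2)

/-- Moving `c` past `s` replaces the colour at `k` by `c(s k) γ(k) c(k)⁻¹`, which telescopes to a
conjugation of every cycle product. -/
theorem characterValue_conj_inl (s : SInf) (γ c : GammaInf Γ) :
    D.characterValue s (permAction Γ s⁻¹ c * γ * c⁻¹) = D.characterValue s γ := by
  refine finprod_congr fun q => ?_
  have h : cycleProduct s (permAction Γ s⁻¹ c * γ * c⁻¹) q.out =
      c.1 q.out * cycleProduct s γ q.out * (c.1 q.out)⁻¹ := by
    have h1 : ∀ i : ℕ, (permAction Γ s⁻¹ c * γ * c⁻¹).1 ((s.1 ^ i) q.out) =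
        c.1 ((s.1 ^ (i + 1)) q.out) * γ.1 ((s.1 ^ i) q.out) * (c.1 ((s.1 ^ i) q.out))⁻¹ := by
      intro i
      rw [pow_succ', Equiv.Perm.mul_apply]
      rfl
    rw [cycleProduct_eq_descProd, funext h1, descProd_conj fun i => c.1 ((s.1 ^ i) q.out),
      s.pow_minimalPeriod]
    rfl
  rw [h, cycleFactor_conj]

theorem cycleValue_of_fixed {s : SInf} {γ : GammaInf Γ} {k : ℕ} (h1 : s.1 k = k)
    (h2 : γ.1 k = 1) : D.cycleValue s γ k = 1 := D.cycleFactor_of_fixed h1 h2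

theorem hasFiniteMulSupport_cycleValue (s : SInf) (γ : GammaInf Γ) (A : Set ℕ) :
    (A.mulIndicator (D.cycleValue s γ)).HasFiniteMulSupport := by
  classical
  obtain ⟨n₁, hn₁⟩ := s.exists_fixesFrom
  obtain ⟨n₂, hn₂⟩ := eventually_atTop.1 γ.eventually_eq_one
  refine (Set.finite_Iio (n₁ + n₂)).subset fun k hk => ?_
  by_contra hlt
  have hle : n₁ + n₂ ≤ k := not_lt.1 hlt
  refine hk ?_
  rw [Set.mulIndicator_apply]
  split_ifs
  · exact D.cycleValue_of_fixed (hn₁ k (by omega)) (hn₂ k (by omega))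
  · rfl

/-- The character is multiplicative on elements with disjoint supports. -/
theorem characterValue_mul {s t : SInf} {γ c : GammaInf Γ} {N : ℕ} (hs : FixesFrom s.1 N)
    (hγ : ∀ m, N ≤ m → γ.1 m = 1) (ht : ∀ m < N, t.1 m = m) (hc : ∀ m < N, c.1 m = 1) :
    D.characterValue (s * t) (γ * c) = D.characterValue s γ * D.characterValue t c := by
  have hlow : ∀ k < N, ∀ i : ℕ, ((s * t : SInf).1 ^ i) k = (s.1 ^ i) k := by
    intro k hk i
    induction i with
    | zero => rfl
    | succ i ih =>
      rw [pow_succ', pow_succ', Equiv.Perm.mul_apply, ih, Equiv.Perm.mul_apply]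
      change s.1 (t.1 _) = _
      rw [ht _ ((hs.pow i).lt hk)]
  have htge : ∀ k, N ≤ k → N ≤ t.1 k := by
    intro k hk
    by_contra hlt
    have := t.1.injective (ht _ (not_le.1 hlt))
    omega
  have htpow : ∀ k, N ≤ k → ∀ i : ℕ, N ≤ (t.1 ^ i) k := by
    intro k hk i
    induction i with
    | zero => exact hk
    | succ i ih => rw [pow_succ', Equiv.Perm.mul_apply]; exact htge _ ih
  have hhigh : ∀ k, N ≤ k → ∀ i : ℕ, ((s * t : SInf).1 ^ i) k = (t.1 ^ i) k := by
    intro k hk i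
    induction i with
    | zero => rfl
    | succ i ih =>
      rw [pow_succ', pow_succ', Equiv.Perm.mul_apply, ih, Equiv.Perm.mul_apply]
      change s.1 (t.1 _) = _
      rw [hs _ (htge _ (htpow k hk i))]
  -- A cycle of a finite permutation is exhausted by nonnegative powers, so agreement of forward
  -- orbits transfers minimality.
  have hmin : ∀ {u v : SInf} {k : ℕ}, (∀ i : ℕ, (u.1 ^ i) k = (v.1 ^ i) k) →
      (IsCycleMin u.1 k → IsCycleMin v.1 k) := by
    intro u v k h hu j hj
    obtain ⟨n, hn⟩ := v.exists_fixesFrom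
    obtain ⟨i, -, rfl⟩ := hn.exists_pow_eq hj
    exact hu _ ⟨i, by rw [zpow_natCast, h]⟩
  have hmin' : ∀ {u v : SInf} {k : ℕ}, (∀ i : ℕ, (u.1 ^ i) k = (v.1 ^ i) k) →
      (IsCycleMin u.1 k ↔ IsCycleMin v.1 k) :=
    fun h => ⟨hmin h, hmin fun i => (h i).symm⟩
  classical
  simp only [characterValue_eq_finprod_mem, finprod_mem_def]
  rw [← finprod_mul_distrib (D.hasFiniteMulSupport_cycleValue _ _ _)
    (D.hasFiniteMulSupport_cycleValue _ _ _)]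
  refine finprod_congr fun k => ?_
  simp only [Set.mulIndicator_apply, Set.mem_ofPred_eq]
  -- Below `N` the product behaves as `s` with colours `γ`, above as `t` with colours `c`; the other
  -- element contributes `1` there.
  by_cases hk : k < N
  · have h1 : D.cycleValue t c k = 1 := D.cycleValue_of_fixed (ht k hk) (hc k hk)
    have h2 : D.cycleValue (s * t) (γ * c) k = D.cycleValue s γ k := by
      refine D.cycleValue_congr Function.injective_id (hlow k hk) fun i => ?_
      rw [hlow k hk]
      change γ.1 _ * c.1 _ = _
      rw [hc _ ((hs.pow i).lt hk), mul_one]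
    rw [h1, h2, ite_self, mul_one]
    simp only [hmin' (hlow k hk)]
  · have hk' := not_lt.1 hk
    have h1 : D.cycleValue s γ k = 1 := D.cycleValue_of_fixed (hs k hk') (hγ k hk')
    have h2 : D.cycleValue (s * t) (γ * c) k = D.cycleValue t c k := by
      refine D.cycleValue_congr Function.injective_id (hhigh k hk') fun i => ?_
      rw [hhigh k hk']
      change γ.1 _ * c.1 _ = _
      rw [hγ _ (htpow k hk' i), one_mul]
    rw [h1, h2, ite_self, one_mul]
    simp only [hmin' (hhigh k hk')]

end OlshanskiData

/-! ### The main theorem -/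

section BlockSwap

/-- The function which exchanges `i` and `N + i` for `i < n`. -/
def blockSwapFun (n N k : ℕ) : ℕ :=
  if k < n then N + k else if N ≤ k ∧ k < N + n then k - N else k

theorem blockSwapFun_involutive {n N : ℕ} (h : n ≤ N) :
    Function.Involutive (blockSwapFun n N) := by
  intro k
  simp only [blockSwapFun]
  split_ifs <;> omega

/-- The permutation which exchanges `i` and `N + i` for `i < n`. -/
def blockSwap {n N : ℕ} (h : n ≤ N) : SInf :=
  ⟨(blockSwapFun_involutive h).toPerm, (Set.finite_Iio (N + n)).subset fun k hk => by
    by_contra hlt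
    refine hk ?_
    have : N + n ≤ k := not_lt.1 hlt
    change blockSwapFun n N k = k
    simp only [blockSwapFun]
    split_ifs <;> omega⟩

/-- Conjugation by the swap therefore moves anything supported below `n` to sites from `N` on. -/
theorem blockSwap_symm_apply_ge {n N : ℕ} (h : n ≤ N) {k : ℕ} (hk : k < N) :
    n ≤ (blockSwap h).1.symm k := by
  change n ≤ blockSwapFun n N k
  simp only [blockSwapFun]
  split_ifs <;> omega

end BlockSwap

theorem Wreath.inl_mul_inr {Γ : Type u} [Group Γ] (s : SInf) (γ : GammaInf Γ) :
    (SemidirectProduct.inl γ : Wreath Γ) * SemidirectProduct.inr s =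
      SemidirectProduct.inr s * SemidirectProduct.inl (permAction Γ s⁻¹ γ) := by
  rw [map_inv (permAction Γ), SemidirectProduct.inl_aut_inv, map_inv, mul_assoc,
    mul_inv_cancel_left]

theorem Wreath.eq_inr_mul_inl {Γ : Type u} [Group Γ] (g : Wreath Γ) :
    ∃ s γ, g = SemidirectProduct.inr s * SemidirectProduct.inl γ := by
  refine ⟨g.right, permAction Γ g.right⁻¹ g.left, ?_⟩
  rw [← Wreath.inl_mul_inr, SemidirectProduct.inl_left_mul_inr_right]

theorem Wreath.inr_mul_inl_mul {Γ : Type u} [Group Γ] (s t : SInf) (γ c : GammaInf Γ) :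
    (SemidirectProduct.inr s * SemidirectProduct.inl γ : Wreath Γ) *
      (SemidirectProduct.inr t * SemidirectProduct.inl c) =
      SemidirectProduct.inr (s * t) * SemidirectProduct.inl (permAction Γ t⁻¹ γ * c) := by
  rw [map_mul, map_mul, mul_assoc, ← mul_assoc (SemidirectProduct.inl γ), Wreath.inl_mul_inr]
  simp only [mul_assoc]

theorem Wreath.inr_mul_conj {Γ : Type u} [Group Γ] (s t : SInf) (γ : GammaInf Γ) :
    (SemidirectProduct.inr t : Wreath Γ) *
      (SemidirectProduct.inr s * SemidirectProduct.inl γ) * (SemidirectProduct.inr t)⁻¹ =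
      SemidirectProduct.inr (t * s * t⁻¹) * SemidirectProduct.inl (permAction Γ t γ) := by
  have h1 := Wreath.inr_mul_inl_mul t s (1 : GammaInf Γ) γ
  have h2 := Wreath.inr_mul_inl_mul (t * s) t⁻¹ γ (1 : GammaInf Γ)
  simp only [map_one, mul_one, one_mul, inv_inv] at h1 h2
  rw [h1, ← map_inv, h2]

namespace OlshanskiData

variable {Γ : Type u} [Group Γ] [TopologicalSpace Γ] (D : OlshanskiData Γ)

theorem norm_vacuum : ‖D.vacuum‖ = 1 := by
  have h : inner ℂ D.vacuum D.vacuum = 1 := by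
    rw [inner_productVector D.η D.norm_η _ _ (Eventually.of_forall fun _ => rfl)
      (Eventually.of_forall fun _ => rfl)]
    refine finprod_eq_one_of_forall_eq_one fun m => ?_
    rw [inner_self_eq_norm_sq_to_K, D.norm_η]
    simp
  rw [norm_eq_sqrt_re_inner (𝕜 := ℂ), h]
  simp

theorem coefficient_wreathRep (s : SInf) (γ : GammaInf Γ) :
    D.coefficient D.wreathRep (SemidirectProduct.inr s * SemidirectProduct.inl γ) =
      D.characterValue s γ := by
  rw [coefficient, rep_mul_apply, wreathRep_inr, wreathRep_inl, inner_vacuum_eq_characterValue]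

theorem coefficient_conj_inr (t : SInf) (g : Wreath Γ) :
    D.coefficient D.wreathRep (SemidirectProduct.inr t * g * (SemidirectProduct.inr t)⁻¹) =
      D.coefficient D.wreathRep g := by
  obtain ⟨s, γ, rfl⟩ := Wreath.eq_inr_mul_inl g
  rw [Wreath.inr_mul_conj, coefficient_wreathRep, coefficient_wreathRep, characterValue_conj_inr]

theorem coefficient_conj_inl (c : GammaInf Γ) (g : Wreath Γ) :
    D.coefficient D.wreathRep (SemidirectProduct.inl c * g * (SemidirectProduct.inl c)⁻¹) =
      D.coefficient D.wreathRep g := by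
  obtain ⟨s, γ, rfl⟩ := Wreath.eq_inr_mul_inl g
  have h1 := Wreath.inr_mul_inl_mul 1 s c γ
  have h2 := Wreath.inr_mul_inl_mul s 1 (permAction Γ s⁻¹ c * γ) c⁻¹
  simp only [map_one, mul_one, one_mul, inv_one, MulAut.one_apply] at h1 h2
  rw [h1, ← map_inv, h2, coefficient_wreathRep, coefficient_wreathRep, characterValue_conj_inl]

/-- Since `h g` is the conjugate of `g h` by `h`, invariance under conjugation by the two subgroups
suffices. -/
theorem coefficient_mul_comm (g h : Wreath Γ) :
    D.coefficient D.wreathRep (g * h) = D.coefficient D.wreathRep (h * g) := by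
  obtain ⟨s, γ, hh⟩ := Wreath.eq_inr_mul_inl h
  have h1 : h * (g * h) * h⁻¹ = h * g := by group
  have h2 : h * (g * h) * h⁻¹ = SemidirectProduct.inr s * (SemidirectProduct.inl γ * (g * h) *
      (SemidirectProduct.inl γ)⁻¹) * (SemidirectProduct.inr s)⁻¹ := by
    rw [hh]
    group
  rw [← h1, h2, coefficient_conj_inr, coefficient_conj_inl]

/-- Block swaps carry `h` beyond the support of any given `h'`; disjoint supports give
multiplicativity, and conjugation leaves the value at `h` unchanged. -/
theorem exists_asymptotic_mul (h : Wreath Γ) : ∃ g : ℕ → Wreath Γ, ∀ h', ∀ᶠ k in atTop,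
    D.coefficient D.wreathRep (h' * (g k * h * (g k)⁻¹)) =
      D.coefficient D.wreathRep h' * D.coefficient D.wreathRep h := by
  obtain ⟨s, γ, rfl⟩ := Wreath.eq_inr_mul_inl h
  obtain ⟨n₁, hn₁⟩ := s.exists_fixesFrom
  obtain ⟨n₂, hn₂⟩ := eventually_atTop.1 γ.eventually_eq_one
  -- The target block starts at `n₁ + n₂ + N`, so that it is disjoint from the original block for
  -- every `N`.
  let t : ℕ → SInf := fun N => blockSwap (n := n₁ + n₂) (N := n₁ + n₂ + N) (by omega)
  refine ⟨fun N => SemidirectProduct.inr (t N), fun h' => ?_⟩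
  obtain ⟨s', γ', rfl⟩ := Wreath.eq_inr_mul_inl h'
  obtain ⟨m₁, hm₁⟩ := s'.exists_fixesFrom
  obtain ⟨m₂, hm₂⟩ := eventually_atTop.1 γ'.eventually_eq_one
  filter_upwards [eventually_ge_atTop (m₁ + m₂)] with N hN
  have hge : ∀ m < n₁ + n₂ + N, n₁ + n₂ ≤ (t N).1.symm m := fun m hm =>
    blockSwap_symm_apply_ge _ hm
  have ht : ∀ m < n₁ + n₂ + N, (t N * s * (t N)⁻¹ : SInf).1 m = m := by
    intro m hm
    change (t N).1 (s.1 ((t N).1.symm m)) = m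
    rw [hn₁ _ (by have := hge m hm; omega), Equiv.apply_symm_apply]
  have hc : ∀ m < n₁ + n₂ + N, (permAction Γ (t N) γ).1 m = 1 := fun m hm =>
    hn₂ _ (by have := hge m hm; omega)
  have hs' : FixesFrom s'.1 (n₁ + n₂ + N) := hm₁.mono (by omega)
  have hγ' : ∀ m, n₁ + n₂ + N ≤ m → γ'.1 m = 1 := fun m hm => hm₂ m (by omega)
  -- The colours of `h'` live below the moved block, so the conjugated permutation leaves them in
  -- place.
  have hfix : permAction Γ (t N * s * (t N)⁻¹)⁻¹ γ' = γ' := by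
    refine Subtype.ext (funext fun m => ?_)
    change γ'.1 ((t N * s * (t N)⁻¹ : SInf).1 m) = γ'.1 m
    by_cases hm : m < n₁ + n₂ + N
    · rw [ht m hm]
    · rw [hγ' m (not_lt.1 hm), hγ']
      by_contra hlt
      have := (t N * s * (t N)⁻¹ : SInf).1.injective (ht _ (not_le.1 hlt))
      omega
  rw [Wreath.inr_mul_conj, Wreath.inr_mul_inl_mul, hfix]
  simp only [coefficient_wreathRep]
  rw [D.characterValue_mul hs' hγ' ht hc, characterValue_conj_inr]

theorem isIndecomposableCharacter_coefficient [IsTopologicalGroup Γ] :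
    IsIndecomposableCharacter (D.coefficient D.wreathRep) :=
  isIndecomposableCharacter_of_asymptotic_mul D.wreathRep D.vacuum D.norm_vacuum
    D.isStronglyContinuous_wreathRep D.coefficient_mul_comm D.exists_asymptotic_mul

end OlshanskiData

theorem mainTheorem5 {Γ : Type u} [Group Γ] [TopologicalSpace Γ] [IsTopologicalGroup Γ]
    (D : OlshanskiData Γ) :
    ∃ π : Wreath Γ →* (D.Space ≃ₗᵢ[ℂ] D.Space),
      D.IsRealization π ∧ (∀ π', D.IsRealization π' → π' = π) ∧ IsStronglyContinuous π ∧
        IsIndecomposableCharacter (D.coefficient π) ∧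
        ∀ (s : SInf) (γ : GammaInf Γ),
          D.coefficient π (SemidirectProduct.inr s * SemidirectProduct.inl γ) =
            D.characterValue s γ :=
  ⟨D.wreathRep, D.isRealization_wreathRep, fun _ h =>
    OlshanskiData.IsRealization.ext D D.isRealization_wreathRep h,
    D.isStronglyContinuous_wreathRep, D.isIndecomposableCharacter_coefficient,
    D.coefficient_wreathRep⟩

end
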